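/- Let $n\ge 2$ and let $(\mathcal S_0,\sigma_{ij})$ be a nonempty compact smooth $n$-dimensional Riemannian manifold (without boundary), with scalar curvature $R$, Laplace–Beltrami operator $\Delta$ and Riemannian volume measure. Let $\mathcal G$ be a compact, connected, semi-simple Lie group with Lie algebra $\mathfrak g$, structure constants $f^a_{bc}$ and Cartan–Killing metric $\gamma_{ab}$ (minus the Killing form), let $E_0=(\mathcal S_0,\mathfrak g,\pi,\mathrm{Ad}(\mathcal G))$ be a smooth adjoint bundle, i.e. a smooth vector bundle with fibre $\mathfrak g$ and transition functions with values in $\mathrm{Ad}(\mathcal G)$, and let $A=(A^a_i)$ be a smooth connection in $E_0$ with curvature $F^a_{ij}=\partial_iA^a_j-\partial_jA^a_i+f^a_{bc}A^b_iA^c_j$ and $F_{ij}F^{ij}=\gamma_{ab}\sigma^{ik}\sigma^{jl}F^a_{ij}F^b_{kl}$. Let the Higgs field be either a smooth section $\Phi=(\Phi^a)$ of $E_0$, with covariant derivative $\Phi^a_i=\partial_i\Phi^a+f^a_{cb}A^c_i\Phi^b$ and a smooth potential $V:E_0\to\mathbb R$, or a smooth scalar field $\Phi:\mathcal S_0\to\mathbb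 R^N$, with $\Phi^a_i=\partial_i\Phi^a$, $\gamma_{ab}=\delta_{ab}$ and a smooth potential $V:\mathbb R^N\to\mathbb R$. Let $\alpha_1,\alpha_2>0$, and for real $m\ge 0$ consider the eigenvalue problem for complex-valued functions $$-(n-1)\Delta v-\tfrac n2Rv+\alpha_1\tfrac n8F_{ij}F^{ij}v+\alpha_2\tfrac n4\gamma_{ab}\sigma^{ij}\Phi^a_i\Phi^b_jv+\alpha_2\tfrac n2\,m\,V(\Phi)v=\mu v\qquad\text{on }\mathcal S_0, \tag{1}$$ where $\mu\in\mathbb R$ is called an eigenvalue if some $v\in H^{1,2}(\mathcal S_0,\mathbb C)$, $v\ne0$, solves (1) in the sense of distributions. Suppose that $V(\Phi)>0$ almost everywhere in $\mathcal S_0$. Then there are constants $m_0\ge0$ and $c>0$, depending only on the data $n,\mathcal S_0,\sigma,A,\Phi,V,\alpha_1,\alpha_2$ and not on $m$, such that for every $m\ge m_0$ the problem (1) has a smallest eigenvalue $\mu_0$, and $$\mu_0\ \ge\ c\ >\ 0 .$$ Moreover $\mu_0\le\mu$ whenever (1) holds pointwise for some smooth $v\not\equiv0$ and some $\mu\in\mathbb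 R$. -/

import Mathlib

open scoped Manifold ContDiff
open Bundle MeasureTheory

namespace YMHiggs

/-- A smooth real Lie group is of class `C^3`; this is the regularity under which Mathlib puts the
Lie algebra structure on the tangent space at the identity. -/
instance instLieGroupMinSmoothness {𝔤 G : Type*} [NormedAddCommGroup 𝔤] [NormedSpace ℝ 𝔤]
    [TopologicalSpace G] [ChartedSpace 𝔤 G] [Group G] [LieGroup 𝓘(ℝ, 𝔤) ∞ G] :
    LieGroup 𝓘(ℝ, 𝔤) (minSmoothness ℝ 3) G :=
  LieGroup.of_le (n := ∞) (by
    rw [minSmoothness_of_isRCLikeNormedField]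
    exact WithTop.coe_le_coe.2 le_top)

section LocalCoordinates

variable {n : ℕ} {S : Type*} [TopologicalSpace S] [ChartedSpace (EuclideanSpace ℝ (Fin n)) S]

/-- The partial derivative `∂_k f` of a function on `ℝⁿ`. -/
noncomputable def pd {F : Type*} [NormedAddCommGroup F] [NormedSpace ℝ F]
    (k : Fin n) (f : EuclideanSpace ℝ (Fin n) → F) (y : EuclideanSpace ℝ (Fin n)) : F :=
  fderiv ℝ f y (EuclideanSpace.single k 1)

/-- The point of the manifold with coordinates `y` in the preferred chart around `x`. -/
noncomputable def pt (x : S) (y : EuclideanSpace ℝ (Fin n)) : S :=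
  (chartAt (EuclideanSpace ℝ (Fin n)) x).symm y

/-- The coordinates of `x` in the preferred chart around `x`. -/
noncomputable def ctr (x : S) : EuclideanSpace ℝ (Fin n) :=
  chartAt (EuclideanSpace ℝ (Fin n)) x x

/-- The coordinate vector field `∂_k` of the preferred chart around `x`, at the point with
coordinates `y`. -/
noncomputable def frame (x : S) (k : Fin n) (y : EuclideanSpace ℝ (Fin n)) :
    TangentSpace (𝓡 n) (pt x y) :=
  mfderiv (𝓡 n) (𝓡 n) (pt x) y (EuclideanSpace.single k (1 : ℝ) : EuclideanSpace ℝ (Fin n))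

end LocalCoordinates

section Riemannian

variable {n : ℕ} {S : Type*} [TopologicalSpace S] [ChartedSpace (EuclideanSpace ℝ (Fin n)) S]
  [IsManifold (𝓡 n) ∞ S]

variable (n S) in
/-- Smooth Riemannian metrics on `S`. -/
abbrev Metric : Type _ :=
  ContMDiffRiemannianMetric (𝓡 n) ∞ (EuclideanSpace ℝ (Fin n))
    (fun p : S => TangentSpace (𝓡 n) p)

/-- The components `σ_{ij}` of the metric in the preferred chart around `x`. -/
noncomputable def gram (σ : Metric n S) (x : S) (y : EuclideanSpace ℝ (Fin n)) :
    Matrix (Fin n) (Fin n) ℝ :=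
  Matrix.of fun i j => σ.inner (pt x y) (frame x i y) (frame x j y)

/-- The components `σ^{ij}` of the inverse metric. -/
noncomputable def gramInv (σ : Metric n S) (x : S) (y : EuclideanSpace ℝ (Fin n)) :
    Matrix (Fin n) (Fin n) ℝ :=
  (gram σ x y)⁻¹

/-- The Riemannian density `√(det σ_{ij})`. -/
noncomputable def density (σ : Metric n S) (x : S) (y : EuclideanSpace ℝ (Fin n)) : ℝ :=
  Real.sqrt (gram σ x y).det

/-- The Riemannian volume measure. For every `x`, the measure `√(det σ_{ij}) dy` on the image of the
preferred chart around `x` is transported to the manifold, where it is concentrated on the domain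
of that chart; any two of these measures coincide on the overlap of the chart domains, and the
volume measure is the least measure dominating all of them, i.e. the measure obtained by gluing. -/
noncomputable def vol [MeasurableSpace S] (σ : Metric n S) : Measure S :=
  ⨆ x : S, Measure.map (pt x)
    ((volume.restrict (chartAt (EuclideanSpace ℝ (Fin n)) x).target).withDensity
      fun y => ENNReal.ofReal (density σ x y))

/-- The Christoffel symbols `Γ^k_{ij}`. -/
noncomputable def christoffel (σ : Metric n S) (x : S) (k i j : Fin n)
    (y : EuclideanSpace ℝ (Fin n)) : ℝ :=
  (1 / 2) * ∑ l, gramInv σ x y k l *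
    (pd i (fun z => gram σ x z j l) y + pd j (fun z => gram σ x z i l) y
      - pd l (fun z => gram σ x z i j) y)

/-- The Ricci tensor
`R_{ij} = ∂_k Γ^k_{ij} - ∂_j Γ^k_{ik} + Γ^k_{kl} Γ^l_{ij} - Γ^k_{jl} Γ^l_{ik}`. -/
noncomputable def ricci (σ : Metric n S) (x : S) (i j : Fin n)
    (y : EuclideanSpace ℝ (Fin n)) : ℝ :=
  ∑ k, (pd k (christoffel σ x k i j) y - pd j (christoffel σ x k i k) y)
    + ∑ k, ∑ l, (christoffel σ x k k l y * christoffel σ x l i j y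
      - christoffel σ x k j l y * christoffel σ x l i k y)

/-- The scalar curvature `R = σ^{ij} R_{ij}` (positive on round spheres of dimension at least 2). -/
noncomputable def scalarCurvature (σ : Metric n S) (p : S) : ℝ :=
  ∑ i, ∑ j, gramInv σ p (ctr p) i j * ricci σ p i j (ctr p)

/-- The Laplace-Beltrami operator `Δv = (1/√σ) ∂_i (√σ σ^{ij} ∂_j v)` on complex functions. -/
noncomputable def laplacian (σ : Metric n S) (v : S → ℂ) (p : S) : ℂ :=
  (1 / (density σ p (ctr p) : ℂ)) * ∑ i, pd i (fun y =>
    (density σ p y : ℂ) * ∑ j, (gramInv σ p y i j : ℂ) * pd j (fun z => v (pt p z)) y) (ctr p)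

/-- The squared length `|Dv|² = σ^{ij} v_i \bar v_j` of the gradient of a complex function. -/
noncomputable def gradSq (σ : Metric n S) (v : S → ℂ) (p : S) : ℝ :=
  (∑ i, ∑ j, (gramInv σ p (ctr p) i j : ℂ) *
    (pd i (fun z => v (pt p z)) (ctr p) *
      (starRingEnd ℂ) (pd j (fun z => v (pt p z)) (ctr p)))).re

/-- The Sobolev space `H^{1,2}(S, ℂ)`: the completion of the smooth functions with respect to the
norm `(∫ |u|² + ∫ |Du|²)^{1/2}`, realised inside `L²`. Thus `v` belongs to it iff it is the `L²`-limit
of smooth functions whose gradients form a Cauchy sequence in `L²`. -/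
def MemSobolev [MeasurableSpace S] (σ : Metric n S) (v : S → ℂ) : Prop :=
  MemLp v 2 (vol σ) ∧ ∃ u : ℕ → S → ℂ, (∀ k, ContMDiff (𝓡 n) 𝓘(ℝ, ℂ) ∞ (u k)) ∧
    Filter.Tendsto (fun k => eLpNorm (u k - v) 2 (vol σ)) Filter.atTop (nhds 0) ∧
    ∀ ε : ℝ, 0 < ε → ∃ K : ℕ, ∀ k ≥ K, ∀ l ≥ K, ∫ p, gradSq σ (u k - u l) p ∂(vol σ) < ε

end Riemannian

section Gauge

variable {𝔤 : Type*} [NormedAddCommGroup 𝔤] [NormedSpace ℝ 𝔤]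
  (G : Type*) [TopologicalSpace G] [ChartedSpace 𝔤 G] [Group G]

/- The Lie group `G` is modelled on the vector space `𝔤`, which therefore is the tangent space of
`G` at the identity, i.e. the vector space underlying its Lie algebra. -/

/-- The Lie bracket of the Lie algebra of `G`. -/
noncomputable def bracket (X Y : 𝔤) : 𝔤 :=
  Bracket.bracket (L := GroupLieAlgebra 𝓘(ℝ, 𝔤) G) (M := GroupLieAlgebra 𝓘(ℝ, 𝔤) G) X Y

variable {G} in
/-- The adjoint representation: `Ad h` is the derivative of `x ↦ h x h⁻¹` at the identity. -/
noncomputable def Ad (h : G) (X : 𝔤) : 𝔤 :=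
  mfderiv 𝓘(ℝ, 𝔤) 𝓘(ℝ, 𝔤) (fun x : G => h * x * h⁻¹) 1 X

/-- The Cartan-Killing metric `γ_{ab}` of the Lie algebra of a compact semi-simple group: the
negative of the Killing form, so that it is positive definite. -/
noncomputable def cartanKilling [CompleteSpace 𝔤] [LieGroup 𝓘(ℝ, 𝔤) ∞ G] (X Y : 𝔤) : ℝ :=
  -(killingForm ℝ (GroupLieAlgebra 𝓘(ℝ, 𝔤) G) X Y)

variable {n : ℕ} {S : Type*} [TopologicalSpace S] [ChartedSpace (EuclideanSpace ℝ (Fin n)) S]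
  {ι : Type*}

/-- The vector bundle with fibre `𝔤` given by the cocycle `Z` is an adjoint bundle
`(S, 𝔤, π, Ad(G))`: all its transition functions take values in `Ad(G)`. -/
def IsAdjointBundle (Z : VectorBundleCore ℝ S 𝔤 ι) : Prop :=
  ∀ i j, ∀ p ∈ Z.baseSet i ∩ Z.baseSet j, ∃ h : G, ∀ X : 𝔤, Z.coordChange i j p X = Ad h X

/-- A smooth connection in an adjoint bundle, given by its gauge potentials `A = (A^a_k)` in the
local trivializations. The covariant derivative of a section with local representatives `Φ` is
`dΦ + [A, Φ]`; the transformation law expresses that it does not depend on the trivialization. -/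
structure GaugeConnection [IsManifold (𝓡 n) ∞ S] (Z : VectorBundleCore ℝ S 𝔤 ι) where
  /-- the local gauge potentials -/
  potential : ι → ∀ p : S, TangentSpace (𝓡 n) p →L[ℝ] 𝔤
  /-- the components of the gauge potentials in local coordinates are smooth -/
  smooth : ∀ (i : ι) (x : S) (k : Fin n),
    ContDiffOn ℝ ∞ (fun y => potential i (pt x y) (frame x k y))
      ((chartAt (EuclideanSpace ℝ (Fin n)) x).target ∩ pt x ⁻¹' Z.baseSet i)
  /-- change of gauge -/
  gauge : ∀ (i j : ι), ∀ p ∈ Z.baseSet i ∩ Z.baseSet j, ∀ (ξ : TangentSpace (𝓡 n) p) (Y : 𝔤),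
    (show 𝔤 from mfderiv (𝓡 n) 𝓘(ℝ, 𝔤) (fun q => Z.coordChange i j q Y) p ξ)
      + bracket G (potential j p ξ) (Z.coordChange i j p Y)
      = Z.coordChange i j p (bracket G (potential i p ξ) Y)

variable {G}
variable [IsManifold (𝓡 n) ∞ S] {Z : VectorBundleCore ℝ S 𝔤 ι}

/-- The component `A_k` of a connection, in the trivialization `i` and the preferred chart
around `x`. -/
noncomputable def GaugeConnection.comp (A : GaugeConnection G (n := n) Z) (i : ι) (x : S)
    (k : Fin n) (y : EuclideanSpace ℝ (Fin n)) : 𝔤 :=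
  A.potential i (pt x y) (frame x k y)

/-- The curvature (field strength) `F_{jk} = ∂_j A_k - ∂_k A_j + [A_j, A_k]`. -/
noncomputable def GaugeConnection.curvature (A : GaugeConnection G (n := n) Z) (i : ι) (x : S)
    (j k : Fin n) (y : EuclideanSpace ℝ (Fin n)) : 𝔤 :=
  pd j (A.comp i x k) y - pd k (A.comp i x j) y + bracket G (A.comp i x j y) (A.comp i x k y)

/-- The Yang-Mills energy density
`F_{ij} F^{ij} = γ_{ab} σ^{ik} σ^{jl} F^a_{ij} F^b_{kl}`. -/
noncomputable def GaugeConnection.normSq [CompleteSpace 𝔤] [LieGroup 𝓘(ℝ, 𝔤) ∞ G]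
    (A : GaugeConnection G (n := n) Z) (σ : Metric n S) (p : S) : ℝ :=
  ∑ i, ∑ j, ∑ k, ∑ l, gramInv σ p (ctr p) i k * gramInv σ p (ctr p) j l *
    cartanKilling G (A.curvature (Z.indexAt p) p i j (ctr p))
      (A.curvature (Z.indexAt p) p k l (ctr p))

/-- The component `Φ_k = ∂_k Φ + [A_k, Φ]` of the covariant derivative of a section, in the
trivialization `i` and the preferred chart around `x`. -/
noncomputable def GaugeConnection.covDeriv (A : GaugeConnection G (n := n) Z)
    (Φ : ∀ p : S, Z.Fiber p) (i : ι) (x : S) (k : Fin n) (y : EuclideanSpace ℝ (Fin n)) : 𝔤 :=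
  pd k (fun z => (Z.localTriv i ⟨pt x z, Φ (pt x z)⟩).2) y
    + bracket G (A.comp i x k y) (Z.localTriv i ⟨pt x y, Φ (pt x y)⟩).2

variable (n Z) in
/-- A Higgs field together with its potential. It is either a smooth section of the adjoint bundle
with a smooth real potential on (the total space of) that bundle, or an arbitrary smooth scalar
field with `N` real components and a smooth real potential on `ℝᴺ`. -/
inductive HiggsField
  | adjoint (Φ : ContMDiffSection (𝓡 n) 𝔤 ∞ Z.Fiber) (V : TotalSpace 𝔤 Z.Fiber → ℝ)
      (smooth_V : ContMDiff ((𝓡 n).prod 𝓘(ℝ, 𝔤)) 𝓘(ℝ, ℝ) ∞ V) : HiggsField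
  | scalar (N : ℕ) (Φ : S → EuclideanSpace ℝ (Fin N))
      (smooth_Φ : ContMDiff (𝓡 n) 𝓘(ℝ, EuclideanSpace ℝ (Fin N)) ∞ Φ)
      (V : EuclideanSpace ℝ (Fin N) → ℝ) (smooth_V : ContDiff ℝ ∞ V) : HiggsField

/-- The function `V(Φ)` on the manifold. -/
noncomputable def HiggsField.potential : HiggsField n Z → S → ℝ
  | .adjoint Φ V _, p => V ⟨p, Φ p⟩
  | .scalar _ Φ _ V _, p => V (Φ p)

/-- The kinetic energy density `γ_{ab} σ^{ij} Φ^a_i Φ^b_j` of the Higgs field; for a scalar field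
the derivatives are the ordinary ones and `γ_{ab}` is the Euclidean metric. -/
noncomputable def HiggsField.kinetic [CompleteSpace 𝔤] [LieGroup 𝓘(ℝ, 𝔤) ∞ G] (A : GaugeConnection G (n := n) Z)
    (σ : Metric n S) : HiggsField n Z → S → ℝ
  | .adjoint Φ _ _, p => ∑ i, ∑ j, gramInv σ p (ctr p) i j *
      cartanKilling G (A.covDeriv (fun q => Φ q) (Z.indexAt p) p i (ctr p))
        (A.covDeriv (fun q => Φ q) (Z.indexAt p) p j (ctr p))
  | .scalar _ Φ _ _ _, p => ∑ i, ∑ j, gramInv σ p (ctr p) i j *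
      inner ℝ (pd i (fun z => Φ (pt p z)) (ctr p)) (pd j (fun z => Φ (pt p z)) (ctr p))

/-- The elliptic operator
`-(n-1) Δv - (n/2) R v + α₁ (n/8) F_{ij}F^{ij} v + α₂ (n/4) γ_{ab} σ^{ij} Φ^a_i Φ^b_j v
  + α₂ (n/2) m V(Φ) v`. -/
noncomputable def ellipticOp [CompleteSpace 𝔤] [LieGroup 𝓘(ℝ, 𝔤) ∞ G] (σ : Metric n S)
    (A : GaugeConnection G (n := n) Z) (Φ : HiggsField n Z) (α₁ α₂ m : ℝ) (v : S → ℂ) (p : S) : ℂ :=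
  -((n : ℂ) - 1) * laplacian σ v p
    + ((-((n : ℝ) / 2) * scalarCurvature σ p + α₁ * ((n : ℝ) / 8) * A.normSq σ p
      + α₂ * ((n : ℝ) / 4) * Φ.kinetic A σ p
      + α₂ * ((n : ℝ) / 2) * m * Φ.potential p : ℝ) : ℂ) * v p

/-- `μ` is an eigenvalue: there is `v ∈ H^{1,2}(S, ℂ)`, not a.e. zero, which solves `L v = μ v`
in the sense of distributions, i.e. `∫ v \bar{L φ} = μ ∫ v \bar φ` for all smooth `φ`, where
`L` is the elliptic operator (a formally self-adjoint operator). -/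
def IsEigenvalue [MeasurableSpace S] [CompleteSpace 𝔤] [LieGroup 𝓘(ℝ, 𝔤) ∞ G] (σ : Metric n S)
    (A : GaugeConnection G (n := n) Z) (Φ : HiggsField n Z) (α₁ α₂ m μ : ℝ) : Prop :=
  ∃ v : S → ℂ, MemSobolev σ v ∧ (¬ v =ᵐ[vol σ] 0) ∧
    ∀ φ : S → ℂ, ContMDiff (𝓡 n) 𝓘(ℝ, ℂ) ∞ φ →
      ∫ p, v p * (starRingEnd ℂ) (ellipticOp σ A Φ α₁ α₂ m φ p) ∂(vol σ)
        = (μ : ℂ) * ∫ p, v p * (starRingEnd ℂ) (φ p) ∂(vol σ)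

/-- `μ` is an eigenvalue in the classical sense: there is a smooth function `v`, not identically
zero, with `L v = μ v` everywhere. -/
def IsClassicalEigenvalue [CompleteSpace 𝔤] [LieGroup 𝓘(ℝ, 𝔤) ∞ G] (σ : Metric n S)
    (A : GaugeConnection G (n := n) Z) (Φ : HiggsField n Z) (α₁ α₂ m μ : ℝ) : Prop :=
  ∃ v : S → ℂ, ContMDiff (𝓡 n) 𝓘(ℝ, ℂ) ∞ v ∧ v ≠ 0 ∧
    ∀ p, ellipticOp σ A Φ α₁ α₂ m v p = (μ : ℂ) * v p

end Gauge

end YMHiggs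

/-!
Divide the left hand side of the eigenvalue equation into its principal part and its coefficient of
order zero: it is a Schrödinger operator `L_m = -(n-1) Δ + q₀ + m V` on a compact manifold, where
`q₀` collects the scalar curvature, the Yang-Mills energy density and the kinetic energy of the
Higgs field, and `V` is a positive multiple of `V(Φ)`. Everything follows from the continuity of
`q₀` and `V` on `S`, the symmetry of `-Δ` on smooth functions, and Rellich's theorem.

*Continuity of the coefficients.* Each coefficient is given at a point `p` by an expression in the
preferred chart and trivialization at `p`, which jump with `p`. It is continuous since the
expression transforms invariantly, so that near `p` it can be evaluated in the chart at `p`. For the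
curvature terms the invariance comes from a single fact: a gauge transformation which intertwines
two connection forms intertwines their curvatures (`connCurv_transform`). Applied to the
Levi-Civita connection, with the derivative of the coordinate change as gauge transformation, it
yields `continuous_scalarCurvature`. Applied to `ad A` it shows that `ad F` transforms by
conjugation, and the Killing form depends on nothing else (`cartanKilling_of_intertwine`), which
yields `continuous_normSq`. The kinetic term (`continuous_kinetic`) uses in addition that `Ad`
preserves the bracket.

*Analysis on the manifold.* The volume measure restricts to `√σ dy` in each chart
(`vol_restrict_dom`). Green's formula for functions supported in a chart shows, when read weakly,
that the Laplacian does not depend on the chart (`chartLap_eq`), and then a partition of unity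
gives `green`. Poincaré's inequality on small coordinate cubes bounds the `L²` norm of a smooth
function by an arbitrarily small multiple of its Dirichlet integral and finitely many of its means
(`meanBound_univ`); hence sequences bounded in `L²` with bounded Dirichlet integrals have convergent
subsequences (`isRellich_negLap`).

*Spectral theory.* This part only involves a symmetric operator on a space mapped to a Hilbert space
whose form differs from a multiple of a nonnegative form with the Rellich property by a bounded one.
A minimizing sequence of the quadratic form converges in the form norm to a weak eigenvector
(`exists_ground_state`), and a weak eigenvalue lies above every lower bound of the form
(`le_of_weak_eigenvalue`); so the infimum of the form on unit vectors is the smallest eigenvalue. If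
there were no `m₀` and `c` such that the form of `L_m` is at least `c` for `m ≥ m₀`, then there would
be unit vectors `u_k` whose forms with `m = k` are at most `1`. A limit `v` of a subsequence is a
unit vector with `∫ V |v|² = 0`, which contradicts the positivity of `V` almost everywhere
(`exists_uniform_lower_bound`).
-/

namespace YMHiggs

open scoped Topology

set_option synthInstance.maxHeartbeats 200000

/-! ### Curvature of connection forms -/

section Euclidean

section Curvature

variable {E E' W W' : Type*} [NormedAddCommGroup E] [NormedSpace ℝ E]
  [NormedAddCommGroup E'] [NormedSpace ℝ E'] [NormedAddCommGroup W] [NormedSpace ℝ W]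
  [NormedAddCommGroup W'] [NormedSpace ℝ W']

/-- The curvature `dB + B ∧ B` of the connection form `B` with values in the endomorphisms
of `W`, on an open subset of a normed space. -/
noncomputable def connCurv (B : E → E →L[ℝ] W →L[ℝ] W) (y ξ η : E) (w : W) : W :=
  fderiv ℝ B y ξ η w - fderiv ℝ B y η ξ w + (B y ξ (B y η w) - B y η (B y ξ w))

section Linearity

variable (B : E → E →L[ℝ] W →L[ℝ] W) (y : E)

theorem connCurv_add_left (ξ₁ ξ₂ η : E) (w : W) :
    connCurv B y (ξ₁ + ξ₂) η w = connCurv B y ξ₁ η w + connCurv B y ξ₂ η w := by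
  simp only [connCurv, ContinuousLinearMap.map_add, add_apply]
  abel

theorem connCurv_smul_left (c : ℝ) (ξ η : E) (w : W) :
    connCurv B y (c • ξ) η w = c • connCurv B y ξ η w := by
  simp only [connCurv, ContinuousLinearMap.map_smul, smul_apply, smul_add, smul_sub]

theorem connCurv_swap (ξ η : E) (w : W) : connCurv B y ξ η w = -connCurv B y η ξ w := by
  simp only [connCurv]
  abel

theorem connCurv_add_mid (ξ η₁ η₂ : E) (w : W) :
    connCurv B y ξ (η₁ + η₂) w = connCurv B y ξ η₁ w + connCurv B y ξ η₂ w := by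
  simp only [connCurv_swap B y ξ, connCurv_add_left, neg_add]

theorem connCurv_smul_mid (c : ℝ) (ξ η : E) (w : W) :
    connCurv B y ξ (c • η) w = c • connCurv B y ξ η w := by
  simp only [connCurv_swap B y ξ, connCurv_smul_left, smul_neg]

theorem connCurv_add_right (ξ η : E) (w₁ w₂ : W) :
    connCurv B y ξ η (w₁ + w₂) = connCurv B y ξ η w₁ + connCurv B y ξ η w₂ := by
  simp only [connCurv, ContinuousLinearMap.map_add]
  abel

theorem connCurv_smul_right (c : ℝ) (ξ η : E) (w : W) :
    connCurv B y ξ η (c • w) = c • connCurv B y ξ η w := by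
  simp only [connCurv, ContinuousLinearMap.map_smul, smul_add, smul_sub]

end Linearity

set_option synthInstance.maxHeartbeats 200000 in
/-- Curvature is tensorial: if the gauge transformation `C` intertwines the connection form `B` with
the pullback of `B'` under `τ`, then `C` intertwines the curvatures. -/
theorem connCurv_transform {B : E → E →L[ℝ] W →L[ℝ] W} {B' : E' → E' →L[ℝ] W' →L[ℝ] W'}
    {τ : E → E'} {C : E → W →L[ℝ] W'} {y : E} (hB : DifferentiableAt ℝ B y)
    (hB' : DifferentiableAt ℝ B' (τ y)) (hτ : ContDiffAt ℝ 2 τ y) (hC : ContDiffAt ℝ 2 C y)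
    (h : ∀ᶠ z in 𝓝 y, ∀ ξ w, fderiv ℝ C z ξ w + B' (τ z) (fderiv ℝ τ z ξ) (C z w)
      = C z (B z ξ w)) (ξ η : E) (w : W) :
    connCurv B' (τ y) (fderiv ℝ τ y ξ) (fderiv ℝ τ y η) (C y w) = C y (connCurv B y ξ η w) := by
  have hC1 : DifferentiableAt ℝ C y := hC.differentiableAt (by norm_num)
  have hτ1 : DifferentiableAt ℝ τ y := hτ.differentiableAt (by norm_num)
  have hdC : DifferentiableAt ℝ (fderiv ℝ C) y :=
    (hC.fderiv_right (m := 1) (by norm_num)).differentiableAt (by norm_num)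
  have hdτ : DifferentiableAt ℝ (fderiv ℝ τ) y :=
    (hτ.fderiv_right (m := 1) (by norm_num)).differentiableAt (by norm_num)
  -- the derivative of the gauge law
  have key : ∀ ξ η : E, fderiv ℝ (fderiv ℝ C) y ξ η w
      + (fderiv ℝ B' (τ y) (fderiv ℝ τ y ξ) (fderiv ℝ τ y η) (C y w)
        + B' (τ y) (fderiv ℝ (fderiv ℝ τ) y ξ η) (C y w)
        + B' (τ y) (fderiv ℝ τ y η) (fderiv ℝ C y ξ w))
      = fderiv ℝ C y ξ (B y η w) + C y (fderiv ℝ B y ξ η w) := by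
    intro ξ η
    have e : (fun z => fderiv ℝ C z η w + B' (τ z) (fderiv ℝ τ z η) (C z w))
        =ᶠ[𝓝 y] fun z => C z (B z η w) := h.mono fun z hz => hz η w
    have h1 : HasFDerivAt (fun z => fderiv ℝ C z η w) _ y :=
      ((hdC.hasFDerivAt.clm_apply (hasFDerivAt_const η y)).clm_apply (hasFDerivAt_const w y))
    have h2 : HasFDerivAt (fun z => B' (τ z) (fderiv ℝ τ z η) (C z w)) _ y :=
      ((hB'.hasFDerivAt.comp y hτ1.hasFDerivAt).clm_apply
        (hdτ.hasFDerivAt.clm_apply (hasFDerivAt_const η y))).clm_apply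
        (hC1.hasFDerivAt.clm_apply (hasFDerivAt_const w y))
    have h3 : HasFDerivAt (fun z => C z (B z η w)) _ y :=
      hC1.hasFDerivAt.clm_apply
        ((hB.hasFDerivAt.clm_apply (hasFDerivAt_const η y)).clm_apply (hasFDerivAt_const w y))
    have e1 := (h1.add h2).unique (h3.congr_of_eventuallyEq e)
    have e2 := DFunLike.congr_fun e1 ξ
    simp only [add_apply, ContinuousLinearMap.comp_apply,
      ContinuousLinearMap.flip_apply, zero_apply, map_zero, zero_add] at e2
    rw [← sub_eq_zero] at e2 ⊢
    rw [← e2]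
    abel
  -- the second derivatives are symmetric, so they cancel when the law is antisymmetrized
  have sC : fderiv ℝ (fderiv ℝ C) y ξ η = fderiv ℝ (fderiv ℝ C) y η ξ :=
    (hC.isSymmSndFDerivAt (by simp)) ξ η
  have sτ : fderiv ℝ (fderiv ℝ τ) y ξ η = fderiv ℝ (fderiv ℝ τ) y η ξ :=
    (hτ.isSymmSndFDerivAt (by simp)) ξ η
  have g := h.self_of_nhds
  have gC : ∀ ξ w, fderiv ℝ C y ξ w = C y (B y ξ w) - B' (τ y) (fderiv ℝ τ y ξ) (C y w) :=
    fun ξ w => eq_sub_of_add_eq (g ξ w)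
  have k1 := key ξ η
  have k2 := key η ξ
  rw [sC, sτ] at k1
  simp only [gC, map_sub] at k1 k2
  simp only [connCurv, map_add, map_sub]
  have k3 := congrArg₂ (fun a b => a - b) k1 k2
  rw [← sub_eq_zero] at k3 ⊢
  rw [← k3]
  abel

theorem contDiffAt_smul_vec {k : WithTop ℕ∞} {f : E → ℝ} {y : E} (hf : ContDiffAt ℝ k f y)
    (w : W) : ContDiffAt ℝ k (fun z => f z • w) y :=
  hf.smul contDiffAt_const

end Curvature

section Koszul

variable {E : Type*} [NormedAddCommGroup E] [NormedSpace ℝ E] (G : E →L[ℝ] E →L[ℝ] ℝ)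
  (Γ : E →L[ℝ] E →L[ℝ] E) (D : E →L[ℝ] E →L[ℝ] E →L[ℝ] ℝ)

/-- The defect in the Koszul formula for the connection `Γ`, with `D` the derivative of the
metric `G`. -/
noncomputable def koszulDefect (ξ η ζ : E) : ℝ := 2 * G (Γ ξ η) ζ - (D ξ η ζ + D η ξ ζ - D ζ ξ η)

theorem koszulDefect_linear₁ (η ζ : E) : IsLinearMap ℝ fun ξ => koszulDefect G Γ D ξ η ζ := by
  constructor <;> intros <;> simp only [koszulDefect, ContinuousLinearMap.map_add,
    ContinuousLinearMap.map_smul, add_apply, smul_apply, smul_eq_mul] <;> ring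

theorem koszulDefect_linear₂ (ξ ζ : E) : IsLinearMap ℝ fun η => koszulDefect G Γ D ξ η ζ := by
  constructor <;> intros <;> simp only [koszulDefect, ContinuousLinearMap.map_add,
    ContinuousLinearMap.map_smul, add_apply, smul_apply, smul_eq_mul] <;> ring

theorem koszulDefect_linear₃ (ξ η : E) : IsLinearMap ℝ fun ζ => koszulDefect G Γ D ξ η ζ := by
  constructor <;> intros <;> simp only [koszulDefect, ContinuousLinearMap.map_add,
    ContinuousLinearMap.map_smul, add_apply, smul_apply, smul_eq_mul] <;> ring

end Koszul

end Euclidean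

/-! ### Bilinear forms in coordinates -/

section Coordinates

variable {n : ℕ}

/-- The standard basis vector `e_i` of `ℝⁿ`. -/
noncomputable abbrev bas (i : Fin n) : EuclideanSpace ℝ (Fin n) := EuclideanSpace.single i 1

theorem sum_smul_bas (ξ : EuclideanSpace ℝ (Fin n)) : ∑ i, ξ i • bas i = ξ := by
  ext k
  simp [bas, Pi.single_apply]

theorem map_eq_sum_bas {F : Type*} [AddCommGroup F] [Module ℝ F]
    (f : EuclideanSpace ℝ (Fin n) →ₗ[ℝ] F) (ξ : EuclideanSpace ℝ (Fin n)) :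
    f ξ = ∑ i, ξ i • f (bas i) := by
  conv_lhs => rw [← sum_smul_bas ξ]
  simp [map_sum]

/-- The matrix `b_{ij} = b(e_i, e_j)` of a bilinear form. -/
noncomputable def formMatrix
    (b : EuclideanSpace ℝ (Fin n) →L[ℝ] EuclideanSpace ℝ (Fin n) →L[ℝ] ℝ) :
    Matrix (Fin n) (Fin n) ℝ :=
  Matrix.of fun i j => b (bas i) (bas j)

theorem formMatrix_apply (b : EuclideanSpace ℝ (Fin n) →L[ℝ] EuclideanSpace ℝ (Fin n) →L[ℝ] ℝ)
    (i j : Fin n) : formMatrix b i j = b (bas i) (bas j) := rfl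

/-- The matrix of an endomorphism of `ℝⁿ`. -/
noncomputable def endMatrix (J : EuclideanSpace ℝ (Fin n) →L[ℝ] EuclideanSpace ℝ (Fin n)) :
    Matrix (Fin n) (Fin n) ℝ :=
  Matrix.of fun k i => J (bas i) k

theorem endMatrix_apply (J : EuclideanSpace ℝ (Fin n) →L[ℝ] EuclideanSpace ℝ (Fin n))
    (k i : Fin n) : endMatrix J k i = J (bas i) k := rfl

theorem endMatrix_eq_toMatrix (J : EuclideanSpace ℝ (Fin n) →L[ℝ] EuclideanSpace ℝ (Fin n)) :
    endMatrix J = LinearMap.toMatrix (EuclideanSpace.basisFun (Fin n) ℝ).toBasis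
      (EuclideanSpace.basisFun (Fin n) ℝ).toBasis J.toLinearMap := by
  ext k i
  simp [endMatrix, LinearMap.toMatrix_apply, bas]

theorem det_endMatrix (J : EuclideanSpace ℝ (Fin n) →L[ℝ] EuclideanSpace ℝ (Fin n)) :
    (endMatrix J).det = J.det := by
  rw [endMatrix_eq_toMatrix, LinearMap.det_toMatrix]

section Pullback

variable {h h' : EuclideanSpace ℝ (Fin n) →L[ℝ] EuclideanSpace ℝ (Fin n) →L[ℝ] ℝ}
  {J : EuclideanSpace ℝ (Fin n) →L[ℝ] EuclideanSpace ℝ (Fin n)}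

theorem formMatrix_pullback (hJ : ∀ ξ η, h ξ η = h' (J ξ) (J η)) :
    formMatrix h = (endMatrix J).transpose * formMatrix h' * endMatrix J := by
  ext i j
  rw [formMatrix_apply, hJ]
  have h1 : h' (J (bas i)) (J (bas j)) = ∑ k, J (bas i) k * h' (bas k) (J (bas j)) := by
    have := map_eq_sum_bas (LinearMap.flip (h'.toLinearMap₁₂) (J (bas j))) (J (bas i))
    simpa using this
  have h2 : ∀ k, h' (bas k) (J (bas j)) = ∑ l, J (bas j) l * h' (bas k) (bas l) := by
    intro k
    have := map_eq_sum_bas (h' (bas k)).toLinearMap (J (bas j))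
    simpa using this
  simp only [h1, h2, Matrix.mul_apply, Matrix.transpose_apply, endMatrix_apply, formMatrix_apply,
    Finset.mul_sum, Finset.sum_mul]
  rw [Finset.sum_comm]
  refine Finset.sum_congr rfl fun k _ => Finset.sum_congr rfl fun l _ => by ring

theorem det_formMatrix_pullback (hJ : ∀ ξ η, h ξ η = h' (J ξ) (J η)) :
    (formMatrix h).det = J.det ^ 2 * (formMatrix h').det := by
  rw [formMatrix_pullback hJ, Matrix.det_mul, Matrix.det_mul, Matrix.det_transpose, det_endMatrix]
  ring

theorem inv_formMatrix_pullback (hJ : ∀ ξ η, h ξ η = h' (J ξ) (J η))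
    (hdet : (formMatrix h).det ≠ 0) :
    endMatrix J * (formMatrix h)⁻¹ * (endMatrix J).transpose = (formMatrix h')⁻¹ := by
  have hd := det_formMatrix_pullback hJ
  have h1 : (endMatrix J).det ≠ 0 := by
    rw [det_endMatrix]
    intro h0
    rw [h0] at hd
    exact hdet (by rw [hd]; ring)
  have hu : IsUnit (endMatrix J).det := isUnit_iff_ne_zero.2 h1
  have hut : IsUnit (endMatrix J).transpose.det := by rwa [Matrix.det_transpose]
  rw [formMatrix_pullback hJ, Matrix.mul_inv_rev, Matrix.mul_inv_rev]
  calc endMatrix J * ((endMatrix J)⁻¹ * ((formMatrix h')⁻¹ * (endMatrix J).transpose⁻¹))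
        * (endMatrix J).transpose
      = (endMatrix J * (endMatrix J)⁻¹) * (formMatrix h')⁻¹
        * ((endMatrix J).transpose⁻¹ * (endMatrix J).transpose) := by
        simp only [Matrix.mul_assoc]
    _ = (formMatrix h')⁻¹ := by
        rw [Matrix.mul_nonsing_inv _ hu, Matrix.nonsing_inv_mul _ hut, Matrix.one_mul,
          Matrix.mul_one]

/-- Contraction of two covariant indices with the inverse metric does not depend on the
coordinates. -/
theorem contraction_pullback (hJ : ∀ ξ η, h ξ η = h' (J ξ) (J η))
    (hdet : (formMatrix h).det ≠ 0) {F : Type*} [AddCommGroup F] [Module ℝ F]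
    (b : EuclideanSpace ℝ (Fin n) →ₗ[ℝ] EuclideanSpace ℝ (Fin n) →ₗ[ℝ] F) :
    ∑ i, ∑ j, (formMatrix h)⁻¹ i j • b (J (bas i)) (J (bas j))
      = ∑ i, ∑ j, (formMatrix h')⁻¹ i j • b (bas i) (bas j) := by
  have h1 : ∀ i j, b (J (bas i)) (J (bas j))
      = ∑ k, ∑ l, (J (bas i) k * J (bas j) l) • b (bas k) (bas l) := by
    intro i j
    have := map_eq_sum_bas (LinearMap.flip b (J (bas j))) (J (bas i))
    simp only [LinearMap.flip_apply] at this
    rw [this]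
    refine Finset.sum_congr rfl fun k _ => ?_
    rw [map_eq_sum_bas (b (bas k)) (J (bas j)), Finset.smul_sum]
    simp only [smul_smul]
  simp only [h1, ← inv_formMatrix_pullback hJ hdet, Matrix.mul_apply, Matrix.transpose_apply,
    endMatrix_apply, Finset.smul_sum, Finset.sum_smul, Finset.sum_mul, smul_smul]
  have e1 : ∀ f : Fin n → Fin n → Fin n → Fin n → F,
      ∑ i, ∑ j, ∑ k, ∑ l, f i j k l = ∑ k, ∑ l, ∑ j, ∑ i, f i j k l := by
    intro f
    calc ∑ i, ∑ j, ∑ k, ∑ l, f i j k l = ∑ i, ∑ k, ∑ j, ∑ l, f i j k l :=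
          Finset.sum_congr rfl fun _ _ => Finset.sum_comm
      _ = ∑ k, ∑ i, ∑ j, ∑ l, f i j k l := Finset.sum_comm
      _ = ∑ k, ∑ i, ∑ l, ∑ j, f i j k l :=
          Finset.sum_congr rfl fun _ _ => Finset.sum_congr rfl fun _ _ => Finset.sum_comm
      _ = ∑ k, ∑ l, ∑ i, ∑ j, f i j k l := Finset.sum_congr rfl fun _ _ => Finset.sum_comm
      _ = _ := Finset.sum_congr rfl fun _ _ => Finset.sum_congr rfl fun _ _ => Finset.sum_comm
  rw [e1]
  refine Finset.sum_congr rfl fun k _ => Finset.sum_congr rfl fun l _ =>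
    Finset.sum_congr rfl fun j _ => Finset.sum_congr rfl fun i _ => ?_
  congr 1
  ring

end Pullback

section Smoothness

variable {E : Type*} [NormedAddCommGroup E] [NormedSpace ℝ E] {k : WithTop ℕ∞}
  {M : E → Matrix (Fin n) (Fin n) ℝ} {y : E}

theorem contDiffAt_det (hM : ∀ i j, ContDiffAt ℝ k (fun z => M z i j) y) :
    ContDiffAt ℝ k (fun z => (M z).det) y := by
  simp only [Matrix.det_apply]
  refine ContDiffAt.sum fun s _ => ?_
  exact (contDiffAt_prod fun i _ => hM _ _).const_smul _

theorem contDiffAt_inv_apply (hM : ∀ i j, ContDiffAt ℝ k (fun z => M z i j) y)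
    (hdet : (M y).det ≠ 0) (i j : Fin n) : ContDiffAt ℝ k (fun z => (M z)⁻¹ i j) y := by
  have h1 : (fun z => (M z)⁻¹ i j) = fun z => ((M z).det)⁻¹ * (M z).adjugate i j := by
    funext z
    rw [Matrix.inv_def, Matrix.smul_apply, Ring.inverse_eq_inv', smul_eq_mul]
  rw [h1]
  refine ((contDiffAt_det hM).inv hdet).mul ?_
  simp only [Matrix.adjugate_apply]
  refine contDiffAt_det fun a b => ?_
  by_cases ha : a = j
  · subst ha
    simp only [Matrix.updateRow_self]
    exact contDiffAt_const
  · simp only [Matrix.updateRow_ne ha]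
    exact hM a b

end Smoothness

end Coordinates

/-! ### Invariance of the scalar curvature -/

section ScalarCurvatureInvariance

variable {n : ℕ}

/-- A trilinear expression vanishes if it vanishes on the standard basis. -/
theorem eq_zero_of_bas {f : EuclideanSpace ℝ (Fin n) → EuclideanSpace ℝ (Fin n) →
      EuclideanSpace ℝ (Fin n) → ℝ}
    (h1 : ∀ η ζ, IsLinearMap ℝ fun ξ => f ξ η ζ) (h2 : ∀ ξ ζ, IsLinearMap ℝ fun η => f ξ η ζ)
    (h3 : ∀ ξ η, IsLinearMap ℝ fun ζ => f ξ η ζ)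
    (h0 : ∀ i j k, f (bas i) (bas j) (bas k) = 0) (ξ η ζ : EuclideanSpace ℝ (Fin n)) :
    f ξ η ζ = 0 := by
  have e1 := map_eq_sum_bas (h1 η ζ).mk' ξ
  simp only [IsLinearMap.mk'_apply] at e1
  rw [e1]
  refine Finset.sum_eq_zero fun i _ => ?_
  have e2 := map_eq_sum_bas (h2 (bas i) ζ).mk' η
  simp only [IsLinearMap.mk'_apply] at e2
  rw [e2]
  refine smul_eq_zero_of_right _ (Finset.sum_eq_zero fun j _ => ?_)
  have e3 := map_eq_sum_bas (h3 (bas i) (bas j)).mk' ζ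
  simp only [IsLinearMap.mk'_apply] at e3
  rw [e3]
  exact smul_eq_zero_of_right _ (Finset.sum_eq_zero fun k _ => by rw [h0, smul_zero])

theorem eq_zero_of_form_eq_zero
    {h : EuclideanSpace ℝ (Fin n) →L[ℝ] EuclideanSpace ℝ (Fin n) →L[ℝ] ℝ}
    (hdet : (formMatrix h).det ≠ 0) {a : EuclideanSpace ℝ (Fin n)} (ha : ∀ ζ, h a ζ = 0) :
    a = 0 := by
  have h1 : Matrix.vecMul (fun i => a i) (formMatrix h) = 0 := by
    funext j
    have := map_eq_sum_bas (LinearMap.flip (h.toLinearMap₁₂) (bas j)) a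
    exact this.symm.trans (ha (bas j))
  have h2 := Matrix.eq_zero_of_vecMul_eq_zero hdet h1
  ext i
  exact congrFun h2 i

/-- The Christoffel symbols of the metric with components `M`. -/
noncomputable def chrOf (M : EuclideanSpace ℝ (Fin n) → Matrix (Fin n) (Fin n) ℝ) (k i j : Fin n)
    (y : EuclideanSpace ℝ (Fin n)) : ℝ :=
  (1 / 2) * ∑ l, (M y)⁻¹ k l * (pd i (fun z => M z j l) y + pd j (fun z => M z i l) y
      - pd l (fun z => M z i j) y)

/-- The Ricci tensor of the metric with components `M`. -/
noncomputable def ricOf (M : EuclideanSpace ℝ (Fin n) → Matrix (Fin n) (Fin n) ℝ) (i j : Fin n)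
    (y : EuclideanSpace ℝ (Fin n)) : ℝ :=
  ∑ k, (pd k (chrOf M k i j) y - pd j (chrOf M k i k) y)
    + ∑ k, ∑ l, (chrOf M k k l y * chrOf M l i j y - chrOf M k j l y * chrOf M l i k y)

/-- The scalar curvature of the metric with components `M`. -/
noncomputable def scalOf (M : EuclideanSpace ℝ (Fin n) → Matrix (Fin n) (Fin n) ℝ)
    (y : EuclideanSpace ℝ (Fin n)) : ℝ :=
  ∑ i, ∑ j, (M y)⁻¹ i j * ricOf M i j y

/-- The Levi-Civita connection form `Γ(ξ) η` of a metric on `ℝⁿ`. -/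
noncomputable def chrMap
    (g : EuclideanSpace ℝ (Fin n) → EuclideanSpace ℝ (Fin n) →L[ℝ] EuclideanSpace ℝ (Fin n) →L[ℝ] ℝ)
    (y : EuclideanSpace ℝ (Fin n)) :
    EuclideanSpace ℝ (Fin n) →L[ℝ] EuclideanSpace ℝ (Fin n) →L[ℝ] EuclideanSpace ℝ (Fin n) :=
  ∑ k, ∑ i, ∑ j, chrOf (fun z => formMatrix (g z)) k i j y •
    (EuclideanSpace.proj i : EuclideanSpace ℝ (Fin n) →L[ℝ] ℝ).smulRight
      ((EuclideanSpace.proj j : EuclideanSpace ℝ (Fin n) →L[ℝ] ℝ).smulRight (bas k))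

variable {g g' : EuclideanSpace ℝ (Fin n) →
    EuclideanSpace ℝ (Fin n) →L[ℝ] EuclideanSpace ℝ (Fin n) →L[ℝ] ℝ}
  {y : EuclideanSpace ℝ (Fin n)}

theorem chrMap_bas (y : EuclideanSpace ℝ (Fin n)) (i j : Fin n) :
    chrMap g y (bas i) (bas j) = ∑ k, chrOf (fun z => formMatrix (g z)) k i j y • bas k := by
  have hp : ∀ a b : Fin n, (EuclideanSpace.proj a : EuclideanSpace ℝ (Fin n) →L[ℝ] ℝ) (bas b)
      = if a = b then 1 else 0 := fun a b => by
    simp [bas]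
  simp only [chrMap, sum_apply, smul_apply, ContinuousLinearMap.smulRight_apply, hp, ite_smul,
    one_smul, zero_smul, smul_ite, smul_zero, apply_ite (fun T : EuclideanSpace ℝ (Fin n) →L[ℝ] _
      => T (bas j)), zero_apply]
  simp only [Finset.sum_ite_irrel, Finset.sum_const_zero, Finset.sum_ite_eq', Finset.mem_univ, if_true]

theorem chrMap_bas_apply (y : EuclideanSpace ℝ (Fin n)) (i j k : Fin n) :
    chrMap g y (bas i) (bas j) k = chrOf (fun z => formMatrix (g z)) k i j y := by
  rw [chrMap_bas]
  simp [bas, Pi.single_apply]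

theorem pd_formMatrix (hg : DifferentiableAt ℝ g y) (i j k : Fin n) :
    pd k (fun z => formMatrix (g z) i j) y = fderiv ℝ g y (bas k) (bas i) (bas j) := by
  have : HasFDerivAt (fun z => g z (bas i) (bas j)) _ y :=
    (hg.hasFDerivAt.clm_apply (hasFDerivAt_const (bas i) y)).clm_apply
      (hasFDerivAt_const (bas j) y)
  simp only [pd, formMatrix_apply]
  rw [this.fderiv]
  simp

/-- The Koszul formula. -/
theorem koszul (hg : DifferentiableAt ℝ g y) (hdet : (formMatrix (g y)).det ≠ 0)
    (hsymm : ∀ ξ η, g y ξ η = g y η ξ) (ξ η ζ : EuclideanSpace ℝ (Fin n)) :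
    2 * g y (chrMap g y ξ η) ζ
      = fderiv ℝ g y ξ η ζ + fderiv ℝ g y η ξ ζ - fderiv ℝ g y ζ ξ η := by
  rw [← sub_eq_zero]
  refine eq_zero_of_bas (f := koszulDefect (g y) (chrMap g y) (fderiv ℝ g y))
    (koszulDefect_linear₁ _ _ _) (koszulDefect_linear₂ _ _ _) (koszulDefect_linear₃ _ _ _) ?_ ξ η ζ
  · intro i j m
    have e0 : g y (chrMap g y (bas i) (bas j)) (bas m)
        = ∑ k, chrOf (fun z => formMatrix (g z)) k i j y * g y (bas k) (bas m) := by
      have := map_eq_sum_bas (LinearMap.flip (g y).toLinearMap₁₂ (bas m))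
        (chrMap g y (bas i) (bas j))
      simp only [chrMap_bas_apply] at this
      exact this
    rw [koszulDefect, e0]
    have e : ∀ k, chrOf (fun z => formMatrix (g z)) k i j y * g y (bas k) (bas m) =
        (1 / 2) * ∑ l, (formMatrix (g y) m k * (formMatrix (g y))⁻¹ k l) *
          (fderiv ℝ g y (bas i) (bas j) (bas l) + fderiv ℝ g y (bas j) (bas i) (bas l)
            - fderiv ℝ g y (bas l) (bas i) (bas j)) := by
      intro k
      simp only [chrOf, pd_formMatrix hg]
      rw [hsymm, ← formMatrix_apply, mul_assoc, Finset.sum_mul]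
      congr 1
      exact Finset.sum_congr rfl fun l _ => by ring
    rw [Finset.sum_congr rfl fun k _ => e k, ← Finset.mul_sum, Finset.sum_comm]
    simp only [← Finset.sum_mul]
    have e2 : ∀ l, ∑ k, formMatrix (g y) m k * (formMatrix (g y))⁻¹ k l
        = (1 : Matrix (Fin n) (Fin n) ℝ) m l := by
      intro l
      rw [← Matrix.mul_nonsing_inv _ (isUnit_iff_ne_zero.2 hdet), Matrix.mul_apply]
    simp only [e2, Matrix.one_apply, ite_mul, one_mul, zero_mul, Finset.sum_ite_eq,
      Finset.mem_univ, if_true]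
    ring

/-- The transformation law of the Christoffel symbols: the derivative of a coordinate change is a
gauge transformation between the Levi-Civita connection forms, as in `connCurv_transform`. -/
theorem chrMap_transform {τ : EuclideanSpace ℝ (Fin n) → EuclideanSpace ℝ (Fin n)}
    (hg : DifferentiableAt ℝ g y) (hg' : DifferentiableAt ℝ g' (τ y)) (hτ : ContDiffAt ℝ 2 τ y)
    (hsymm : ∀ ξ η, g y ξ η = g y η ξ) (hsymm' : ∀ ξ η, g' (τ y) ξ η = g' (τ y) η ξ)
    (hdet : (formMatrix (g y)).det ≠ 0)
    (hp : ∀ᶠ z in 𝓝 y, ∀ ξ η, g z ξ η = g' (τ z) (fderiv ℝ τ z ξ) (fderiv ℝ τ z η))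
    (ξ η : EuclideanSpace ℝ (Fin n)) :
    fderiv ℝ (fderiv ℝ τ) y ξ η + chrMap g' (τ y) (fderiv ℝ τ y ξ) (fderiv ℝ τ y η)
      = fderiv ℝ τ y (chrMap g y ξ η) := by
  have hτ1 : DifferentiableAt ℝ τ y := hτ.differentiableAt (by norm_num)
  have hdτ : DifferentiableAt ℝ (fderiv ℝ τ) y :=
    (hτ.fderiv_right (m := 1) (by norm_num)).differentiableAt (by norm_num)
  have sτ : ∀ ξ η, fderiv ℝ (fderiv ℝ τ) y ξ η = fderiv ℝ (fderiv ℝ τ) y η ξ := fun ξ η =>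
    (hτ.isSymmSndFDerivAt (by simp)) ξ η
  have hp0 := hp.self_of_nhds
  have hd := det_formMatrix_pullback hp0
  have hJ : (fderiv ℝ τ y).det ≠ 0 := by
    intro h0; rw [h0] at hd; exact hdet (by rw [hd]; ring)
  have hdet' : (formMatrix (g' (τ y))).det ≠ 0 := by
    intro h0; rw [h0] at hd; exact hdet (by rw [hd]; ring)
  have hsurj : Function.Surjective (fderiv ℝ τ y) := by
    exact (LinearMap.equivOfDetNeZero
      (fderiv ℝ τ y : EuclideanSpace ℝ (Fin n) →ₗ[ℝ] EuclideanSpace ℝ (Fin n)) hJ).surjective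
  -- the derivative of the relation between the two metrics
  have dg : ∀ a b c, fderiv ℝ g y a b c
      = fderiv ℝ g' (τ y) (fderiv ℝ τ y a) (fderiv ℝ τ y b) (fderiv ℝ τ y c)
        + g' (τ y) (fderiv ℝ (fderiv ℝ τ) y a b) (fderiv ℝ τ y c)
        + g' (τ y) (fderiv ℝ τ y b) (fderiv ℝ (fderiv ℝ τ) y a c) := by
    intro a b c
    have e : (fun z => g z b c) =ᶠ[𝓝 y] fun z => g' (τ z) (fderiv ℝ τ z b) (fderiv ℝ τ z c) :=
      hp.mono fun z hz => hz b c
    have h1 : HasFDerivAt (fun z => g z b c) _ y :=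
      (hg.hasFDerivAt.clm_apply (hasFDerivAt_const b y)).clm_apply (hasFDerivAt_const c y)
    have h2 : HasFDerivAt (fun z => g' (τ z) (fderiv ℝ τ z b) (fderiv ℝ τ z c)) _ y :=
      ((hg'.hasFDerivAt.comp y hτ1.hasFDerivAt).clm_apply
        (hdτ.hasFDerivAt.clm_apply (hasFDerivAt_const b y))).clm_apply
        (hdτ.hasFDerivAt.clm_apply (hasFDerivAt_const c y))
    have e1 := h1.unique (h2.congr_of_eventuallyEq e)
    have e2 := DFunLike.congr_fun e1 a
    simp only [add_apply, ContinuousLinearMap.comp_apply,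
      ContinuousLinearMap.flip_apply, zero_apply, map_zero, zero_add] at e2
    rw [e2]
    ring
  rw [← sub_eq_zero]
  refine eq_zero_of_form_eq_zero hdet' fun ζ' => ?_
  obtain ⟨ζ, rfl⟩ := hsurj ζ'
  have k1 := koszul hg hdet hsymm ξ η ζ
  have k2 := koszul hg' hdet' hsymm' (fderiv ℝ τ y ξ) (fderiv ℝ τ y η) (fderiv ℝ τ y ζ)
  rw [hp0] at k1
  simp only [dg] at k1
  simp only [map_sub, map_add, sub_apply, add_apply]
  rw [sτ η ξ, sτ ζ ξ, sτ ζ η, hsymm' (fderiv ℝ τ y η), hsymm' (fderiv ℝ τ y ξ)] at k1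
  linarith

theorem chrOf_contDiffAt {k : ℕ∞} (hg : ContDiffAt ℝ (k + 1) g y)
    (hdet : (formMatrix (g y)).det ≠ 0) (l i j : Fin n) :
    ContDiffAt ℝ k (chrOf (fun z => formMatrix (g z)) l i j) y := by
  have hM : ∀ a b, ContDiffAt ℝ (k + 1) (fun z => formMatrix (g z) a b) y := fun a b => by
    simp only [formMatrix_apply]
    exact (hg.clm_apply contDiffAt_const).clm_apply contDiffAt_const
  have hpd : ∀ a b c, ContDiffAt ℝ k (pd c (fun z => formMatrix (g z) a b)) y := fun a b c =>
    ((hM a b).fderiv_right le_rfl).clm_apply contDiffAt_const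
  unfold chrOf
  refine contDiffAt_const.mul (ContDiffAt.sum fun m _ => ?_)
  refine (contDiffAt_inv_apply (M := fun z => formMatrix (g z))
    (fun a b => (hM a b).of_le (by exact_mod_cast le_self_add)) hdet _ _).mul ?_
  exact ((hpd _ _ _).add (hpd _ _ _)).sub (hpd _ _ _)

theorem chrMap_contDiffAt {k : ℕ∞} (hg : ContDiffAt ℝ (k + 1) g y)
    (hdet : (formMatrix (g y)).det ≠ 0) : ContDiffAt ℝ k (chrMap g) y := by
  unfold chrMap
  exact ContDiffAt.sum fun l _ => ContDiffAt.sum fun i _ => ContDiffAt.sum fun j _ =>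
    contDiffAt_smul_vec (chrOf_contDiffAt hg hdet l i j) _

theorem chrOf_symm (hsymm : ∀ᶠ z in 𝓝 y, ∀ ξ η, g z ξ η = g z η ξ) (l i j : Fin n) :
    chrOf (fun z => formMatrix (g z)) l i j y = chrOf (fun z => formMatrix (g z)) l j i y := by
  unfold chrOf
  congr 1
  refine Finset.sum_congr rfl fun m _ => ?_
  congr 1
  have : pd m (fun z => formMatrix (g z) i j) y = pd m (fun z => formMatrix (g z) j i) y := by
    unfold pd
    rw [Filter.EventuallyEq.fderiv_eq]
    exact hsymm.mono fun z hz => hz _ _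
  rw [this]
  ring

/-- The Ricci tensor as a bilinear form: `Ric(ξ, η)` is the trace of `ζ ↦ R(ζ, η) ξ`. -/
noncomputable def ricForm
    (g : EuclideanSpace ℝ (Fin n) → EuclideanSpace ℝ (Fin n) →L[ℝ] EuclideanSpace ℝ (Fin n) →L[ℝ] ℝ)
    (y : EuclideanSpace ℝ (Fin n)) :
    EuclideanSpace ℝ (Fin n) →ₗ[ℝ] EuclideanSpace ℝ (Fin n) →ₗ[ℝ] ℝ :=
  LinearMap.mk₂ ℝ (fun ξ η => ∑ k, connCurv (chrMap g) y (bas k) η ξ k)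
    (fun ξ₁ ξ₂ η => by simp only [connCurv_add_right, PiLp.add_apply, Finset.sum_add_distrib])
    (fun c ξ η => by simp only [connCurv_smul_right, PiLp.smul_apply, Finset.smul_sum])
    (fun ξ η₁ η₂ => by simp only [connCurv_add_mid, PiLp.add_apply, Finset.sum_add_distrib])
    (fun c ξ η => by simp only [connCurv_smul_mid, PiLp.smul_apply, Finset.smul_sum])

theorem ricForm_apply (y ξ η : EuclideanSpace ℝ (Fin n)) :
    ricForm g y ξ η = ∑ k, connCurv (chrMap g) y (bas k) η ξ k := rfl

theorem ricForm_bas (hg : ContDiffAt ℝ 2 g y) (hdet : (formMatrix (g y)).det ≠ 0)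
    (hsymm : ∀ᶠ z in 𝓝 y, ∀ ξ η, g z ξ η = g z η ξ) (i j : Fin n) :
    ricForm g y (bas i) (bas j) = ricOf (fun z => formMatrix (g z)) i j y := by
  have hd : DifferentiableAt ℝ (chrMap g) y :=
    (chrMap_contDiffAt (k := 1) (by simpa [one_add_one_eq_two] using hg) hdet).differentiableAt
      (by norm_num)
  have hf : ∀ a b c l, fderiv ℝ (chrMap g) y (bas c) (bas a) (bas b) l
      = pd c (chrOf (fun z => formMatrix (g z)) l a b) y := by
    intro a b c l
    have h1 : HasFDerivAt (fun z => chrMap g z (bas a) (bas b)) _ y :=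
      (hd.hasFDerivAt.clm_apply (hasFDerivAt_const (bas a) y)).clm_apply
        (hasFDerivAt_const (bas b) y)
    have h2 := (EuclideanSpace.proj l : EuclideanSpace ℝ (Fin n) →L[ℝ] ℝ).hasFDerivAt.comp y h1
    have h3 : (EuclideanSpace.proj l : EuclideanSpace ℝ (Fin n) →L[ℝ] ℝ) ∘
        (fun z => chrMap g z (bas a) (bas b)) = chrOf (fun z => formMatrix (g z)) l a b := by
      funext z
      simp only [Function.comp_apply, PiLp.proj_apply, chrMap_bas_apply]
    rw [h3] at h2
    unfold pd
    rw [h2.fderiv]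
    simp
  have hs : ∀ l a b, chrOf (fun z => formMatrix (g z)) l a b =ᶠ[𝓝 y]
      chrOf (fun z => formMatrix (g z)) l b a := fun l a b =>
    hsymm.eventually_nhds.mono fun z hz => chrOf_symm hz l a b
  have hps : ∀ c l a b, pd c (chrOf (fun z => formMatrix (g z)) l a b) y
      = pd c (chrOf (fun z => formMatrix (g z)) l b a) y := fun c l a b => by
    unfold pd; rw [(hs l a b).fderiv_eq]
  have hc : ∀ a (w : EuclideanSpace ℝ (Fin n)) k, chrMap g y (bas a) w k
      = ∑ l, w l * chrOf (fun z => formMatrix (g z)) k a l y := by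
    intro a w k
    rw [← ContinuousLinearMap.coe_coe, map_eq_sum_bas]
    simp [chrMap_bas_apply]
  rw [ricForm_apply, ricOf, ← Finset.sum_add_distrib]
  refine Finset.sum_congr rfl fun k _ => ?_
  simp only [connCurv, PiLp.add_apply, PiLp.sub_apply, hf, hc _ (chrMap g y _ _), chrMap_bas_apply]
  rw [hps k k j i, hps j k k i, ← Finset.sum_sub_distrib]
  congr 1
  refine Finset.sum_congr rfl fun l _ => ?_
  rw [(hs l j i).self_of_nhds, (hs l k i).self_of_nhds]
  ring

/-- Scalar curvature does not depend on the coordinates. -/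
theorem scalOf_transform {τ : EuclideanSpace ℝ (Fin n) → EuclideanSpace ℝ (Fin n)}
    (hg : ContDiffAt ℝ 2 g y) (hg' : ContDiffAt ℝ 2 g' (τ y)) (hτ : ContDiffAt ℝ 3 τ y)
    (hsymm : ∀ᶠ z in 𝓝 y, ∀ ξ η, g z ξ η = g z η ξ)
    (hsymm' : ∀ᶠ z in 𝓝 (τ y), ∀ ξ η, g' z ξ η = g' z η ξ)
    (hdet : (formMatrix (g y)).det ≠ 0)
    (hp : ∀ᶠ z in 𝓝 y, ∀ ξ η, g z ξ η = g' (τ z) (fderiv ℝ τ z ξ) (fderiv ℝ τ z η)) :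
    scalOf (fun z => formMatrix (g z)) y = scalOf (fun z => formMatrix (g' z)) (τ y) := by
  have hp0 := hp.self_of_nhds
  have hd := det_formMatrix_pullback hp0
  have hJ : (fderiv ℝ τ y).det ≠ 0 := by
    intro h0; rw [h0] at hd; exact hdet (by rw [hd]; ring)
  have hdet' : (formMatrix (g' (τ y))).det ≠ 0 := by
    intro h0; rw [h0] at hd; exact hdet (by rw [hd]; ring)
  have hdet_ev : ∀ᶠ z in 𝓝 y, (formMatrix (g z)).det ≠ 0 := by
    have : ContinuousAt (fun z => (formMatrix (g z)).det) y :=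
      (contDiffAt_det (k := 2) (M := fun z => formMatrix (g z)) fun a b =>
        (hg.clm_apply contDiffAt_const).clm_apply contDiffAt_const).continuousAt
    exact this.eventually_ne hdet
  have hτc : ContinuousAt τ y := hτ.continuousAt
  have gauge : ∀ᶠ z in 𝓝 y, ∀ ξ w, fderiv ℝ (fderiv ℝ τ) z ξ w
      + chrMap g' (τ z) (fderiv ℝ τ z ξ) (fderiv ℝ τ z w) = fderiv ℝ τ z (chrMap g z ξ w) := by
    filter_upwards [hg.eventually (by simp), hτc.eventually (hg'.eventually (by simp)),
      hτ.eventually (by simp), hsymm, hτc.eventually hsymm', hdet_ev, hp.eventually_nhds]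
      with z z1 z2 z3 z4 z5 z6 z7 ξ w
    exact chrMap_transform (z1.differentiableAt (by norm_num)) (z2.differentiableAt (by norm_num))
      (z3.of_le (by norm_num)) z4 z5 z6 z7 ξ w
  have hB : DifferentiableAt ℝ (chrMap g) y :=
    (chrMap_contDiffAt (k := 1) (by simpa [one_add_one_eq_two] using hg) hdet).differentiableAt
      (by norm_num)
  have hB' : DifferentiableAt ℝ (chrMap g') (τ y) :=
    (chrMap_contDiffAt (k := 1) (by simpa [one_add_one_eq_two] using hg') hdet').differentiableAt
      (by norm_num)
  have curv := connCurv_transform hB hB' (hτ.of_le (by norm_num))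
    (hτ.fderiv_right (m := 2) (by norm_num)) gauge
  let e : EuclideanSpace ℝ (Fin n) ≃ₗ[ℝ] EuclideanSpace ℝ (Fin n) :=
    LinearMap.equivOfDetNeZero (fderiv ℝ τ y : EuclideanSpace ℝ (Fin n) →ₗ[ℝ] _) hJ
  have he : ∀ ξ, e ξ = fderiv ℝ τ y ξ := fun ξ => rfl
  have tr : ∀ T : EuclideanSpace ℝ (Fin n) →ₗ[ℝ] EuclideanSpace ℝ (Fin n),
      LinearMap.trace ℝ _ T = ∑ k, T (bas k) k := by
    intro T
    rw [LinearMap.trace_eq_matrix_trace ℝ (EuclideanSpace.basisFun (Fin n) ℝ).toBasis,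
      Matrix.trace]
    simp [LinearMap.toMatrix_apply, bas]
  let T : ∀ (g : EuclideanSpace ℝ (Fin n) →
      EuclideanSpace ℝ (Fin n) →L[ℝ] EuclideanSpace ℝ (Fin n) →L[ℝ] ℝ)
      (y ξ η : EuclideanSpace ℝ (Fin n)), EuclideanSpace ℝ (Fin n) →ₗ[ℝ] EuclideanSpace ℝ (Fin n) :=
    fun g y ξ η =>
      { toFun := fun ζ => connCurv (chrMap g) y ζ η ξ
        map_add' := fun ζ₁ ζ₂ => connCurv_add_left _ _ ζ₁ ζ₂ η ξ
        map_smul' := fun c ζ => connCurv_smul_left _ _ c ζ η ξ }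
  have ric : ∀ ξ η, ricForm g' (τ y) (fderiv ℝ τ y ξ) (fderiv ℝ τ y η) = ricForm g y ξ η := by
    intro ξ η
    have h1 : ricForm g y ξ η = LinearMap.trace ℝ _ (T g y ξ η) := by rw [tr]; rfl
    have h2 : ricForm g' (τ y) (fderiv ℝ τ y ξ) (fderiv ℝ τ y η)
      = LinearMap.trace ℝ _ (T g' (τ y) (fderiv ℝ τ y ξ) (fderiv ℝ τ y η)) := by rw [tr]; rfl
    rw [h1, h2, ← LinearMap.trace_conj' (T g y ξ η) e]
    congr 1
    refine LinearMap.ext fun ζ' => ?_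
    obtain ⟨ζ, rfl⟩ := e.surjective ζ'
    rw [LinearEquiv.conj_apply_apply, LinearEquiv.symm_apply_apply, he, he]
    exact curv ζ η ξ
  unfold scalOf
  have := contraction_pullback hp0 hdet (ricForm g' (τ y))
  simp only [ric, ricForm_bas hg hdet hsymm, ricForm_bas hg' hdet' hsymm', smul_eq_mul] at this
  exact this

end ScalarCurvatureInvariance

/-! ### Charts and the metric -/

section Transition

variable {n : ℕ} {S : Type*} [TopologicalSpace S] [ChartedSpace (EuclideanSpace ℝ (Fin n)) S]

/-- The domain of the preferred chart around `x`. -/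
abbrev chartDom (n : ℕ) {S : Type*} [TopologicalSpace S]
    [ChartedSpace (EuclideanSpace ℝ (Fin n)) S] (x : S) : Set S :=
  (chartAt (EuclideanSpace ℝ (Fin n)) x).source

/-- The image of the preferred chart around `x`. -/
abbrev chartTgt (n : ℕ) {S : Type*} [TopologicalSpace S]
    [ChartedSpace (EuclideanSpace ℝ (Fin n)) S] (x : S) : Set (EuclideanSpace ℝ (Fin n)) :=
  (chartAt (EuclideanSpace ℝ (Fin n)) x).target

/-- The coordinate change from the chart around `x` to the chart around `x'`. -/
noncomputable def trans (x x' : S) (y : EuclideanSpace ℝ (Fin n)) : EuclideanSpace ℝ (Fin n) :=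
  chartAt (EuclideanSpace ℝ (Fin n)) x' (pt x y)

theorem isOpen_chartTgt (x : S) : IsOpen (chartTgt n x) :=
  (chartAt (EuclideanSpace ℝ (Fin n)) x).open_target

theorem isOpen_chartDom (x : S) : IsOpen (chartDom n x) :=
  (chartAt (EuclideanSpace ℝ (Fin n)) x).open_source

theorem pt_mem {x : S} {y : EuclideanSpace ℝ (Fin n)} (hy : y ∈ chartTgt n x) :
    pt x y ∈ chartDom n x :=
  (chartAt (EuclideanSpace ℝ (Fin n)) x).map_target hy

theorem chart_mem {x p : S} (hp : p ∈ chartDom n x) :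
    chartAt (EuclideanSpace ℝ (Fin n)) x p ∈ chartTgt n x :=
  (chartAt (EuclideanSpace ℝ (Fin n)) x).map_source hp

theorem pt_chart {x p : S} (hp : p ∈ chartDom n x) :
    pt x (chartAt (EuclideanSpace ℝ (Fin n)) x p) = p :=
  (chartAt (EuclideanSpace ℝ (Fin n)) x).left_inv hp

theorem chart_pt {x : S} {y : EuclideanSpace ℝ (Fin n)} (hy : y ∈ chartTgt n x) :
    chartAt (EuclideanSpace ℝ (Fin n)) x (pt x y) = y :=
  (chartAt (EuclideanSpace ℝ (Fin n)) x).right_inv hy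

theorem mem_chartDom (x : S) : x ∈ chartDom n x := mem_chart_source _ x

theorem ctr_mem (x : S) : (ctr x : EuclideanSpace ℝ (Fin n)) ∈ chartTgt n x := mem_chart_target _ x

@[simp]
theorem pt_ctr (x : S) : pt x (ctr x : EuclideanSpace ℝ (Fin n)) = x := pt_chart (mem_chartDom x)

theorem pt_trans {x x' : S} {y : EuclideanSpace ℝ (Fin n)} (hy : pt x y ∈ chartDom n x') :
    pt x' (trans x x' y) = pt x y := pt_chart hy

theorem trans_mem {x x' : S} {y : EuclideanSpace ℝ (Fin n)} (hy : pt x y ∈ chartDom n x') :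
    trans x x' y ∈ chartTgt n x' := chart_mem hy

theorem trans_ctr (x : S) (y : EuclideanSpace ℝ (Fin n)) : trans x (pt x y) y = ctr (pt x y) := rfl

theorem continuousOn_pt (x : S) :
    ContinuousOn (pt x : EuclideanSpace ℝ (Fin n) → S) (chartTgt n x) :=
  (chartAt (EuclideanSpace ℝ (Fin n)) x).continuousOn_symm

theorem continuousAt_pt {x : S} {y : EuclideanSpace ℝ (Fin n)} (hy : y ∈ chartTgt n x) :
    ContinuousAt (pt x : EuclideanSpace ℝ (Fin n) → S) y :=
  (continuousOn_pt x).continuousAt ((isOpen_chartTgt x).mem_nhds hy)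

theorem eventually_mem_tgt {x : S} {y : EuclideanSpace ℝ (Fin n)} (hy : y ∈ chartTgt n x) :
    ∀ᶠ z in 𝓝 y, z ∈ chartTgt n x := (isOpen_chartTgt x).mem_nhds hy

theorem eventually_pt_mem {x : S} {y : EuclideanSpace ℝ (Fin n)} (hy : y ∈ chartTgt n x)
    {U : Set S} (hU : IsOpen U) (hyU : pt x y ∈ U) : ∀ᶠ z in 𝓝 y, pt x z ∈ U :=
  (continuousAt_pt hy).eventually (hU.mem_nhds hyU)

/-- A function on the manifold is continuous if near each point it is given by a continuous
function in the chart around that point. -/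
theorem continuous_of_local {F : Type*} [TopologicalSpace F] {f : S → F}
    (h : ∀ x : S, ∃ f' : EuclideanSpace ℝ (Fin n) → F, ContinuousAt f' (ctr x) ∧
      ∀ᶠ y in 𝓝 (ctr x), f (pt x y) = f' y) : Continuous f := by
  rw [continuous_iff_continuousAt]
  intro x
  obtain ⟨f', hf', he⟩ := h x
  have hc : ContinuousAt (chartAt (EuclideanSpace ℝ (Fin n)) x) x :=
    (chartAt (EuclideanSpace ℝ (Fin n)) x).continuousAt (mem_chartDom x)
  have h1 : ContinuousAt (f' ∘ chartAt (EuclideanSpace ℝ (Fin n)) x) x :=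
    ContinuousAt.comp (g := f') hf' hc
  refine h1.congr ?_
  have h2 := hc.eventually he
  filter_upwards [h2, (isOpen_chartDom (n := n) x).mem_nhds (mem_chartDom x)] with p hp hpx
  rw [pt_chart hpx] at hp
  exact hp.symm

variable [IsManifold (𝓡 n) ∞ S]

theorem contMDiffOn_pt (x : S) :
    ContMDiffOn (𝓡 n) (𝓡 n) ∞ (pt x : EuclideanSpace ℝ (Fin n) → S) (chartTgt n x) :=
  contMDiffOn_chart_symm

theorem contMDiffAt_pt {x : S} {y : EuclideanSpace ℝ (Fin n)} (hy : y ∈ chartTgt n x) :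
    ContMDiffAt (𝓡 n) (𝓡 n) ∞ (pt x : EuclideanSpace ℝ (Fin n) → S) y :=
  (contMDiffOn_pt x).contMDiffAt ((isOpen_chartTgt x).mem_nhds hy)

theorem mdifferentiableAt_pt {x : S} {y : EuclideanSpace ℝ (Fin n)} (hy : y ∈ chartTgt n x) :
    MDifferentiableAt (𝓡 n) (𝓡 n) (pt x : EuclideanSpace ℝ (Fin n) → S) y :=
  (contMDiffAt_pt hy).mdifferentiableAt (by simp)

theorem contDiffAt_trans {x x' : S} {y : EuclideanSpace ℝ (Fin n)} (hy : y ∈ chartTgt n x)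
    (hy' : pt x y ∈ chartDom n x') : ContDiffAt ℝ ∞ (trans x x') y := by
  rw [← contMDiffAt_iff_contDiffAt]
  have h1 : ContMDiffAt (𝓡 n) (𝓡 n) ∞ (chartAt (EuclideanSpace ℝ (Fin n)) x') (pt x y) :=
    contMDiffOn_chart.contMDiffAt ((isOpen_chartDom x').mem_nhds hy')
  exact h1.comp y (contMDiffAt_pt hy)

/-- The derivative of the inverse of the preferred chart around `x`. Tangent spaces are identified
with the model space, as in the definition of `TangentSpace`. -/
noncomputable def dpt (x : S) (y : EuclideanSpace ℝ (Fin n)) :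
    EuclideanSpace ℝ (Fin n) →L[ℝ] EuclideanSpace ℝ (Fin n) :=
  mfderiv (𝓡 n) (𝓡 n) (pt x) y

theorem dpt_injective {x : S} {y : EuclideanSpace ℝ (Fin n)} (hy : y ∈ chartTgt n x) :
    Function.Injective (dpt x y) := by
  have : IsManifold (𝓡 n) 1 S := IsManifold.of_le (n := ∞) (by simp)
  exact ((mdifferentiable_chart (I := 𝓡 n) x).symm).mfderiv_injective hy

/-- The chain rule for the coordinate change between two charts. -/
theorem dpt_trans {x x' : S} {y : EuclideanSpace ℝ (Fin n)} (hy : y ∈ chartTgt n x)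
    (hy' : pt x y ∈ chartDom n x') (ξ : EuclideanSpace ℝ (Fin n)) :
    dpt x y ξ = dpt x' (trans x x' y) (fderiv ℝ (trans x x') y ξ) := by
  have e : (pt x : EuclideanSpace ℝ (Fin n) → S) =ᶠ[𝓝 y] fun z => pt x' (trans x x' z) := by
    filter_upwards [eventually_pt_mem hy (isOpen_chartDom x') hy'] with z hz
    exact (pt_trans hz).symm
  have h1 := e.mfderiv_eq (I := 𝓡 n) (I' := 𝓡 n)
  have h2 := mfderiv_comp (I := 𝓡 n) (I' := 𝓡 n) (I'' := 𝓡 n) y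
    (mdifferentiableAt_pt (trans_mem hy'))
    (((contDiffAt_trans hy hy').differentiableAt (by simp)).mdifferentiableAt)
  rw [mfderiv_eq_fderiv] at h2
  have h3 := h1.trans h2
  exact DFunLike.congr_fun h3 ξ

theorem contMDiffOn_dpt (x : S) (ξ : EuclideanSpace ℝ (Fin n)) :
    ContMDiffOn (𝓡 n) ((𝓡 n).tangent) ∞
      (fun y => (⟨pt x y, dpt x y ξ⟩ : TangentBundle (𝓡 n) S)) (chartTgt n x) := by
  have hu : UniqueMDiffOn (𝓡 n) (chartTgt n x) := (isOpen_chartTgt x).uniqueMDiffOn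
  have h1 := (contMDiffOn_pt (n := n) x).contMDiffOn_tangentMapWithin (m := ∞) (by simp) hu
  have h2 : ContMDiff (𝓡 n) ((𝓡 n).tangent) ∞
      (fun y : EuclideanSpace ℝ (Fin n) => (⟨y, ξ⟩ : TangentBundle (𝓡 n) _)) := by
    intro y
    exact contMDiffAt_vectorSpace_iff_contDiffAt.2 contDiffAt_const
  have h3 := h1.comp (s := chartTgt n x) h2.contMDiffOn (fun y hy => hy)
  refine h3.congr fun y hy => ?_
  simp only [Function.comp_apply, tangentMapWithin]
  rw [mfderivWithin_of_isOpen (isOpen_chartTgt x) hy]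
  rfl

section MetricForm

variable (σ : Metric n S)

/-- The metric in the preferred chart around `x`, as a bilinear form on `ℝⁿ`. -/
noncomputable def gramForm (x : S) (y : EuclideanSpace ℝ (Fin n)) :
    EuclideanSpace ℝ (Fin n) →L[ℝ] EuclideanSpace ℝ (Fin n) →L[ℝ] ℝ :=
  ContinuousLinearMap.bilinearComp
    (show EuclideanSpace ℝ (Fin n) →L[ℝ] EuclideanSpace ℝ (Fin n) →L[ℝ] ℝ from σ.inner (pt x y))
    (dpt x y) (dpt x y)

theorem gramForm_apply (x : S) (y ξ η : EuclideanSpace ℝ (Fin n)) :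
    gramForm σ x y ξ η = σ.inner (pt x y) (dpt x y ξ) (dpt x y η) := rfl

theorem gramForm_symm (x : S) (y ξ η : EuclideanSpace ℝ (Fin n)) :
    gramForm σ x y ξ η = gramForm σ x y η ξ := σ.symm _ _ _

theorem gramForm_pos {x : S} {y : EuclideanSpace ℝ (Fin n)} (hy : y ∈ chartTgt n x)
    {ξ : EuclideanSpace ℝ (Fin n)} (hξ : ξ ≠ 0) : 0 < gramForm σ x y ξ ξ := by
  refine σ.pos _ _ fun h0 => hξ (dpt_injective hy ?_)
  rw [map_zero]
  exact h0

theorem gram_posDef {x : S} {y : EuclideanSpace ℝ (Fin n)} (hy : y ∈ chartTgt n x) :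
    (gram σ x y).PosDef := by
  refine Matrix.PosDef.of_dotProduct_mulVec_pos ?_ ?_
  · ext i j
    simp only [Matrix.conjTranspose_apply, star_trivial]
    exact σ.symm _ _ _
  · intro v hv
    have h1 : WithLp.toLp 2 v ≠ (0 : EuclideanSpace ℝ (Fin n)) := by
      intro h0; exact hv (by simpa using congrArg WithLp.ofLp h0)
    have h2 := gramForm_pos σ hy h1
    have h3 := map_eq_sum_bas (LinearMap.flip (gramForm σ x y).toLinearMap₁₂ (WithLp.toLp 2 v))
      (WithLp.toLp 2 v)
    have h4 : ∀ i, gramForm σ x y (bas i) (WithLp.toLp 2 v) = ∑ j, v j * gram σ x y i j := fun i =>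
      map_eq_sum_bas (gramForm σ x y (bas i)).toLinearMap (WithLp.toLp 2 v)
    have h5 : gramForm σ x y (WithLp.toLp 2 v) (WithLp.toLp 2 v)
      = ∑ i, v i * ∑ j, v j * gram σ x y i j := h3.trans (by
        refine Finset.sum_congr rfl fun i _ => ?_
        rw [← h4]
        rfl)
    rw [h5] at h2
    simp only [star_trivial, dotProduct, Matrix.mulVec]
    refine h2.trans_eq ?_
    refine Finset.sum_congr rfl fun i _ => ?_
    congr 1
    exact Finset.sum_congr rfl fun j _ => mul_comm _ _

theorem det_gram_pos {x : S} {y : EuclideanSpace ℝ (Fin n)} (hy : y ∈ chartTgt n x) :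
    0 < (gram σ x y).det := (gram_posDef σ hy).det_pos

theorem density_pos {x : S} {y : EuclideanSpace ℝ (Fin n)} (hy : y ∈ chartTgt n x) :
    0 < density σ x y := Real.sqrt_pos.2 (det_gram_pos σ hy)

theorem gramForm_trans {x x' : S} {y : EuclideanSpace ℝ (Fin n)} (hy : y ∈ chartTgt n x)
    (hy' : pt x y ∈ chartDom n x') (ξ η : EuclideanSpace ℝ (Fin n)) :
    gramForm σ x y ξ η = gramForm σ x' (trans x x' y) (fderiv ℝ (trans x x') y ξ)
      (fderiv ℝ (trans x x') y η) := by
  rw [gramForm_apply, gramForm_apply, dpt_trans hy hy', dpt_trans hy hy' η, pt_trans hy']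

theorem contDiffAt_gram {x : S} {y : EuclideanSpace ℝ (Fin n)} (hy : y ∈ chartTgt n x)
    (i j : Fin n) : ContDiffAt ℝ ∞ (fun z => gram σ x z i j) y := by
  have h0 := σ.contMDiff
  have hv : ∀ k, ContMDiffAt (𝓡 n) ((𝓡 n).tangent) ∞
      (fun y => (⟨pt x y, dpt x y (bas k)⟩ : TangentBundle (𝓡 n) S)) y := fun k =>
    (contMDiffOn_dpt x (bas k)).contMDiffAt ((isOpen_chartTgt x).mem_nhds hy)
  let _ : RiemannianBundle (fun p : S => TangentSpace (𝓡 n) p) := ⟨σ.toRiemannianMetric⟩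
  rw [← contMDiffAt_iff_contDiffAt]
  exact (hv i).inner_bundle (hv j)

theorem contDiffAt_gramForm {x : S} {y : EuclideanSpace ℝ (Fin n)} (hy : y ∈ chartTgt n x) :
    ContDiffAt ℝ ∞ (gramForm σ x) y := by
  have h1 : gramForm σ x = fun z => ∑ i, ∑ j, gram σ x z i j •
    (EuclideanSpace.proj i : EuclideanSpace ℝ (Fin n) →L[ℝ] ℝ).smulRight
      (EuclideanSpace.proj j : EuclideanSpace ℝ (Fin n) →L[ℝ] ℝ) := by
    funext z
    refine ContinuousLinearMap.ext fun ξ => ContinuousLinearMap.ext fun η => ?_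
    have h3 := map_eq_sum_bas (LinearMap.flip (gramForm σ x z).toLinearMap₁₂ η) ξ
    have h4 : ∀ i, gramForm σ x z (bas i) η = ∑ j, η j * gram σ x z i j := fun i =>
      map_eq_sum_bas (gramForm σ x z (bas i)).toLinearMap η
    refine h3.trans ?_
    simp only [sum_apply, smul_apply, ContinuousLinearMap.smulRight_apply, PiLp.proj_apply]
    refine Finset.sum_congr rfl fun i _ => ?_
    refine (congrArg (fun t => ξ i • t) (h4 i)).trans ?_
    simp only [smul_eq_mul, Finset.mul_sum]
    exact Finset.sum_congr rfl fun j _ => by ring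
  rw [h1]
  exact ContDiffAt.sum fun i _ => ContDiffAt.sum fun j _ =>
    contDiffAt_smul_vec (contDiffAt_gram σ hy i j) _

theorem contDiffAt_gramInv {x : S} {y : EuclideanSpace ℝ (Fin n)} (hy : y ∈ chartTgt n x)
    (i j : Fin n) : ContDiffAt ℝ ∞ (fun z => gramInv σ x z i j) y :=
  contDiffAt_inv_apply (contDiffAt_gram σ hy) (det_gram_pos σ hy).ne' i j

theorem contDiffAt_density {x : S} {y : EuclideanSpace ℝ (Fin n)} (hy : y ∈ chartTgt n x) :
    ContDiffAt ℝ ∞ (density σ x) y :=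
  (contDiffAt_det (contDiffAt_gram σ hy)).sqrt (det_gram_pos σ hy).ne'

theorem density_trans {x x' : S} {y : EuclideanSpace ℝ (Fin n)} (hy : y ∈ chartTgt n x)
    (hy' : pt x y ∈ chartDom n x') :
    density σ x y = |(fderiv ℝ (trans x x') y).det| * density σ x' (trans x x' y) := by
  have h := det_formMatrix_pullback (gramForm_trans σ hy hy')
  have h1 : (gram σ x y).det
      = (fderiv ℝ (trans x x') y).det ^ 2 * (gram σ x' (trans x x' y)).det := h
  rw [density, h1, Real.sqrt_mul (sq_nonneg _), Real.sqrt_sq_eq_abs]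
  rfl

/-- Contraction with the inverse metric of a bilinear form on the tangent spaces does not depend
on the chart. -/
theorem contraction_trans {x x' : S} {y : EuclideanSpace ℝ (Fin n)} (hy : y ∈ chartTgt n x)
    (hy' : pt x y ∈ chartDom n x') {F : Type*} [AddCommGroup F] [Module ℝ F]
    (b : EuclideanSpace ℝ (Fin n) →ₗ[ℝ] EuclideanSpace ℝ (Fin n) →ₗ[ℝ] F) :
    ∑ i, ∑ j, gramInv σ x y i j •
        b (fderiv ℝ (trans x x') y (bas i)) (fderiv ℝ (trans x x') y (bas j))
      = ∑ i, ∑ j, gramInv σ x' (trans x x' y) i j • b (bas i) (bas j) :=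
  contraction_pullback (gramForm_trans σ hy hy') (det_gram_pos σ hy).ne' b

theorem scalarCurvature_eq (p : S) : scalarCurvature σ p = scalOf (gram σ p) (ctr p) := rfl

theorem scalOf_trans {x x' : S} {y : EuclideanSpace ℝ (Fin n)} (hy : y ∈ chartTgt n x)
    (hy' : pt x y ∈ chartDom n x') :
    scalOf (gram σ x) y = scalOf (gram σ x') (trans x x' y) := by
  refine scalOf_transform (g := gramForm σ x) (g' := gramForm σ x') (τ := trans x x')
    ((contDiffAt_gramForm σ hy).of_le (ENat.LEInfty.out))
    ((contDiffAt_gramForm σ (trans_mem hy')).of_le ENat.LEInfty.out)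
    ((contDiffAt_trans hy hy').of_le ENat.LEInfty.out)
    (Filter.Eventually.of_forall fun z => gramForm_symm σ x z)
    (Filter.Eventually.of_forall fun z => gramForm_symm σ x' z) (det_gram_pos σ hy).ne' ?_
  filter_upwards [eventually_mem_tgt hy, eventually_pt_mem hy (isOpen_chartDom x') hy']
    with z h1 h2 using gramForm_trans σ h1 h2

theorem continuous_scalarCurvature : Continuous (scalarCurvature σ) := by
  refine continuous_of_local (n := n) fun x => ⟨scalOf (gram σ x), ?_, ?_⟩
  · have hg := contDiffAt_gramForm σ (ctr_mem x)
    have hdet : (formMatrix (gramForm σ x (ctr x))).det ≠ 0 := (det_gram_pos σ (ctr_mem x)).ne'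
    have hc : ∀ k i j, ContDiffAt ℝ 1 (chrOf (gram σ x) k i j) (ctr x) := fun k i j =>
      chrOf_contDiffAt (k := 1) (hg.of_le (by exact_mod_cast le_top)) hdet k i j
    have hpd : ∀ k i j l, ContinuousAt (pd l (chrOf (gram σ x) k i j)) (ctr x) := fun k i j l =>
      (((hc k i j).fderiv_right (m := 0) (by norm_num)).clm_apply contDiffAt_const).continuousAt
    have hcc : ∀ k i j, ContinuousAt (chrOf (gram σ x) k i j) (ctr x) := fun k i j =>
      (hc k i j).continuousAt
    have hgi : ∀ i j, ContinuousAt (fun y => (gram σ x y)⁻¹ i j) (ctr x) := fun i j =>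
      (contDiffAt_gramInv σ (ctr_mem x) i j).continuousAt
    unfold scalOf ricOf
    refine tendsto_finsetSum _ fun i _ => tendsto_finsetSum _ fun j _ => (hgi i j).mul ?_
    refine ContinuousAt.add ?_ ?_
    · exact tendsto_finsetSum _ fun k _ => (hpd _ _ _ _).sub (hpd _ _ _ _)
    · exact tendsto_finsetSum _ fun k _ => tendsto_finsetSum _ fun l _ =>
        ((hcc _ _ _).mul (hcc _ _ _)).sub ((hcc _ _ _).mul (hcc _ _ _))
  · filter_upwards [eventually_mem_tgt (ctr_mem x)] with y hy
    rw [scalarCurvature_eq, scalOf_trans σ hy (mem_chartDom (pt x y)), trans_ctr]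

end MetricForm

end Transition

/-! ### The adjoint action and the Killing form -/

section LieAlgebra

variable {𝔤 : Type*} [NormedAddCommGroup 𝔤] [NormedSpace ℝ 𝔤]
  {G : Type*} [TopologicalSpace G] [ChartedSpace 𝔤 G] [Group G]

section Adjoint

variable [CompleteSpace 𝔤] [LieGroup 𝓘(ℝ, 𝔤) ∞ G]

omit [CompleteSpace 𝔤] in
theorem contMDiff_conj (h : G) :
    ContMDiff 𝓘(ℝ, 𝔤) 𝓘(ℝ, 𝔤) ∞ (fun x : G => h * x * h⁻¹) :=
  (contMDiff_mul_right (a := h⁻¹)).comp (contMDiff_mul_left (a := h))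

omit [CompleteSpace 𝔤] in
theorem mfderiv_conj_isInvertible (h g : G) :
    (mfderiv 𝓘(ℝ, 𝔤) 𝓘(ℝ, 𝔤) (fun x : G => h * x * h⁻¹) g).IsInvertible := by
  have hd : ∀ (k q : G), MDifferentiableAt 𝓘(ℝ, 𝔤) 𝓘(ℝ, 𝔤) (fun x : G => k * x * k⁻¹) q :=
    fun k q => (contMDiff_conj (𝔤 := 𝔤) k).mdifferentiableAt (by simp)
  have hc : ∀ k : G, (fun x : G => k⁻¹ * x * (k⁻¹)⁻¹) ∘ (fun x : G => k * x * k⁻¹) = id := by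
    intro k; funext x; simp [mul_assoc]
  have hc' : ∀ k : G, (fun x : G => k * x * k⁻¹) ∘ (fun x : G => k⁻¹ * x * (k⁻¹)⁻¹) = id := by
    intro k; funext x; simp [mul_assoc]
  have h1 : (mfderiv 𝓘(ℝ, 𝔤) 𝓘(ℝ, 𝔤) (fun x : G => h⁻¹ * x * (h⁻¹)⁻¹) (h * g * h⁻¹)).comp
      (mfderiv 𝓘(ℝ, 𝔤) 𝓘(ℝ, 𝔤) (fun x : G => h * x * h⁻¹) g) = ContinuousLinearMap.id ℝ 𝔤 := by
    have := mfderiv_comp (I := 𝓘(ℝ, 𝔤)) (I' := 𝓘(ℝ, 𝔤)) (I'' := 𝓘(ℝ, 𝔤)) g (hd h⁻¹ (h * g * h⁻¹))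
      (hd h g)
    rw [hc, mfderiv_id] at this
    exact this.symm
  have h2 : (mfderiv 𝓘(ℝ, 𝔤) 𝓘(ℝ, 𝔤) (fun x : G => h * x * h⁻¹) g).comp
      (mfderiv 𝓘(ℝ, 𝔤) 𝓘(ℝ, 𝔤) (fun x : G => h⁻¹ * x * (h⁻¹)⁻¹) (h * g * h⁻¹))
        = ContinuousLinearMap.id ℝ 𝔤 := by
    have e : h⁻¹ * (h * g * h⁻¹) * (h⁻¹)⁻¹ = g := by simp [mul_assoc]
    have := mfderiv_comp_of_eq (I := 𝓘(ℝ, 𝔤)) (I' := 𝓘(ℝ, 𝔤)) (I'' := 𝓘(ℝ, 𝔤)) (hd h g)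
      (hd h⁻¹ (h * g * h⁻¹)) e
    rw [hc', mfderiv_id] at this
    exact (congrArg (fun T : 𝔤 →L[ℝ] 𝔤 => T.comp _) (mfderiv_congr_point (I := 𝓘(ℝ, 𝔤))
      (I' := 𝓘(ℝ, 𝔤)) (f := fun x : G => h * x * h⁻¹) e).symm).trans this.symm
  exact ContinuousLinearMap.IsInvertible.of_inverse h2 h1

/-- The adjoint action preserves the Lie bracket: conjugation by `h` pulls the left-invariant
vector field of `Ad h X` back to that of `X`. -/
theorem bracket_Ad (h : G) (X Y : 𝔤) :
    bracket G (Ad h X) (Ad h Y) = Ad h (bracket G X Y) := by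
  have hd : ∀ (k q : G), MDifferentiableAt 𝓘(ℝ, 𝔤) 𝓘(ℝ, 𝔤) (fun x : G => k * x * k⁻¹) q :=
    fun k q => (contMDiff_conj (𝔤 := 𝔤) k).mdifferentiableAt (by simp)
  have hl : ∀ (k q : G), MDifferentiableAt 𝓘(ℝ, 𝔤) 𝓘(ℝ, 𝔤) (fun x : G => k * x) q :=
    fun k q => (contMDiff_mul_left (I := 𝓘(ℝ, 𝔤)) (n := ∞) (a := k)).mdifferentiableAt (by simp)
  have e1 : h * 1 * h⁻¹ = 1 := by simp
  have hp : ∀ X : 𝔤, VectorField.mpullback 𝓘(ℝ, 𝔤) 𝓘(ℝ, 𝔤) (fun x : G => h * x * h⁻¹)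
      (mulInvariantVectorField (I := 𝓘(ℝ, 𝔤)) (G := G) (Ad (𝔤 := 𝔤) h X))
        = mulInvariantVectorField (I := 𝓘(ℝ, 𝔤)) (G := G) X := by
    intro X
    funext g
    rw [VectorField.mpullback_apply]
    refine (mfderiv_conj_isInvertible h g).inverse_apply_eq.2 ?_
    have a1 := mfderiv_comp_of_eq (I := 𝓘(ℝ, 𝔤)) (I' := 𝓘(ℝ, 𝔤)) (I'' := 𝓘(ℝ, 𝔤))
      (hl (h * g * h⁻¹) 1) (hd h 1) e1
    have a2 := mfderiv_comp_of_eq (I := 𝓘(ℝ, 𝔤)) (I' := 𝓘(ℝ, 𝔤)) (I'' := 𝓘(ℝ, 𝔤))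
      (hd h g) (hl g 1) (mul_one g)
    have a3 : (fun x : G => h * g * h⁻¹ * x) ∘ (fun x : G => h * x * h⁻¹)
        = (fun x : G => h * x * h⁻¹) ∘ (fun x : G => g * x) := by
      funext x; simp [mul_assoc]
    rw [a3] at a1
    have a4 := DFunLike.congr_fun (a1.symm.trans a2) X
    have b1 := DFunLike.congr_fun (mfderiv_congr_point (I := 𝓘(ℝ, 𝔤)) (I' := 𝓘(ℝ, 𝔤))
      (f := fun x : G => h * g * h⁻¹ * x) e1) (Ad (𝔤 := 𝔤) h X)
    have b2 := DFunLike.congr_fun (mfderiv_congr_point (I := 𝓘(ℝ, 𝔤)) (I' := 𝓘(ℝ, 𝔤))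
      (f := fun x : G => h * x * h⁻¹) (mul_one g))
        (mulInvariantVectorField (I := 𝓘(ℝ, 𝔤)) (G := G) X g)
    exact b1.symm.trans (a4.trans b2)
  have hb := VectorField.mpullback_mlieBracket (I := 𝓘(ℝ, 𝔤)) (I' := 𝓘(ℝ, 𝔤)) (x₀ := (1 : G))
    (n := ∞) (f := fun x : G => h * x * h⁻¹)
    (V := mulInvariantVectorField (I := 𝓘(ℝ, 𝔤)) (G := G) (Ad (𝔤 := 𝔤) h X))
    (W := mulInvariantVectorField (I := 𝓘(ℝ, 𝔤)) (G := G) (Ad (𝔤 := 𝔤) h Y))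
    (mdifferentiableAt_mulInvariantVectorField _) (mdifferentiableAt_mulInvariantVectorField _)
    (contMDiff_conj (𝔤 := 𝔤) h).contMDiffAt
    (by rw [minSmoothness_of_isRCLikeNormedField]; exact ENat.LEInfty.out)
  rw [hp, hp, VectorField.mpullback_apply] at hb
  have hb' := (mfderiv_conj_isInvertible h 1).inverse_apply_eq.1 hb
  have e2 : ∀ q : G, q = 1 → (show 𝔤 from VectorField.mlieBracket 𝓘(ℝ, 𝔤)
      (mulInvariantVectorField (I := 𝓘(ℝ, 𝔤)) (G := G) (Ad (𝔤 := 𝔤) h X))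
      (mulInvariantVectorField (I := 𝓘(ℝ, 𝔤)) (G := G) (Ad (𝔤 := 𝔤) h Y)) q)
      = bracket G (Ad h X) (Ad h Y) := by
    rintro q rfl; rfl
  exact (e2 _ e1).symm.trans hb'

end Adjoint

section Killing

variable [LieGroup 𝓘(ℝ, 𝔤) ∞ G]

variable (G) in
/-- The Lie bracket as a bilinear map. -/
noncomputable def bracketₗ [CompleteSpace 𝔤] : 𝔤 →ₗ[ℝ] 𝔤 →ₗ[ℝ] 𝔤 :=
  LinearMap.mk₂ ℝ (fun X Y => bracket G X Y)
    (fun X Y Z => add_lie (L := GroupLieAlgebra 𝓘(ℝ, 𝔤) G) (M := GroupLieAlgebra 𝓘(ℝ, 𝔤) G) X Y Z)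
    (fun c X Y =>
      smul_lie (L := GroupLieAlgebra 𝓘(ℝ, 𝔤) G) (M := GroupLieAlgebra 𝓘(ℝ, 𝔤) G) c X Y)
    (fun X Y Z => lie_add (L := GroupLieAlgebra 𝓘(ℝ, 𝔤) G) (M := GroupLieAlgebra 𝓘(ℝ, 𝔤) G) X Y Z)
    (fun c X Y =>
      lie_smul (L := GroupLieAlgebra 𝓘(ℝ, 𝔤) G) (M := GroupLieAlgebra 𝓘(ℝ, 𝔤) G) c X Y)

theorem bracketₗ_apply [CompleteSpace 𝔤] (X Y : 𝔤) : bracketₗ G X Y = bracket G X Y := rfl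

variable (G) in
/-- The Cartan-Killing metric as a bilinear form. -/
noncomputable def cartanKillingₗ [CompleteSpace 𝔤] : 𝔤 →ₗ[ℝ] 𝔤 →ₗ[ℝ] ℝ :=
  -(killingForm ℝ (GroupLieAlgebra 𝓘(ℝ, 𝔤) G))

theorem cartanKillingₗ_apply [CompleteSpace 𝔤] (X Y : 𝔤) :
    cartanKillingₗ G X Y = cartanKilling G X Y := rfl

theorem cartanKilling_eq_trace [CompleteSpace 𝔤] (X Y : 𝔤) :
    cartanKilling G X Y = -LinearMap.trace ℝ 𝔤 (bracketₗ G X ∘ₗ bracketₗ G Y) := rfl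

/-- The Cartan-Killing metric only depends on the conjugacy class of the adjoint endomorphisms. -/
theorem cartanKilling_of_intertwine [CompleteSpace 𝔤] (C : 𝔤 ≃ₗ[ℝ] 𝔤) {X X' Y Y' : 𝔤}
    (hX : ∀ w, bracket G X' (C w) = C (bracket G X w))
    (hY : ∀ w, bracket G Y' (C w) = C (bracket G Y w)) :
    cartanKilling G X' Y' = cartanKilling G X Y := by
  rw [cartanKilling_eq_trace, cartanKilling_eq_trace,
    ← LinearMap.trace_conj' (bracketₗ G X ∘ₗ bracketₗ G Y) C]
  congr 2
  refine LinearMap.ext fun w' => ?_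
  obtain ⟨w, rfl⟩ := C.surjective w'
  rw [LinearEquiv.conj_apply_apply, LinearEquiv.symm_apply_apply]
  simp only [LinearMap.comp_apply, bracketₗ_apply, hX, hY]

variable [FiniteDimensional ℝ 𝔤]

variable (G) in
/-- The Lie bracket as a continuous bilinear map. -/
noncomputable def bracketL [CompleteSpace 𝔤] : 𝔤 →L[ℝ] 𝔤 →L[ℝ] 𝔤 :=
  LinearMap.toContinuousLinearMap
    ((LinearMap.toContinuousLinearMap (E := 𝔤) (F' := 𝔤) (𝕜 := ℝ)).toLinearMap ∘ₗ bracketₗ G)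

theorem bracket_jacobi [CompleteSpace 𝔤] (X Y w : 𝔤) :
    bracketL G (bracketL G X Y) w
      = bracketL G X (bracketL G Y w) - bracketL G Y (bracketL G X w) :=
  lie_lie (L := GroupLieAlgebra 𝓘(ℝ, 𝔤) G) (M := GroupLieAlgebra 𝓘(ℝ, 𝔤) G) X Y w

theorem continuous_cartanKilling [CompleteSpace 𝔤] :
    Continuous fun q : 𝔤 × 𝔤 => cartanKilling G q.1 q.2 := by
  let K : 𝔤 →L[ℝ] 𝔤 →L[ℝ] ℝ := LinearMap.toContinuousLinearMap
    ((LinearMap.toContinuousLinearMap (E := 𝔤) (F' := ℝ) (𝕜 := ℝ)).toLinearMap ∘ₗ cartanKillingₗ G)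
  have h : (fun q : 𝔤 × 𝔤 => cartanKilling G q.1 q.2) = fun q => K q.1 q.2 := rfl
  rw [h]
  exact (K.continuous.comp continuous_fst).clm_apply continuous_snd

end Killing

end LieAlgebra

/-! ### Curvature of gauge connections -/

section GaugeCurvature

variable {E W : Type*} [NormedAddCommGroup E] [NormedSpace ℝ E]
  [NormedAddCommGroup W] [NormedSpace ℝ W]

/-- The field strength `da + [a, a]` of the gauge potential `a`, as a bilinear map. -/
noncomputable def gaugeCurv (br : W →L[ℝ] W →L[ℝ] W) (a : E → E →L[ℝ] W) (y : E) :
    E →ₗ[ℝ] E →ₗ[ℝ] W :=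
  LinearMap.mk₂ ℝ (fun ξ η => fderiv ℝ a y ξ η - fderiv ℝ a y η ξ + br (a y ξ) (a y η))
    (fun _ _ _ => by simp only [ContinuousLinearMap.map_add, add_apply]; abel)
    (fun _ _ _ => by
      simp only [ContinuousLinearMap.map_smul, smul_apply, smul_add, smul_sub])
    (fun _ _ _ => by simp only [ContinuousLinearMap.map_add, add_apply]; abel)
    (fun _ _ _ => by
      simp only [ContinuousLinearMap.map_smul, smul_apply, smul_add, smul_sub])

theorem gaugeCurv_apply (br : W →L[ℝ] W →L[ℝ] W) (a : E → E →L[ℝ] W) (y ξ η : E) :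
    gaugeCurv br a y ξ η
      = fderiv ℝ a y ξ η - fderiv ℝ a y η ξ + br (a y ξ) (a y η) := rfl

/-- The curvature of the adjoint connection form is the adjoint endomorphism of the field
strength. -/
theorem connCurv_eq_gaugeCurv {br : W →L[ℝ] W →L[ℝ] W}
    (jac : ∀ X Y w, br (br X Y) w = br X (br Y w) - br Y (br X w)) {a : E → E →L[ℝ] W} {y : E}
    (ha : DifferentiableAt ℝ a y) (ξ η : E) (w : W) :
    connCurv (fun z => br.comp (a z)) y ξ η w = br (gaugeCurv br a y ξ η) w := by
  have h1 := (hasFDerivAt_const br y).clm_comp ha.hasFDerivAt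
  rw [connCurv, h1.fderiv, gaugeCurv_apply]
  simp only [ContinuousLinearMap.comp_apply, ContinuousLinearMap.compL_apply, zero_apply,
    map_zero, add_zero,
    ContinuousLinearMap.map_add, ContinuousLinearMap.map_sub, add_apply, sub_apply, jac]

end GaugeCurvature

section DoubleContraction

variable {n : ℕ} {h h' : EuclideanSpace ℝ (Fin n) →L[ℝ] EuclideanSpace ℝ (Fin n) →L[ℝ] ℝ}
  {J : EuclideanSpace ℝ (Fin n) →L[ℝ] EuclideanSpace ℝ (Fin n)}

/-- The squared norm of a two-form with values in a space with a bilinear form does not depend on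
the coordinates. -/
theorem double_contraction_pullback (hJ : ∀ ξ η, h ξ η = h' (J ξ) (J η))
    (hdet : (formMatrix h).det ≠ 0) {W : Type*} [AddCommGroup W] [Module ℝ W]
    (Q : W →ₗ[ℝ] W →ₗ[ℝ] ℝ)
    (c : EuclideanSpace ℝ (Fin n) →ₗ[ℝ] EuclideanSpace ℝ (Fin n) →ₗ[ℝ] W) :
    ∑ i, ∑ j, ∑ k, ∑ l, (formMatrix h)⁻¹ i k * (formMatrix h)⁻¹ j l *
        Q (c (J (bas i)) (J (bas j))) (c (J (bas k)) (J (bas l)))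
      = ∑ i, ∑ j, ∑ k, ∑ l, (formMatrix h')⁻¹ i k * (formMatrix h')⁻¹ j l *
        Q (c (bas i) (bas j)) (c (bas k) (bas l)) := by
  have s : ∀ (N : Matrix (Fin n) (Fin n) ℝ) (f : Fin n → Fin n → Fin n → Fin n → ℝ),
      ∑ i, ∑ j, ∑ k, ∑ l, N i k * N j l * f i j k l
        = ∑ i, ∑ k, N i k * ∑ j, ∑ l, N j l * f i j k l := by
    intro N f
    refine Finset.sum_congr rfl fun i _ => ?_
    rw [Finset.sum_comm]
    refine Finset.sum_congr rfl fun k _ => ?_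
    simp only [Finset.mul_sum, mul_assoc]
  rw [s, s]
  have h1 : ∀ ξ ξ', ∑ j, ∑ l, (formMatrix h)⁻¹ j l * Q (c ξ (J (bas j))) (c ξ' (J (bas l)))
      = ∑ j, ∑ l, (formMatrix h')⁻¹ j l * Q (c ξ (bas j)) (c ξ' (bas l)) := fun ξ ξ' => by
    have := contraction_pullback hJ hdet (Q.compl₁₂ (c ξ) (c ξ'))
    simpa only [LinearMap.compl₁₂_apply, smul_eq_mul] using this
  simp only [h1]
  have h2 := contraction_pullback hJ hdet
    (∑ j, ∑ l, (formMatrix h')⁻¹ j l • Q.compl₁₂ (c.flip (bas j)) (c.flip (bas l)))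
  simpa only [LinearMap.sum_apply, LinearMap.smul_apply, LinearMap.compl₁₂_apply,
    LinearMap.flip_apply, smul_eq_mul] using h2

end DoubleContraction

section Gauge

variable {𝔤 : Type*} [NormedAddCommGroup 𝔤] [NormedSpace ℝ 𝔤]
  {G : Type*} [TopologicalSpace G] [ChartedSpace 𝔤 G] [Group G]
  {n : ℕ} {S : Type*} [TopologicalSpace S] [ChartedSpace (EuclideanSpace ℝ (Fin n)) S]
  {ι : Type*} [IsManifold (𝓡 n) ∞ S] {Z : VectorBundleCore ℝ S 𝔤 ι}

/-- The transition functions of a vector bundle are linear isomorphisms. -/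
noncomputable def coordEquiv (Z : VectorBundleCore ℝ S 𝔤 ι) (i j : ι) {p : S}
    (hp : p ∈ Z.baseSet i ∩ Z.baseSet j) : 𝔤 ≃ₗ[ℝ] 𝔤 :=
  LinearEquiv.ofLinearMap (Z.coordChange i j p).toLinearMap (Z.coordChange j i p).toLinearMap
    (by
      refine LinearMap.ext fun v => ?_
      have := Z.coordChange_comp j i j p ⟨⟨hp.2, hp.1⟩, hp.2⟩ v
      rw [Z.coordChange_self j p hp.2] at this
      exact this)
    (by
      refine LinearMap.ext fun v => ?_
      have := Z.coordChange_comp i j i p ⟨⟨hp.1, hp.2⟩, hp.1⟩ v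
      rw [Z.coordChange_self i p hp.1] at this
      exact this)

omit [IsManifold (𝓡 n) ∞ S] [ChartedSpace (EuclideanSpace ℝ (Fin n)) S] in
theorem coordEquiv_apply (i j : ι) {p : S} (hp : p ∈ Z.baseSet i ∩ Z.baseSet j) (v : 𝔤) :
    coordEquiv Z i j hp v = Z.coordChange i j p v := rfl

/-- The local gauge potential in the preferred chart around `x`. -/
noncomputable def gaugeForm (A : GaugeConnection G (n := n) Z) (i : ι) (x : S)
    (y : EuclideanSpace ℝ (Fin n)) : EuclideanSpace ℝ (Fin n) →L[ℝ] 𝔤 :=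
  ContinuousLinearMap.comp (show EuclideanSpace ℝ (Fin n) →L[ℝ] 𝔤 from A.potential i (pt x y))
    (dpt x y)

theorem contDiffAt_gaugeForm (A : GaugeConnection G (n := n) Z) {i : ι} {x : S}
    {y : EuclideanSpace ℝ (Fin n)} (hy : y ∈ chartTgt n x) (hi : pt x y ∈ Z.baseSet i) :
    ContDiffAt ℝ ∞ (gaugeForm A i x) y := by
  have h1 : gaugeForm A i x = fun z => ∑ k, ContinuousLinearMap.smulRightL ℝ _ 𝔤
      (EuclideanSpace.proj k : EuclideanSpace ℝ (Fin n) →L[ℝ] ℝ) (A.comp i x k z) := by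
    funext z
    refine ContinuousLinearMap.ext fun ξ => ?_
    refine (map_eq_sum_bas (gaugeForm A i x z).toLinearMap ξ).trans ?_
    rw [sum_apply]
    rfl
  rw [h1]
  refine ContDiffAt.sum fun k _ => (ContinuousLinearMap.contDiff _).contDiffAt.comp y ?_
  refine (A.smooth i x k).contDiffAt ?_
  filter_upwards [eventually_mem_tgt hy, eventually_pt_mem hy (Z.isOpen_baseSet i) hi]
    with z h1 h2 using ⟨h1, h2⟩

theorem gaugeForm_differentiableAt (A : GaugeConnection G (n := n) Z) {i : ι} {x : S}
    {y : EuclideanSpace ℝ (Fin n)} (hy : y ∈ chartTgt n x) (hi : pt x y ∈ Z.baseSet i) :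
    DifferentiableAt ℝ (gaugeForm A i x) y :=
  (contDiffAt_gaugeForm A hy hi).differentiableAt (by simp)

theorem contDiffAt_coordChange [Z.IsContMDiff (𝓡 n) ∞] {i j : ι} {x : S}
    {y : EuclideanSpace ℝ (Fin n)} (hy : y ∈ chartTgt n x)
    (hij : pt x y ∈ Z.baseSet i ∩ Z.baseSet j) :
    ContDiffAt ℝ ∞ (fun z => Z.coordChange i j (pt x z)) y := by
  rw [← contMDiffAt_iff_contDiffAt]
  have h1 : ContMDiffAt (𝓡 n) 𝓘(ℝ, 𝔤 →L[ℝ] 𝔤) ∞ (Z.coordChange i j) (pt x y) :=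
    (Z.contMDiffOn_coordChange (𝓡 n) i j).contMDiffAt
      (((Z.isOpen_baseSet i).inter (Z.isOpen_baseSet j)).mem_nhds hij)
  exact h1.comp y (contMDiffAt_pt hy)

variable [LieGroup 𝓘(ℝ, 𝔤) ∞ G] [FiniteDimensional ℝ 𝔤] [CompleteSpace 𝔤]

theorem curvature_eq (A : GaugeConnection G (n := n) Z) {i : ι} {x : S}
    {y : EuclideanSpace ℝ (Fin n)} (hy : y ∈ chartTgt n x) (hi : pt x y ∈ Z.baseSet i)
    (j k : Fin n) : A.curvature i x j k y
      = gaugeCurv (bracketL G) (gaugeForm A i x) y (bas j) (bas k) := by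
  have h : ∀ a b, pd a (A.comp i x b) y = fderiv ℝ (gaugeForm A i x) y (bas a) (bas b) := by
    intro a b
    have h1 := (gaugeForm_differentiableAt A hy hi).hasFDerivAt.clm_apply
      (hasFDerivAt_const (bas b) y)
    have h2 : A.comp i x b = fun z => gaugeForm A i x z (bas b) := rfl
    rw [pd, h2, h1.fderiv]
    simp
  rw [GaugeConnection.curvature, h, h, gaugeCurv_apply]
  rfl

/-- The law of change of gauge, in local coordinates. -/
theorem gauge_law [Z.IsContMDiff (𝓡 n) ∞] (A : GaugeConnection G (n := n) Z) {i j : ι} {x x' : S}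
    {y : EuclideanSpace ℝ (Fin n)} (hy : y ∈ chartTgt n x) (hy' : pt x y ∈ chartDom n x')
    (hij : pt x y ∈ Z.baseSet i ∩ Z.baseSet j) (ξ : EuclideanSpace ℝ (Fin n)) (w : 𝔤) :
    fderiv ℝ (fun z => Z.coordChange i j (pt x z)) y ξ w
      + bracketL G (gaugeForm A j x' (trans x x' y) (fderiv ℝ (trans x x') y ξ))
        (Z.coordChange i j (pt x y) w)
      = Z.coordChange i j (pt x y) (bracketL G (gaugeForm A i x y ξ) w) := by
  have h1 := A.gauge i j (pt x y) hij (dpt x y ξ) w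
  have h2 : gaugeForm A j x' (trans x x' y) (fderiv ℝ (trans x x') y ξ)
      = A.potential j (pt x y) (dpt x y ξ) := by
    rw [gaugeForm, ContinuousLinearMap.comp_apply, ← dpt_trans hy hy', pt_trans hy']
    rfl
  have hC : DifferentiableAt ℝ (fun z => Z.coordChange i j (pt x z)) y :=
    (contDiffAt_coordChange hy hij).differentiableAt (by simp)
  have h3 : fderiv ℝ (fun z => Z.coordChange i j (pt x z)) y ξ w
      = (show 𝔤 from mfderiv (𝓡 n) 𝓘(ℝ, 𝔤) (fun q => Z.coordChange i j q w) (pt x y)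
        (dpt x y ξ)) := by
    have a1 : ContMDiffAt (𝓡 n) 𝓘(ℝ, 𝔤) ∞ (fun q => Z.coordChange i j q w) (pt x y) :=
      ((Z.contMDiffOn_coordChange (𝓡 n) i j).contMDiffAt
        (((Z.isOpen_baseSet i).inter (Z.isOpen_baseSet j)).mem_nhds hij)).clm_apply
        contMDiffAt_const
    have a2 := mfderiv_comp (I := 𝓡 n) (I' := 𝓡 n) (I'' := 𝓘(ℝ, 𝔤)) y
      (a1.mdifferentiableAt (by simp)) (mdifferentiableAt_pt hy)
    rw [mfderiv_eq_fderiv] at a2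
    have a3 := hC.hasFDerivAt.clm_apply (hasFDerivAt_const w y)
    have a4 := DFunLike.congr_fun (a3.fderiv.symm.trans a2) ξ
    refine Eq.trans ?_ a4
    simp
  rw [h3, h2]
  exact h1

/-- The adjoint endomorphism of the field strength transforms by conjugation with the transition
function. The gauge law only determines the potentials up to the centre of the Lie algebra, which is
why the statement concerns `ad F` and not `F` itself. -/
theorem adjoint_curvature_trans [Z.IsContMDiff (𝓡 n) ∞] (A : GaugeConnection G (n := n) Z)
    {i j : ι} {x x' : S} {y : EuclideanSpace ℝ (Fin n)} (hy : y ∈ chartTgt n x)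
    (hy' : pt x y ∈ chartDom n x') (hij : pt x y ∈ Z.baseSet i ∩ Z.baseSet j)
    (ξ η : EuclideanSpace ℝ (Fin n)) (w : 𝔤) :
    bracket G (gaugeCurv (bracketL G) (gaugeForm A j x') (trans x x' y)
        (fderiv ℝ (trans x x') y ξ) (fderiv ℝ (trans x x') y η)) (Z.coordChange i j (pt x y) w)
      = Z.coordChange i j (pt x y)
        (bracket G (gaugeCurv (bracketL G) (gaugeForm A i x) y ξ η) w) := by
  have hj' : pt x' (trans x x' y) ∈ Z.baseSet j := by rw [pt_trans hy']; exact hij.2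
  have d1 := gaugeForm_differentiableAt A hy hij.1
  have d2 := gaugeForm_differentiableAt A (trans_mem hy') hj'
  have key := connCurv_transform (B := fun z => (bracketL G).comp (gaugeForm A i x z))
    (B' := fun z => (bracketL G).comp (gaugeForm A j x' z)) (τ := trans x x')
    (C := fun z => Z.coordChange i j (pt x z)) (y := y)
    ((differentiableAt_const _).clm_comp d1) ((differentiableAt_const _).clm_comp d2)
    ((contDiffAt_trans hy hy').of_le ENat.LEInfty.out)
    ((contDiffAt_coordChange hy hij).of_le ENat.LEInfty.out) (by
      filter_upwards [eventually_mem_tgt hy, eventually_pt_mem hy (isOpen_chartDom x') hy',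
        eventually_pt_mem hy ((Z.isOpen_baseSet i).inter (Z.isOpen_baseSet j)) hij]
        with z h1 h2 h3 ξ w using gauge_law A h1 h2 h3 ξ w) ξ η w
  rw [connCurv_eq_gaugeCurv bracket_jacobi d1, connCurv_eq_gaugeCurv bracket_jacobi d2] at key
  exact key

/-- The Yang-Mills energy density in a given trivialization and chart. -/
noncomputable def normSqOf (A : GaugeConnection G (n := n) Z) (σ : Metric n S) (i : ι) (x : S)
    (y : EuclideanSpace ℝ (Fin n)) : ℝ :=
  ∑ a, ∑ b, ∑ c, ∑ d, gramInv σ x y a c * gramInv σ x y b d *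
    cartanKilling G (A.curvature i x a b y) (A.curvature i x c d y)

/-- The Yang-Mills energy density depends neither on the trivialization nor on the chart: the
Killing form only sees the adjoint endomorphisms of the field strength. -/
theorem normSqOf_trans [Z.IsContMDiff (𝓡 n) ∞] (A : GaugeConnection G (n := n) Z)
    (σ : Metric n S) {i j : ι} {x x' : S} {y : EuclideanSpace ℝ (Fin n)} (hy : y ∈ chartTgt n x)
    (hy' : pt x y ∈ chartDom n x') (hij : pt x y ∈ Z.baseSet i ∩ Z.baseSet j) :
    normSqOf A σ i x y = normSqOf A σ j x' (trans x x' y) := by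
  have hj' : pt x' (trans x x' y) ∈ Z.baseSet j := by rw [pt_trans hy']; exact hij.2
  unfold normSqOf
  simp only [curvature_eq A hy hij.1, curvature_eq A (trans_mem hy') hj']
  have key := double_contraction_pullback (gramForm_trans σ hy hy') (det_gram_pos σ hy).ne'
    (cartanKillingₗ G) (gaugeCurv (bracketL G) (gaugeForm A j x') (trans x x' y))
  refine Eq.trans ?_ key
  refine Finset.sum_congr rfl fun a _ => Finset.sum_congr rfl fun b _ =>
    Finset.sum_congr rfl fun c _ => Finset.sum_congr rfl fun d _ => ?_
  refine congrArg₂ (· * ·) rfl ?_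
  exact (cartanKilling_of_intertwine (coordEquiv Z i j hij)
    (fun w => adjoint_curvature_trans A hy hy' hij _ _ w)
    (fun w => adjoint_curvature_trans A hy hy' hij _ _ w)).symm

theorem continuousAt_gaugeCurv (A : GaugeConnection G (n := n) Z) {i : ι} {x : S}
    {y : EuclideanSpace ℝ (Fin n)} (hy : y ∈ chartTgt n x) (hi : pt x y ∈ Z.baseSet i)
    (ξ η : EuclideanSpace ℝ (Fin n)) :
    ContinuousAt (fun z => gaugeCurv (bracketL G) (gaugeForm A i x) z ξ η) y := by
  have h := contDiffAt_gaugeForm A hy hi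
  have hd : ContinuousAt (fderiv ℝ (gaugeForm A i x)) y :=
    (h.fderiv_right (m := 0) (by simp)).continuousAt
  have hc := h.continuousAt
  simp only [gaugeCurv_apply]
  have c1 : ∀ ξ η, ContinuousAt (fun z => fderiv ℝ (gaugeForm A i x) z ξ η) y := fun ξ η =>
    (hd.clm_apply continuousAt_const).clm_apply continuousAt_const
  have c2 : ∀ ξ, ContinuousAt (fun z => gaugeForm A i x z ξ) y := fun ξ =>
    hc.clm_apply continuousAt_const
  exact ((c1 _ _).sub (c1 _ _)).add ((continuousAt_const.clm_apply (c2 _)).clm_apply (c2 _))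

theorem continuous_normSq [Z.IsContMDiff (𝓡 n) ∞] (A : GaugeConnection G (n := n) Z)
    (σ : Metric n S) : Continuous (A.normSq σ) := by
  refine continuous_of_local (n := n) fun x => ⟨normSqOf A σ (Z.indexAt x) x, ?_, ?_⟩
  · have hi : pt x (ctr x : EuclideanSpace ℝ (Fin n)) ∈ Z.baseSet (Z.indexAt x) := by
      rw [pt_ctr]; exact Z.mem_baseSet_at x
    have hF : ∀ a b, ContinuousAt (A.curvature (Z.indexAt x) x a b) (ctr x) := fun a b => by
      refine (continuousAt_gaugeCurv A (ctr_mem x) hi (bas a) (bas b)).congr ?_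
      filter_upwards [eventually_mem_tgt (ctr_mem x),
        eventually_pt_mem (ctr_mem x) (Z.isOpen_baseSet _) hi] with z h1 h2
      exact (curvature_eq A h1 h2 a b).symm
    have hg : ∀ a b, ContinuousAt (fun z => gramInv σ x z a b) (ctr x) := fun a b =>
      (contDiffAt_gramInv σ (ctr_mem x) a b).continuousAt
    unfold normSqOf
    refine tendsto_finsetSum _ fun a _ => tendsto_finsetSum _ fun b _ =>
      tendsto_finsetSum _ fun c _ => tendsto_finsetSum _ fun d _ =>
      ((hg _ _).mul (hg _ _)).mul ?_
    exact ContinuousAt.comp (f := fun z => (A.curvature (Z.indexAt x) x a b z,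
      A.curvature (Z.indexAt x) x c d z)) (g := fun q : 𝔤 × 𝔤 => cartanKilling G q.1 q.2)
      continuous_cartanKilling.continuousAt ((hF a b).prodMk (hF c d))
  · have hi : pt x (ctr x : EuclideanSpace ℝ (Fin n)) ∈ Z.baseSet (Z.indexAt x) := by
      rw [pt_ctr]; exact Z.mem_baseSet_at x
    filter_upwards [eventually_mem_tgt (ctr_mem x),
        eventually_pt_mem (ctr_mem x) (Z.isOpen_baseSet _) hi] with y hy h2
    exact (normSqOf_trans A σ hy (mem_chartDom (pt x y)) ⟨h2, Z.mem_baseSet_at _⟩).symm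

end Gauge

/-! ### The Higgs field -/

section FirstDerivatives

variable {n : ℕ} {S : Type*} [TopologicalSpace S] [ChartedSpace (EuclideanSpace ℝ (Fin n)) S]
  [IsManifold (𝓡 n) ∞ S]

/-- The chain rule for the differential of a function in two charts. -/
theorem fderiv_comp_pt_trans {F : Type*} [NormedAddCommGroup F] [NormedSpace ℝ F] {f : S → F}
    (hf : ContMDiff (𝓡 n) 𝓘(ℝ, F) ∞ f) {x x' : S} {y : EuclideanSpace ℝ (Fin n)}
    (hy : y ∈ chartTgt n x) (hy' : pt x y ∈ chartDom n x') (ξ : EuclideanSpace ℝ (Fin n)) :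
    fderiv ℝ (fun z => f (pt x' z)) (trans x x' y) (fderiv ℝ (trans x x') y ξ)
      = fderiv ℝ (fun z => f (pt x z)) y ξ := by
  have hd : DifferentiableAt ℝ (fun z => f (pt x' z)) (trans x x' y) := by
    have : ContMDiffAt (𝓡 n) 𝓘(ℝ, F) ∞ (fun z => f (pt x' z)) (trans x x' y) :=
      (hf (pt x' (trans x x' y))).comp _ (contMDiffAt_pt (trans_mem hy'))
    exact (contMDiffAt_iff_contDiffAt.1 this).differentiableAt (by simp)
  have e : (fun z => f (pt x z)) =ᶠ[𝓝 y] fun z => f (pt x' (trans x x' z)) := by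
    filter_upwards [eventually_pt_mem hy (isOpen_chartDom x') hy'] with z hz
    rw [pt_trans hz]
  have h1 := hd.hasFDerivAt.comp y
      ((contDiffAt_trans hy hy').differentiableAt (by simp)).hasFDerivAt
  rw [(h1.congr_of_eventuallyEq e).fderiv]
  rfl

theorem contDiffAt_comp_pt {F : Type*} [NormedAddCommGroup F] [NormedSpace ℝ F] {f : S → F}
    (hf : ContMDiff (𝓡 n) 𝓘(ℝ, F) ∞ f) {x : S} {y : EuclideanSpace ℝ (Fin n)}
    (hy : y ∈ chartTgt n x) : ContDiffAt ℝ ∞ (fun z => f (pt x z)) y := by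
  rw [← contMDiffAt_iff_contDiffAt]
  exact (hf (pt x y)).comp _ (contMDiffAt_pt hy)

theorem continuousAt_pd_comp_pt {F : Type*} [NormedAddCommGroup F] [NormedSpace ℝ F] {f : S → F}
    (hf : ContMDiff (𝓡 n) 𝓘(ℝ, F) ∞ f) {x : S} {y : EuclideanSpace ℝ (Fin n)}
    (hy : y ∈ chartTgt n x) (k : Fin n) : ContinuousAt (pd k (fun z => f (pt x z))) y :=
  (((contDiffAt_comp_pt hf hy).fderiv_right (m := 0) (by simp)).continuousAt).clm_apply
    continuousAt_const

theorem contraction_pd_trans {F F' : Type*} [NormedAddCommGroup F] [NormedSpace ℝ F]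
    [NormedAddCommGroup F'] [NormedSpace ℝ F'] (σ : Metric n S) (b : F →L[ℝ] F →L[ℝ] F')
    {f h : S → F} (hf : ContMDiff (𝓡 n) 𝓘(ℝ, F) ∞ f) (hh : ContMDiff (𝓡 n) 𝓘(ℝ, F) ∞ h)
    {x x' : S} {y : EuclideanSpace ℝ (Fin n)} (hy : y ∈ chartTgt n x)
    (hy' : pt x y ∈ chartDom n x') :
    ∑ i, ∑ j, gramInv σ x y i j • b (pd i (fun z => f (pt x z)) y) (pd j (fun z => h (pt x z)) y)
      = ∑ i, ∑ j, gramInv σ x' (trans x x' y) i j • b (pd i (fun z => f (pt x' z)) (trans x x' y))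
          (pd j (fun z => h (pt x' z)) (trans x x' y)) := by
  have key := contraction_trans σ hy hy' (b.toLinearMap₁₂.compl₁₂
    (fderiv ℝ (fun z => f (pt x' z)) (trans x x' y)).toLinearMap
    (fderiv ℝ (fun z => h (pt x' z)) (trans x x' y)).toLinearMap)
  simp only [LinearMap.compl₁₂_apply, ContinuousLinearMap.coe_coe,
    fderiv_comp_pt_trans hf hy hy', fderiv_comp_pt_trans hh hy hy'] at key
  exact key

/-- A bilinear expression `σ^{ij} b(∂_i f, ∂_j h)` in first derivatives is continuous. -/
theorem continuous_contraction_pd {F F' : Type*} [NormedAddCommGroup F] [NormedSpace ℝ F]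
    [NormedAddCommGroup F'] [NormedSpace ℝ F'] (σ : Metric n S) (b : F →L[ℝ] F →L[ℝ] F')
    {f h : S → F} (hf : ContMDiff (𝓡 n) 𝓘(ℝ, F) ∞ f) (hh : ContMDiff (𝓡 n) 𝓘(ℝ, F) ∞ h) :
    Continuous fun p => ∑ i, ∑ j, gramInv σ p (ctr p) i j •
      b (pd i (fun z => f (pt p z)) (ctr p)) (pd j (fun z => h (pt p z)) (ctr p)) := by
  refine continuous_of_local (n := n) fun x => ⟨fun y => ∑ i, ∑ j, gramInv σ x y i j •
    b (pd i (fun z => f (pt x z)) y) (pd j (fun z => h (pt x z)) y), ?_, ?_⟩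
  · refine tendsto_finsetSum _ fun i _ => tendsto_finsetSum _ fun j _ =>
      Filter.Tendsto.smul (contDiffAt_gramInv σ (ctr_mem x) i j).continuousAt ?_
    exact (continuousAt_const.clm_apply (continuousAt_pd_comp_pt hf (ctr_mem x) i)).clm_apply
      (continuousAt_pd_comp_pt hh (ctr_mem x) j)
  · filter_upwards [eventually_mem_tgt (ctr_mem x)] with y hy
    exact (contraction_pd_trans σ b hf hh hy (mem_chartDom (pt x y))).symm

end FirstDerivatives

section Higgs

variable {𝔤 : Type*} [NormedAddCommGroup 𝔤] [NormedSpace ℝ 𝔤]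
  {G : Type*} [TopologicalSpace G] [ChartedSpace 𝔤 G] [Group G]
  {n : ℕ} {S : Type*} [TopologicalSpace S] [ChartedSpace (EuclideanSpace ℝ (Fin n)) S]
  {ι : Type*} [IsManifold (𝓡 n) ∞ S] {Z : VectorBundleCore ℝ S 𝔤 ι}

/-- The local representative of a section in the trivialization `i`, in the chart around `x`. -/
noncomputable def sectionRep (Φ : ∀ p : S, Z.Fiber p) (i : ι) (x : S)
    (y : EuclideanSpace ℝ (Fin n)) : 𝔤 :=
  (Z.localTriv i ⟨pt x y, Φ (pt x y)⟩).2

omit [IsManifold (𝓡 n) ∞ S] in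
theorem sectionRep_trans (Φ : ∀ p : S, Z.Fiber p) {i j : ι} {x x' : S}
    {y : EuclideanSpace ℝ (Fin n)} (hy' : pt x y ∈ chartDom n x')
    (hij : pt x y ∈ Z.baseSet i ∩ Z.baseSet j) :
    sectionRep Φ j x' (trans x x' y) = Z.coordChange i j (pt x y) (sectionRep Φ i x y) := by
  have h := Z.coordChange_comp (Z.indexAt (pt x y)) i j (pt x y)
    ⟨⟨Z.mem_baseSet_at _, hij.1⟩, hij.2⟩ (Φ (pt x y))
  unfold sectionRep
  rw [pt_trans hy']
  exact h.symm

theorem contDiffAt_sectionRep [Z.IsContMDiff (𝓡 n) ∞] (Φ : ContMDiffSection (𝓡 n) 𝔤 ∞ Z.Fiber)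
    {i : ι} {x : S} {y : EuclideanSpace ℝ (Fin n)} (hy : y ∈ chartTgt n x)
    (hi : pt x y ∈ Z.baseSet i) : ContDiffAt ℝ ∞ (sectionRep (fun q => Φ q) i x) y := by
  rw [← contMDiffAt_iff_contDiffAt]
  have : MemTrivializationAtlas (Z.localTriv i) := ⟨⟨i, rfl⟩⟩
  have h1 : ContMDiffAt (𝓡 n) 𝓘(ℝ, 𝔤) ∞ (fun q => (Z.localTriv i ⟨q, Φ q⟩).2) (pt x y) :=
    ((Z.localTriv i).contMDiffAt_section_iff hi).1 (Φ.contMDiff (pt x y))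
  exact h1.comp y (contMDiffAt_pt hy)

variable [LieGroup 𝓘(ℝ, 𝔤) ∞ G] [FiniteDimensional ℝ 𝔤] [CompleteSpace 𝔤]

/-- The covariant derivative of a section, as a linear map. -/
noncomputable def covForm (A : GaugeConnection G (n := n) Z) (Φ : ∀ p : S, Z.Fiber p) (i : ι)
    (x : S) (y : EuclideanSpace ℝ (Fin n)) : EuclideanSpace ℝ (Fin n) →ₗ[ℝ] 𝔤 :=
  (fderiv ℝ (sectionRep Φ i x) y
    + ((bracketL G).flip (sectionRep Φ i x y)).comp (gaugeForm A i x y)).toLinearMap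

theorem covForm_apply (A : GaugeConnection G (n := n) Z) (Φ : ∀ p : S, Z.Fiber p) (i : ι)
    (x : S) (y ξ : EuclideanSpace ℝ (Fin n)) : covForm A Φ i x y ξ
      = fderiv ℝ (sectionRep Φ i x) y ξ
        + bracketL G (gaugeForm A i x y ξ) (sectionRep Φ i x y) := rfl

/-- Covariance of the covariant derivative. -/
theorem covForm_trans [Z.IsContMDiff (𝓡 n) ∞] (A : GaugeConnection G (n := n) Z)
    (Φ : ContMDiffSection (𝓡 n) 𝔤 ∞ Z.Fiber) {i j : ι} {x x' : S}
    {y : EuclideanSpace ℝ (Fin n)} (hy : y ∈ chartTgt n x) (hy' : pt x y ∈ chartDom n x')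
    (hij : pt x y ∈ Z.baseSet i ∩ Z.baseSet j) (ξ : EuclideanSpace ℝ (Fin n)) :
    covForm A (fun q => Φ q) j x' (trans x x' y) (fderiv ℝ (trans x x') y ξ)
      = Z.coordChange i j (pt x y) (covForm A (fun q => Φ q) i x y ξ) := by
  have hj' : pt x' (trans x x' y) ∈ Z.baseSet j := by rw [pt_trans hy']; exact hij.2
  have e : (fun z => sectionRep (fun q => Φ q) j x' (trans x x' z)) =ᶠ[𝓝 y]
      fun z => Z.coordChange i j (pt x z) (sectionRep (fun q => Φ q) i x z) := by
    filter_upwards [eventually_pt_mem hy (isOpen_chartDom x') hy',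
        eventually_pt_mem hy ((Z.isOpen_baseSet i).inter (Z.isOpen_baseSet j)) hij]
        with z h2 h3 using sectionRep_trans _ h2 h3
  have d1 := ((contDiffAt_sectionRep Φ (trans_mem hy') hj').differentiableAt
    (by simp)).hasFDerivAt.comp y
      ((contDiffAt_trans hy hy').differentiableAt (by simp)).hasFDerivAt
  have d2 := ((contDiffAt_coordChange (Z := Z) hy hij).differentiableAt
    (by simp)).hasFDerivAt.clm_apply
      ((contDiffAt_sectionRep Φ hy hij.1).differentiableAt (by simp)).hasFDerivAt
  have h1 := DFunLike.congr_fun (d1.unique (d2.congr_of_eventuallyEq e)) ξ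
  simp only [ContinuousLinearMap.comp_apply, add_apply, ContinuousLinearMap.flip_apply] at h1
  have h2 := gauge_law A hy hy' hij ξ (sectionRep (fun q => Φ q) i x y)
  rw [covForm_apply, covForm_apply, h1, sectionRep_trans _ hy' hij, ContinuousLinearMap.map_add,
    ← h2]
  abel

omit [FiniteDimensional ℝ 𝔤] in
/-- The transition functions of an adjoint bundle preserve the Cartan-Killing metric, because they
are Lie algebra automorphisms. -/
theorem cartanKilling_coordChange (hZ : IsAdjointBundle G Z) {i j : ι} {p : S}
    (hp : p ∈ Z.baseSet i ∩ Z.baseSet j) (X Y : 𝔤) :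
    cartanKilling G (Z.coordChange i j p X) (Z.coordChange i j p Y) = cartanKilling G X Y := by
  obtain ⟨h, hh⟩ := hZ i j p hp
  have key : ∀ X w, bracket G (Z.coordChange i j p X) (coordEquiv Z i j hp w)
      = coordEquiv Z i j hp (bracket G X w) := fun X w => by
    rw [coordEquiv_apply, coordEquiv_apply, hh, hh, hh, bracket_Ad]
  exact cartanKilling_of_intertwine (coordEquiv Z i j hp) (key X) (key Y)

theorem continuous_kinetic_adjoint [Z.IsContMDiff (𝓡 n) ∞] (hZ : IsAdjointBundle G Z)
    (A : GaugeConnection G (n := n) Z) (σ : Metric n S) (Φ : ContMDiffSection (𝓡 n) 𝔤 ∞ Z.Fiber) :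
    Continuous fun p => ∑ i, ∑ j, gramInv σ p (ctr p) i j *
      cartanKilling G (A.covDeriv (fun q => Φ q) (Z.indexAt p) p i (ctr p))
        (A.covDeriv (fun q => Φ q) (Z.indexAt p) p j (ctr p)) := by
  refine continuous_of_local (n := n) fun x => ⟨fun y => ∑ a, ∑ b, gramInv σ x y a b *
    cartanKilling G (covForm A (fun q => Φ q) (Z.indexAt x) x y (bas a))
      (covForm A (fun q => Φ q) (Z.indexAt x) x y (bas b)), ?_, ?_⟩
  · have hi : pt x (ctr x : EuclideanSpace ℝ (Fin n)) ∈ Z.baseSet (Z.indexAt x) := by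
      rw [pt_ctr]; exact Z.mem_baseSet_at x
    have hu := contDiffAt_sectionRep Φ (ctr_mem x) hi
    have hF : ∀ a, ContinuousAt
        (fun y => covForm A (fun q => Φ q) (Z.indexAt x) x y (bas a)) (ctr x) := fun a => by
      simp only [covForm_apply]
      refine ContinuousAt.add ?_ ?_
      · exact ((hu.fderiv_right (m := 0) (by simp)).continuousAt).clm_apply continuousAt_const
      · exact (continuousAt_const.clm_apply ((contDiffAt_gaugeForm A
          (ctr_mem x) hi).continuousAt.clm_apply continuousAt_const)).clm_apply hu.continuousAt
    refine tendsto_finsetSum _ fun a _ => tendsto_finsetSum _ fun b _ =>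
      ((contDiffAt_gramInv σ (ctr_mem x) a b).continuousAt).mul ?_
    exact ContinuousAt.comp (f := fun z => (covForm A (fun q => Φ q) (Z.indexAt x) x z (bas a),
      covForm A (fun q => Φ q) (Z.indexAt x) x z (bas b)))
      (g := fun q : 𝔤 × 𝔤 => cartanKilling G q.1 q.2)
      continuous_cartanKilling.continuousAt ((hF a).prodMk (hF b))
  · have hi : pt x (ctr x : EuclideanSpace ℝ (Fin n)) ∈ Z.baseSet (Z.indexAt x) := by
      rw [pt_ctr]; exact Z.mem_baseSet_at x
    filter_upwards [eventually_mem_tgt (ctr_mem x),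
        eventually_pt_mem (ctr_mem x) (Z.isOpen_baseSet _) hi] with y hy h2
    have hij : pt x y ∈ Z.baseSet (Z.indexAt x) ∩ Z.baseSet (Z.indexAt (pt x y)) :=
      ⟨h2, Z.mem_baseSet_at _⟩
    have hy' := mem_chartDom (n := n) (pt x y)
    have key := contraction_trans σ hy hy' ((cartanKillingₗ G).compl₁₂
      (covForm A (fun q => Φ q) (Z.indexAt (pt x y)) (pt x y) (trans x (pt x y) y))
      (covForm A (fun q => Φ q) (Z.indexAt (pt x y)) (pt x y) (trans x (pt x y) y)))
    simp only [LinearMap.compl₁₂_apply, covForm_trans A Φ hy hy' hij, cartanKillingₗ_apply,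
      cartanKilling_coordChange hZ hij, smul_eq_mul] at key
    exact key.symm

variable (A : GaugeConnection G (n := n) Z) (σ : Metric n S) (Φ : HiggsField n Z)

theorem continuous_kinetic [Z.IsContMDiff (𝓡 n) ∞] (hZ : IsAdjointBundle G Z) :
    Continuous (Φ.kinetic A σ) := by
  cases Φ with
  | adjoint Φ V hV => exact continuous_kinetic_adjoint hZ A σ Φ
  | scalar N Φ hΦ V hV => exact continuous_contraction_pd σ (innerSL ℝ) hΦ hΦ

omit [FiniteDimensional ℝ 𝔤] [CompleteSpace 𝔤] [LieGroup 𝓘(ℝ, 𝔤) ∞ G] [IsManifold (𝓡 n) ∞ S] in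
theorem continuous_potential : Continuous Φ.potential := by
  cases Φ with
  | adjoint Φ V hV => exact hV.continuous.comp Φ.contMDiff.continuous
  | scalar N Φ hΦ V hV => exact hV.continuous.comp hΦ.continuous

end Higgs

/-! ### The volume measure -/

section Volume

variable {n : ℕ} {S : Type*} [TopologicalSpace S] [ChartedSpace (EuclideanSpace ℝ (Fin n)) S]
  [IsManifold (𝓡 n) ∞ S] (σ : Metric n S)

theorem continuousOn_density (x : S) : ContinuousOn (density σ x) (chartTgt n x) := fun _ hy =>
  (contDiffAt_density σ hy).continuousAt.continuousWithinAt

omit [IsManifold (𝓡 n) ∞ S] in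
theorem trans_injOn (x x' : S) :
    Set.InjOn (trans x x') (chartTgt n x ∩ pt x ⁻¹' chartDom n x') := by
  intro y hy z hz h
  have h1 : pt x y = pt x z := by rw [← pt_trans hy.2, h, pt_trans hz.2]
  rw [← chart_pt hy.1, h1, chart_pt hz.1]

variable [MeasurableSpace S]

/-- The Riemannian measure in the preferred chart around `x`, transported to the manifold. -/
noncomputable def chartVol (x : S) : Measure S :=
  Measure.map (pt x) ((volume.restrict (chartTgt n x)).withDensity
    fun y => ENNReal.ofReal (density σ x y))

theorem chartVol_le_vol (x : S) : chartVol σ x ≤ vol σ := le_iSup (chartVol σ) x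

variable [BorelSpace S]

omit [IsManifold (𝓡 n) ∞ S] in
theorem measurableSet_tgt_inter_preimage (x : S) {B : Set S} (hB : MeasurableSet B) :
    MeasurableSet (chartTgt n x ∩ pt x ⁻¹' B) := by
  have h1 : Measurable fun y : chartTgt n x => pt x (y : EuclideanSpace ℝ (Fin n)) :=
    (continuousOn_iff_continuous_domRestrict.1 (continuousOn_pt x)).measurable
  have h2 := ((isOpen_chartTgt x).measurableSet).subtype_image (h1 hB)
  convert h2 using 1
  ext y
  simp [and_comm]

omit [MeasurableSpace S] [BorelSpace S] in
theorem aemeasurable_density (x : S) :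
    AEMeasurable (fun y => ENNReal.ofReal (density σ x y)) (volume.restrict (chartTgt n x)) :=
  ((continuousOn_density σ x).aemeasurable (isOpen_chartTgt x).measurableSet).ennreal_ofReal

theorem aemeasurable_pt (x : S) : AEMeasurable (pt x)
    ((volume.restrict (chartTgt n x)).withDensity fun y => ENNReal.ofReal (density σ x y)) :=
  ((continuousOn_pt x).aemeasurable (isOpen_chartTgt x).measurableSet).mono_ac
    (withDensity_absolutelyContinuous _ _)

theorem chartVol_apply (x : S) {B : Set S} (hB : MeasurableSet B) :
    chartVol σ x B = ∫⁻ y in chartTgt n x ∩ pt x ⁻¹' B, ENNReal.ofReal (density σ x y) := by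
  rw [chartVol, Measure.map_apply_of_aemeasurable (aemeasurable_pt σ x) hB, withDensity_apply',
    Measure.restrict_restrict' (isOpen_chartTgt x).measurableSet, Set.inter_comm]

theorem chartVol_inter_dom (x : S) {B : Set S} (hB : MeasurableSet B) :
    chartVol σ x (B ∩ chartDom n x) = chartVol σ x B := by
  rw [chartVol_apply σ x hB, chartVol_apply σ x (hB.inter (isOpen_chartDom x).measurableSet)]
  congr 2
  ext y
  exact ⟨fun h => ⟨h.1, h.2.1⟩, fun h => ⟨h.1, h.2, pt_mem h.1⟩⟩

/-- The Riemannian measures of two charts agree on the overlap. -/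
theorem chartVol_eq_of_subset {x x' : S} {B : Set S} (hB : MeasurableSet B)
    (h : B ⊆ chartDom n x) (h' : B ⊆ chartDom n x') : chartVol σ x B = chartVol σ x' B := by
  rw [chartVol_apply σ x hB, chartVol_apply σ x' hB]
  have hs := measurableSet_tgt_inter_preimage (n := n) x hB
  have himg : trans x x' '' (chartTgt n x ∩ pt x ⁻¹' B) = chartTgt n x' ∩ pt x' ⁻¹' B := by
    ext z
    constructor
    · rintro ⟨y, hy, rfl⟩
      exact ⟨trans_mem (h' hy.2), by rw [Set.mem_preimage, pt_trans (h' hy.2)]; exact hy.2⟩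
    · rintro ⟨hz, hzB⟩
      have hzB' : pt x' z ∈ B := hzB
      refine ⟨trans x' x z, ⟨trans_mem (h hzB), ?_⟩, ?_⟩
      · rw [Set.mem_preimage, pt_trans (h hzB)]; exact hzB
      · unfold trans
        rw [pt_chart (h hzB'), chart_pt hz]
  have hinj : Set.InjOn (trans x x') (chartTgt n x ∩ pt x ⁻¹' B) :=
    (trans_injOn x x').mono (Set.inter_subset_inter_right _ (Set.preimage_mono h'))
  rw [← himg, lintegral_image_eq_lintegral_abs_det_fderiv_mul volume hs
    (f' := fun y => fderiv ℝ (trans x x') y)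
    (fun y hy => ((contDiffAt_trans hy.1 (h' hy.2)).differentiableAt
      (by simp)).hasFDerivAt.hasFDerivWithinAt)
    hinj]
  refine setLIntegral_congr_fun hs fun y hy => ?_
  rw [density_trans σ hy.1 (h' hy.2), ENNReal.ofReal_mul (abs_nonneg _)]

/-- The volume measure is the supremum of the chart measures. The right hand side dominates each of
them: on the domain of the chart around `x` they agree with `chartVol σ x`, and off this domain the
bound is infinite on nonempty sets. -/
theorem vol_le (x : S) : vol σ ≤ chartVol σ x + (⊤ : Measure S).restrict (chartDom n x)ᶜ := by
  have hU := (isOpen_chartDom (n := n) x).measurableSet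
  refine iSup_le fun x' => Measure.le_iff.2 fun B hB => ?_
  have hU' := (isOpen_chartDom (n := n) x').measurableSet
  rw [Measure.add_apply, Measure.restrict_apply hB, ← measure_inter_add_sdiff B hU]
  refine add_le_add ?_ ?_
  · calc chartVol σ x' (B ∩ chartDom n x)
        = chartVol σ x' (B ∩ chartDom n x ∩ chartDom n x') :=
          (chartVol_inter_dom σ x' (hB.inter hU)).symm
      _ = chartVol σ x (B ∩ chartDom n x ∩ chartDom n x') :=
          chartVol_eq_of_subset σ ((hB.inter hU).inter hU') (fun p hp => hp.2) fun p hp => hp.1.2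
      _ ≤ chartVol σ x B := measure_mono fun p hp => hp.1.1
  · exact (le_top : chartVol σ x' ≤ ⊤) _

/-- On the domain of a chart the volume measure is the Riemannian measure of that chart. -/
theorem vol_restrict_dom (x : S) : (vol σ).restrict (chartDom n x) = chartVol σ x := by
  have hU := (isOpen_chartDom (n := n) x).measurableSet
  ext B hB
  rw [Measure.restrict_apply hB]
  apply le_antisymm
  · refine (vol_le σ x _).trans ?_
    rw [Measure.add_apply, Measure.restrict_apply (hB.inter hU)]
    have : B ∩ chartDom n x ∩ (chartDom n x)ᶜ = ∅ := by
      ext p; simp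
    rw [this, measure_empty, add_zero]
    exact measure_mono Set.inter_subset_left
  · rw [← chartVol_inter_dom σ x hB]
    exact chartVol_le_vol σ x _

theorem vol_apply_of_subset {x : S} {B : Set S} (hB : MeasurableSet B) (h : B ⊆ chartDom n x) :
    vol σ B = ∫⁻ y in chartTgt n x ∩ pt x ⁻¹' B, ENNReal.ofReal (density σ x y) := by
  rw [← chartVol_apply σ x hB, ← vol_restrict_dom, Measure.restrict_apply hB,
    Set.inter_eq_left.2 h]

instance isLocallyFiniteMeasure_vol : IsLocallyFiniteMeasure (vol σ) := by
  refine ⟨fun x => ?_⟩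
  obtain ⟨r, hr, hball⟩ := Metric.isOpen_iff.1 (isOpen_chartTgt (n := n) x) _ (ctr_mem x)
  have hsub : Metric.closedBall (ctr x : EuclideanSpace ℝ (Fin n)) (r / 2) ⊆ chartTgt n x :=
    (Metric.closedBall_subset_ball (half_lt_self hr)).trans hball
  let U : Set S := chartDom n x ∩ chartAt (EuclideanSpace ℝ (Fin n)) x ⁻¹' Metric.ball (ctr x) (r / 2)
  have hU : IsOpen U :=
    (chartAt (EuclideanSpace ℝ (Fin n)) x).isOpen_inter_preimage Metric.isOpen_ball
  refine ⟨U, hU.mem_nhds ⟨mem_chartDom x, Metric.mem_ball_self (half_pos hr)⟩, ?_⟩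
  rw [vol_apply_of_subset σ hU.measurableSet Set.inter_subset_left]
  have h1 : chartTgt n x ∩ pt x ⁻¹' U ⊆ Metric.closedBall (ctr x) (r / 2) := by
    rintro y ⟨hy, hyU⟩
    have := hyU.2
    rw [Set.mem_preimage, chart_pt hy] at this
    exact Metric.ball_subset_closedBall this
  refine (lintegral_mono_set h1).trans_lt ?_
  have h2 : IntegrableOn (density σ x) (Metric.closedBall (ctr x) (r / 2)) :=
    ((continuousOn_density σ x).mono hsub).integrableOn_compact (isCompact_closedBall _ _)
  refine lt_of_le_of_lt (lintegral_mono fun y => ?_) h2.2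
  exact Real.ofReal_le_enorm _

instance isOpenPosMeasure_vol : (vol σ).IsOpenPosMeasure := by
  refine ⟨fun O hO ⟨x, hx⟩ h0 => ?_⟩
  have hW : IsOpen (chartTgt n x ∩ pt x ⁻¹' (O ∩ chartDom n x)) :=
    (continuousOn_pt x).isOpen_inter_preimage (isOpen_chartTgt x) (hO.inter (isOpen_chartDom x))
  have h1 : vol σ (O ∩ chartDom n x) = 0 := measure_mono_null Set.inter_subset_left h0
  rw [vol_apply_of_subset σ (hO.inter (isOpen_chartDom x)).measurableSet Set.inter_subset_right,
    lintegral_eq_zero_iff' ((aemeasurable_density σ x).mono_set Set.inter_subset_left)] at h1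
  have h2 : ∀ᵐ y ∂(volume.restrict (chartTgt n x ∩ pt x ⁻¹' (O ∩ chartDom n x))), False := by
    filter_upwards [h1, ae_restrict_mem hW.measurableSet] with y hy hyW
    have := density_pos σ hyW.1
    simp only [Pi.zero_apply, ENNReal.ofReal_eq_zero] at hy
    linarith
  have h3 : volume (chartTgt n x ∩ pt x ⁻¹' (O ∩ chartDom n x)) = 0 := by
    have := ae_iff.1 h2
    simpa using this
  refine hW.measure_ne_zero volume ⟨ctr x, ctr_mem x, ?_⟩ h3
  rw [Set.mem_preimage, pt_ctr]
  exact ⟨hx, mem_chartDom x⟩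

/-- Integration over the domain of a chart, in coordinates. -/
theorem setIntegral_dom {F : Type*} [NormedAddCommGroup F] [NormedSpace ℝ F] (x : S) {f : S → F}
    (hf : AEStronglyMeasurable f (chartVol σ x)) :
    ∫ p in chartDom n x, f p ∂(vol σ) = ∫ y in chartTgt n x, density σ x y • f (pt x y) := by
  rw [vol_restrict_dom, chartVol, integral_map (aemeasurable_pt σ x) hf,
    integral_withDensity_eq_integral_toReal_smul₀ (aemeasurable_density σ x)
      (Filter.Eventually.of_forall fun y => ENNReal.ofReal_lt_top)]
  refine setIntegral_congr_fun (isOpen_chartTgt x).measurableSet fun y hy => ?_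
  simp only [ENNReal.toReal_ofReal (density_pos σ hy).le]

end Volume

/-! ### Green's formula -/

section LocalGreen

/-- A partial derivative of a function with compact support in `U` integrates to zero. -/
theorem integral_pd_eq_zero {n : ℕ} {U K : Set (EuclideanSpace ℝ (Fin n))} (hU : IsOpen U)
    (hK : IsCompact K) (hKU : K ⊆ U) {h : EuclideanSpace ℝ (Fin n) → ℂ}
    (hd : ∀ y ∈ U, ContDiffAt ℝ 1 h y) (h0 : ∀ y ∈ U, y ∉ K → h y = 0) (i : Fin n) :
    ∫ y in U, pd i h y = 0 := by
  set H := U.indicator h with hH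
  have e0 : ∀ y ∉ K, H =ᶠ[𝓝 y] fun _ => 0 := fun y hy => by
    filter_upwards [hK.isClosed.isOpen_compl.mem_nhds hy] with z hz
    by_cases hzU : z ∈ U
    · rw [hH, Set.indicator_of_mem hzU, h0 z hzU hz]
    · rw [hH, Set.indicator_of_notMem hzU]
  have e1 : ∀ y ∈ U, H =ᶠ[𝓝 y] h := fun y hy => by
    filter_upwards [hU.mem_nhds hy] with z hz
    rw [hH, Set.indicator_of_mem hz]
  have hc : ContDiff ℝ 1 H := contDiff_iff_contDiffAt.2 fun y => by
    by_cases hy : y ∈ U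
    · exact (hd y hy).congr_of_eventuallyEq (e1 y hy)
    · exact contDiffAt_const.congr_of_eventuallyEq (e0 y fun hyK => hy (hKU hyK))
  have hs : HasCompactSupport H := HasCompactSupport.intro hK fun y hy => (e0 y hy).eq_of_nhds
  have hcont : Continuous fun y => fderiv ℝ H y (EuclideanSpace.single i 1) :=
    (hc.continuous_fderiv (by simp)).clm_apply continuous_const
  have hs' : HasCompactSupport fun y => fderiv ℝ H y (EuclideanSpace.single i 1) :=
    hs.fderiv_apply (𝕜 := ℝ) _
  have key : ∫ y, fderiv ℝ H y (EuclideanSpace.single i 1) = 0 := by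
    have := integral_mul_fderiv_eq_neg_fderiv_mul_of_integrable (𝕜 := ℂ) (μ := volume)
      (f := fun _ : EuclideanSpace ℝ (Fin n) => (1 : ℂ)) (g := H) (v := EuclideanSpace.single i 1)
      (by simp) (by simpa using hcont.integrable_of_hasCompactSupport hs')
      (by simpa using hc.continuous.integrable_of_hasCompactSupport hs)
      (fun y _ => differentiableAt_const _)
      (fun y _ => (hc.differentiable (by simp)).differentiableAt)
    simpa using this
  rw [← key, ← setIntegral_eq_integral_of_forall_compl_eq_zero (s := U)
    (f := fun y => fderiv ℝ H y (EuclideanSpace.single i 1))]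
  · refine setIntegral_congr_fun hU.measurableSet fun y hy => ?_
    simp only [pd, (e1 y hy).fderiv_eq]
  · intro y hy
    rw [(e0 y fun hyK => hy (hKU hyK)).fderiv_eq]
    simp

variable {n : ℕ} {S : Type*} [TopologicalSpace S] [ChartedSpace (EuclideanSpace ℝ (Fin n)) S]
  [IsManifold (𝓡 n) ∞ S] (σ : Metric n S)

/-- The flux `√σ σ^{ij} ∂_j φ` in the preferred chart around `x`. -/
noncomputable def flux (x : S) (φ : S → ℂ) (i : Fin n) (y : EuclideanSpace ℝ (Fin n)) : ℂ :=
  (density σ x y : ℂ) * ∑ j, (gramInv σ x y i j : ℂ) * pd j (fun z => φ (pt x z)) y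

/-- The expression of the Laplace-Beltrami operator in the preferred chart around `x`. -/
noncomputable def chartLap (x : S) (φ : S → ℂ) (y : EuclideanSpace ℝ (Fin n)) : ℂ :=
  (1 / (density σ x y : ℂ)) * ∑ i, pd i (flux σ x φ i) y

theorem laplacian_eq (φ : S → ℂ) (p : S) : laplacian σ φ p = chartLap σ p φ (ctr p) := rfl

/-- The bilinear gradient product `σ^{ij} ∂_i u ∂_j v`. -/
noncomputable def gradDot (u v : S → ℂ) (p : S) : ℂ :=
  ∑ i, ∑ j, gramInv σ p (ctr p) i j •
    (pd i (fun z => u (pt p z)) (ctr p) * pd j (fun z => v (pt p z)) (ctr p))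

variable {σ} {φ w : S → ℂ}

theorem continuous_gradDot (hw : ContMDiff (𝓡 n) 𝓘(ℝ, ℂ) ∞ w) (hφ : ContMDiff (𝓡 n) 𝓘(ℝ, ℂ) ∞ φ) :
    Continuous (gradDot σ w φ) :=
  continuous_contraction_pd σ (ContinuousLinearMap.mul ℝ ℂ) hw hφ

theorem gradDot_pt (hw : ContMDiff (𝓡 n) 𝓘(ℝ, ℂ) ∞ w) (hφ : ContMDiff (𝓡 n) 𝓘(ℝ, ℂ) ∞ φ)
    {x : S} {y : EuclideanSpace ℝ (Fin n)} (hy : y ∈ chartTgt n x) :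
    gradDot σ w φ (pt x y) = ∑ i, ∑ j, gramInv σ x y i j •
      (pd i (fun z => w (pt x z)) y * pd j (fun z => φ (pt x z)) y) :=
  (contraction_pd_trans σ (ContinuousLinearMap.mul ℝ ℂ) hw hφ hy (mem_chartDom (pt x y))).symm

theorem contDiffAt_pd_comp_pt (hφ : ContMDiff (𝓡 n) 𝓘(ℝ, ℂ) ∞ φ) {x : S}
    {y : EuclideanSpace ℝ (Fin n)} (hy : y ∈ chartTgt n x) (k : Fin n) :
    ContDiffAt ℝ ∞ (pd k fun z => φ (pt x z)) y :=
  ((contDiffAt_comp_pt hφ hy).fderiv_right (m := ∞) (by simp)).clm_apply contDiffAt_const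

theorem contDiffAt_flux (hφ : ContMDiff (𝓡 n) 𝓘(ℝ, ℂ) ∞ φ) {x : S}
    {y : EuclideanSpace ℝ (Fin n)} (hy : y ∈ chartTgt n x) (i : Fin n) :
    ContDiffAt ℝ ∞ (flux σ x φ i) y := by
  refine (Complex.ofRealCLM.contDiff.contDiffAt.comp y (contDiffAt_density σ hy)).mul
    (ContDiffAt.sum fun j _ => ContDiffAt.mul ?_ (contDiffAt_pd_comp_pt hφ hy j))
  exact Complex.ofRealCLM.contDiff.contDiffAt.comp y (contDiffAt_gramInv σ hy i j)

theorem continuousAt_chartLap (hφ : ContMDiff (𝓡 n) 𝓘(ℝ, ℂ) ∞ φ) {x : S}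
    {y : EuclideanSpace ℝ (Fin n)} (hy : y ∈ chartTgt n x) :
    ContinuousAt (chartLap σ x φ) y := by
  refine ContinuousAt.mul ?_ (tendsto_finsetSum _ fun i _ => ?_)
  · refine continuousAt_const.div ?_ (by exact_mod_cast (density_pos σ hy).ne')
    exact Complex.continuous_ofReal.continuousAt.comp (contDiffAt_density σ hy).continuousAt
  · exact (((contDiffAt_flux hφ hy i).fderiv_right (m := 0) (by simp)).continuousAt).clm_apply
      continuousAt_const

/-- The divergence of `w` times the flux of `φ`. -/
theorem sum_pd_mul_flux (hw : ContMDiff (𝓡 n) 𝓘(ℝ, ℂ) ∞ w) (hφ : ContMDiff (𝓡 n) 𝓘(ℝ, ℂ) ∞ φ)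
    {x : S} {y : EuclideanSpace ℝ (Fin n)} (hy : y ∈ chartTgt n x) :
    ∑ i, pd i (fun z => w (pt x z) * flux σ x φ i z) y
      = density σ x y • (gradDot σ w φ (pt x y) + w (pt x y) * chartLap σ x φ y) := by
  have h1 : ∀ i, pd i (fun z => w (pt x z) * flux σ x φ i z) y
      = w (pt x y) * pd i (flux σ x φ i) y + pd i (fun z => w (pt x z)) y * flux σ x φ i y := by
    intro i
    have := fderiv_fun_mul ((contDiffAt_comp_pt hw hy).differentiableAt (by simp))
      ((contDiffAt_flux (σ := σ) hφ hy i).differentiableAt (by simp))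
    simp only [pd, this, add_apply, smul_apply, smul_eq_mul]
    ring
  have hρ : (density σ x y : ℂ) ≠ 0 := by exact_mod_cast (density_pos σ hy).ne'
  rw [Finset.sum_congr rfl fun i _ => h1 i, Finset.sum_add_distrib, gradDot_pt hw hφ hy,
    Complex.real_smul, mul_add, add_comm]
  congr 1
  · simp only [flux, Finset.mul_sum, Complex.real_smul]
    exact Finset.sum_congr rfl fun i _ => Finset.sum_congr rfl fun j _ => by ring
  · rw [chartLap, ← Finset.mul_sum]
    field_simp

/-- Green's formula in a chart. -/
theorem green_chart (hw : ContMDiff (𝓡 n) 𝓘(ℝ, ℂ) ∞ w)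
    (hφ : ContMDiff (𝓡 n) 𝓘(ℝ, ℂ) ∞ φ) {x : S} (hc : IsCompact (tsupport w))
    (hx : tsupport w ⊆ chartDom n x) :
    ∫ y in chartTgt n x, density σ x y •
      (gradDot σ w φ (pt x y) + w (pt x y) * chartLap σ x φ y) = 0 := by
  set K := chartAt (EuclideanSpace ℝ (Fin n)) x '' tsupport w with hK
  have hKc : IsCompact K :=
    hc.image_of_continuousOn ((chartAt (EuclideanSpace ℝ (Fin n)) x).continuousOn.mono hx)
  have hKU : K ⊆ chartTgt n x := by
    rintro _ ⟨p, hp, rfl⟩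
    exact chart_mem (hx hp)
  have hw0 : ∀ y ∈ chartTgt n x, y ∉ K → w (pt x y) = 0 := fun y hy hyK => by
    by_contra h
    exact hyK ⟨pt x y, subset_tsupport _ h, chart_pt hy⟩
  have hcd : ∀ i, ∀ y ∈ chartTgt n x, ContDiffAt ℝ ∞ (fun z => w (pt x z) * flux σ x φ i z) y :=
    fun i y hy => (contDiffAt_comp_pt hw hy).mul (contDiffAt_flux hφ hy i)
  have h0 : ∀ i, ∫ y in chartTgt n x, pd i (fun z => w (pt x z) * flux σ x φ i z) y = 0 :=
    fun i => integral_pd_eq_zero (isOpen_chartTgt x) hKc hKU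
      (fun y hy => (hcd i y hy).of_le ENat.LEInfty.out)
      (fun y hy hyK => by rw [hw0 y hy hyK, zero_mul]) i
  have hint : ∀ i, IntegrableOn (pd i fun z => w (pt x z) * flux σ x φ i z) (chartTgt n x) := by
    intro i
    have hcont : ContinuousOn (pd i fun z => w (pt x z) * flux σ x φ i z) K := fun y hy =>
      ((((hcd i y (hKU hy)).fderiv_right (m := 0) (by simp)).continuousAt).clm_apply
        continuousAt_const).continuousWithinAt
    refine (hcont.integrableOn_compact hKc).of_forall_sdiff_eq_zero
      (isOpen_chartTgt x).measurableSet fun y hy => ?_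
    have : (fun z => w (pt x z) * flux σ x φ i z) =ᶠ[𝓝 y] fun _ => 0 := by
      filter_upwards [(isOpen_chartTgt x).mem_nhds hy.1, hKc.isClosed.isOpen_compl.mem_nhds hy.2]
        with z hz hzK
      rw [hw0 z hz hzK, zero_mul]
    simp only [pd, this.fderiv_eq]
    simp
  rw [setIntegral_congr_fun (isOpen_chartTgt x).measurableSet
    fun y hy => (sum_pd_mul_flux hw hφ hy).symm, integral_finsetSum _ fun i _ => hint i]
  exact Finset.sum_eq_zero fun i _ => h0 i

variable [MeasurableSpace S] [BorelSpace S]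

omit [MeasurableSpace S] [BorelSpace S] in
theorem gradDot_eq_zero_of_notMem {p : S} (hp : p ∉ tsupport w) : gradDot σ w φ p = 0 := by
  have h1 : (fun z => w (pt p z)) =ᶠ[𝓝 (ctr p : EuclideanSpace ℝ (Fin n))] fun _ => 0 := by
    filter_upwards [eventually_pt_mem (ctr_mem p) (isClosed_tsupport w).isOpen_compl
      (by simpa using hp)] with z hz
    exact image_eq_zero_of_notMem_tsupport hz
  have h2 : ∀ i, pd i (fun z => w (pt p z)) (ctr p : EuclideanSpace ℝ (Fin n)) = 0 := fun i => by
    simp [pd, h1.fderiv_eq]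
  simp [gradDot, h2]

omit [MeasurableSpace S] [BorelSpace S] in
theorem continuousOn_chartLap_chart (hφ : ContMDiff (𝓡 n) 𝓘(ℝ, ℂ) ∞ φ) (x : S) :
    ContinuousOn (fun p => chartLap σ x φ (chartAt (EuclideanSpace ℝ (Fin n)) x p))
      (chartDom n x) :=
  ContinuousOn.comp (fun _ hy => (continuousAt_chartLap hφ hy).continuousWithinAt)
    (chartAt (EuclideanSpace ℝ (Fin n)) x).continuousOn
    (fun _ hp => chart_mem hp)

theorem integrable_green (hw : ContMDiff (𝓡 n) 𝓘(ℝ, ℂ) ∞ w)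
    (hφ : ContMDiff (𝓡 n) 𝓘(ℝ, ℂ) ∞ φ) {x : S} (hc : IsCompact (tsupport w))
    (hx : tsupport w ⊆ chartDom n x) :
    Integrable (fun p => gradDot σ w φ p
      + w p * chartLap σ x φ (chartAt (EuclideanSpace ℝ (Fin n)) x p)) (vol σ) := by
  rw [← integrableOn_iff_integrable_of_support_subset (s := tsupport w)]
  · refine ContinuousOn.integrableOn_compact' hc (isClosed_tsupport w).measurableSet ?_
    exact (continuous_gradDot hw hφ).continuousOn.add
      (hw.continuous.continuousOn.mul ((continuousOn_chartLap_chart hφ x).mono hx))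
  · intro p hp
    by_contra h
    exact hp (by simp [gradDot_eq_zero_of_notMem h, image_eq_zero_of_notMem_tsupport h])

/-- Green's formula against a function supported in the domain of a chart. -/
theorem green_dom (hw : ContMDiff (𝓡 n) 𝓘(ℝ, ℂ) ∞ w)
    (hφ : ContMDiff (𝓡 n) 𝓘(ℝ, ℂ) ∞ φ) {x : S} (hc : IsCompact (tsupport w))
    (hx : tsupport w ⊆ chartDom n x) :
    ∫ p, (gradDot σ w φ p + w p * chartLap σ x φ (chartAt (EuclideanSpace ℝ (Fin n)) x p)) ∂(vol σ)
      = 0 := by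
  rw [← setIntegral_eq_integral_of_forall_compl_eq_zero (s := chartDom n x), setIntegral_dom,
    ← green_chart (σ := σ) hw hφ hc hx]
  · refine setIntegral_congr_fun (isOpen_chartTgt x).measurableSet fun y hy => ?_
    simp only [chart_pt hy]
  · rw [← vol_restrict_dom]
    exact (integrable_green hw hφ hc hx).aestronglyMeasurable.restrict
  · intro p hp
    have h : p ∉ tsupport w := fun h => hp (hx h)
    simp [gradDot_eq_zero_of_notMem h, image_eq_zero_of_notMem_tsupport h]

/-- The Laplace-Beltrami operator does not depend on the chart: by Green's formula its expressions
in two charts agree when tested against functions supported in the overlap. -/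
theorem chartLap_eq [T2Space S] [CompactSpace S] (hφ : ContMDiff (𝓡 n) 𝓘(ℝ, ℂ) ∞ φ) {x x' p : S}
    (hp : p ∈ chartDom n x) (hp' : p ∈ chartDom n x') :
    chartLap σ x φ (chartAt (EuclideanSpace ℝ (Fin n)) x p)
      = chartLap σ x' φ (chartAt (EuclideanSpace ℝ (Fin n)) x' p) := by
  set O := chartDom n x ∩ chartDom n x' with hO
  have hOo : IsOpen O := (isOpen_chartDom x).inter (isOpen_chartDom x')
  set f := fun q => chartLap σ x φ (chartAt (EuclideanSpace ℝ (Fin n)) x q) with hf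
  set f' := fun q => chartLap σ x' φ (chartAt (EuclideanSpace ℝ (Fin n)) x' q) with hf'
  have hfc : ContinuousOn f O := (continuousOn_chartLap_chart hφ x).mono Set.inter_subset_left
  have hfc' : ContinuousOn f' O := (continuousOn_chartLap_chart hφ x').mono Set.inter_subset_right
  have hloc : LocallyCompactSpace S :=
    ChartedSpace.locallyCompactSpace (EuclideanSpace ℝ (Fin n)) S
  have hae : ∀ᵐ q ∂(vol σ), q ∈ O → f q - f' q = 0 := by
    refine IsOpen.ae_eq_zero_of_integral_contMDiff_smul_eq_zero (𝓡 n) hOo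
      ((hfc.sub hfc').locallyIntegrableOn hOo.measurableSet) fun g hg hgc hgO => ?_
    have hw : ContMDiff (𝓡 n) 𝓘(ℝ, ℂ) ∞ fun q => (g q : ℂ) :=
      Complex.ofRealCLM.contDiff.contMDiff.comp hg
    have hs : tsupport (fun q => (g q : ℂ)) ⊆ tsupport g :=
      closure_mono fun q hq h => hq (by simp [h])
    have hc : IsCompact (tsupport fun q => (g q : ℂ)) :=
      IsCompact.of_isClosed_subset hgc (isClosed_tsupport _) hs
    have h1 := integrable_green (σ := σ) hw hφ hc (hs.trans (hgO.trans Set.inter_subset_left))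
    have h2 := integrable_green (σ := σ) hw hφ hc (hs.trans (hgO.trans Set.inter_subset_right))
    have h3 := green_dom (σ := σ) hw hφ hc (hs.trans (hgO.trans Set.inter_subset_left))
    have h4 := green_dom (σ := σ) hw hφ hc (hs.trans (hgO.trans Set.inter_subset_right))
    have h5 := integral_sub h1 h2
    rw [h3, h4, sub_zero] at h5
    rw [← h5]
    refine integral_congr_ae (Filter.Eventually.of_forall fun q => ?_)
    simp only [Complex.real_smul]
    ring
  have h := Measure.eqOn_open_of_ae_eq (μ := vol σ) (f := f) (g := f') (U := O)
    ((ae_restrict_iff' hOo.measurableSet).2 (hae.mono fun q hq hqO => sub_eq_zero.1 (hq hqO)))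
    hOo hfc hfc'
  exact h ⟨hp, hp'⟩

theorem laplacian_eq_chartLap [T2Space S] [CompactSpace S] (hφ : ContMDiff (𝓡 n) 𝓘(ℝ, ℂ) ∞ φ) {x p : S}
    (hp : p ∈ chartDom n x) :
    laplacian σ φ p = chartLap σ x φ (chartAt (EuclideanSpace ℝ (Fin n)) x p) :=
  chartLap_eq hφ (mem_chartDom p) hp

theorem continuous_laplacian [T2Space S] [CompactSpace S] (hφ : ContMDiff (𝓡 n) 𝓘(ℝ, ℂ) ∞ φ) :
    Continuous (laplacian σ φ) := by
  rw [continuous_iff_continuousAt]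
  intro x
  refine ((continuousOn_chartLap_chart (σ := σ) hφ x).continuousAt
    ((isOpen_chartDom x).mem_nhds (mem_chartDom x))).congr ?_
  filter_upwards [(isOpen_chartDom (n := n) x).mem_nhds (mem_chartDom x)] with p hp
  exact (laplacian_eq_chartLap (n := n) hφ hp).symm

end LocalGreen

section Green

variable {n : ℕ} {S : Type*} [TopologicalSpace S] [ChartedSpace (EuclideanSpace ℝ (Fin n)) S]
  [IsManifold (𝓡 n) ∞ S] {σ : Metric n S} [T2Space S] [CompactSpace S]

omit [T2Space S] [CompactSpace S] in
theorem differentiableAt_comp_pt_ctr {w : S → ℂ} (hw : ContMDiff (𝓡 n) 𝓘(ℝ, ℂ) ∞ w) (p : S) :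
    DifferentiableAt ℝ (fun z => w (pt p z)) (ctr p : EuclideanSpace ℝ (Fin n)) :=
  (contDiffAt_comp_pt hw (ctr_mem p)).differentiableAt (by simp)

omit [T2Space S] [CompactSpace S] in
theorem gradDot_sum {ι : Type*} (t : Finset ι) {w : ι → S → ℂ} {φ : S → ℂ}
    (hw : ∀ i, ContMDiff (𝓡 n) 𝓘(ℝ, ℂ) ∞ (w i)) (p : S) :
    gradDot σ (fun q => ∑ k ∈ t, w k q) φ p = ∑ k ∈ t, gradDot σ (w k) φ p := by
  have h : ∀ i, pd i (fun z => ∑ k ∈ t, w k (pt p z)) (ctr p : EuclideanSpace ℝ (Fin n))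
      = ∑ k ∈ t, pd i (fun z => w k (pt p z)) (ctr p) := fun i => by
    simp only [pd]
    rw [fderiv_fun_sum fun k _ => differentiableAt_comp_pt_ctr (hw k) p, sum_apply]
  simp only [gradDot, h, Finset.sum_mul, Finset.smul_sum]
  rw [Finset.sum_comm (s := t)]
  refine Finset.sum_congr rfl fun i _ => ?_
  rw [Finset.sum_comm]

variable [MeasurableSpace S] [BorelSpace S]

/-- Green's formula on a compact manifold. -/
theorem green {w φ : S → ℂ} (hw : ContMDiff (𝓡 n) 𝓘(ℝ, ℂ) ∞ w)
    (hφ : ContMDiff (𝓡 n) 𝓘(ℝ, ℂ) ∞ φ) :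
    ∫ p, w p * laplacian σ φ p ∂(vol σ) = - ∫ p, gradDot σ w φ p ∂(vol σ) := by
  obtain ⟨f, hf⟩ := SmoothPartitionOfUnity.exists_isSubordinate_chartAt_source (𝓡 n) S
  have hfin := f.locallyFinite.finite_nonempty_of_compact
  set t := hfin.toFinset with ht
  have hsum : ∀ p, ∑ i ∈ t, f i p = 1 := fun p => by
    rw [← f.sum_eq_one (Set.mem_univ p), finsum_eq_sum_of_support_subset]
    intro i hi
    simp only [ht, Set.Finite.coe_toFinset, Set.mem_ofPred_eq]
    exact ⟨p, hi⟩
  set W : S → S → ℂ := fun i p => f i p • w p with hW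
  have hWs : ∀ i, ContMDiff (𝓡 n) 𝓘(ℝ, ℂ) ∞ (W i) := fun i =>
    (f i).contMDiff.smul hw
  have hwW : w = fun p => ∑ i ∈ t, W i p := by
    funext p
    rw [hW, ← Finset.sum_smul, hsum p, one_smul]
  have hsupp : ∀ i, tsupport (W i) ⊆ chartDom n i := fun i =>
    (closure_mono (Function.support_smul_subset_left _ _)).trans (hf i)
  -- Green's formula for the pieces of `w` cut out by a partition of unity
  have hzero : ∀ i, ∫ p, (gradDot σ (W i) φ p + W i p * laplacian σ φ p) ∂(vol σ) = 0 := fun i => by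
    rw [← green_dom (σ := σ) (hWs i) hφ (isClosed_tsupport (W i)).isCompact (hsupp i)]
    refine integral_congr_ae (Filter.Eventually.of_forall fun p => ?_)
    by_cases hp : p ∈ chartDom n i
    · simp only [laplacian_eq_chartLap hφ hp]
    · have : W i p = 0 := image_eq_zero_of_notMem_tsupport fun h => hp (hsupp i h)
      simp only [this, zero_mul]
  have hint : ∀ {v : S → ℂ}, Continuous v → Integrable v (vol σ) := fun hv =>
    hv.integrable_of_hasCompactSupport (HasCompactSupport.of_compactSpace _)
  have h1 : ∫ p, (gradDot σ w φ p + w p * laplacian σ φ p) ∂(vol σ) = 0 := by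
    have e : ∀ p, gradDot σ w φ p + w p * laplacian σ φ p
        = ∑ i ∈ t, (gradDot σ (W i) φ p + W i p * laplacian σ φ p) := fun p => by
      rw [Finset.sum_add_distrib, ← gradDot_sum t hWs, ← Finset.sum_mul, ← hwW]
      rw [congrFun hwW p]
    rw [integral_congr_ae (Filter.Eventually.of_forall e), integral_finsetSum _ fun i _ => ?_]
    · exact Finset.sum_eq_zero fun i _ => hzero i
    · exact hint ((continuous_gradDot (hWs i) hφ).add
        ((hWs i).continuous.mul (continuous_laplacian hφ)))
  rw [integral_add (hint (continuous_gradDot hw hφ))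
    (hint (v := fun p => w p * laplacian σ φ p)
      (hw.continuous.mul (continuous_laplacian hφ)))] at h1
  linear_combination h1

end Green

/-! ### Poincaré's inequality on convex sets -/

section Poincare

open scoped ENNReal

/-- The Cauchy-Schwarz inequality against the constant function `1`. -/
theorem lintegral_sq_le {α : Type*} [MeasurableSpace α] (ν : Measure α) {h : α → ℝ≥0∞}
    (hh : AEMeasurable h ν) : (∫⁻ a, h a ∂ν) ^ 2 ≤ ν Set.univ * ∫⁻ a, h a ^ 2 ∂ν := by
  have h1 := ENNReal.lintegral_mul_le_Lp_mul_Lq ν Real.HolderConjugate.two_two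
    (f := fun _ => 1) (g := h) aemeasurable_const hh
  simp only [Pi.mul_apply, one_mul, lintegral_const, ENNReal.rpow_two] at h1
  calc (∫⁻ a, h a ∂ν) ^ 2
      ≤ (ν Set.univ ^ (1 / 2 : ℝ) * (∫⁻ a, h a ^ 2 ∂ν) ^ (1 / 2 : ℝ)) ^ 2 := by
        gcongr
        simpa using h1
    _ = ν Set.univ * ∫⁻ a, h a ^ 2 ∂ν := by
      rw [mul_pow, ← ENNReal.rpow_natCast, ← ENNReal.rpow_natCast, ← ENNReal.rpow_mul,
        ← ENNReal.rpow_mul]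
      norm_num

theorem ennreal_add_sq_le (a b : ℝ≥0∞) : (a + b) ^ 2 ≤ 2 * a ^ 2 + 2 * b ^ 2 := by
  have h := ENNReal.rpow_add_le_mul_rpow_add_rpow a b (p := 2) (by norm_num)
  norm_num at h
  rwa [← mul_add]

/-- The square integral of a function is controlled by its mean and its oscillation. -/
theorem lintegral_sq_le_mean_add_oscillation {α : Type*} [MeasurableSpace α] (ν : Measure α)
    [IsFiniteMeasure ν] {f : α → ℂ} (hf : Measurable f) (hi : Integrable f ν) :
    ν Set.univ * ∫⁻ q, ‖f q‖ₑ ^ 2 ∂ν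
      ≤ 2 * ‖∫ p, f p ∂ν‖ₑ ^ 2 + 2 * ∫⁻ q, ∫⁻ p, ‖f q - f p‖ₑ ^ 2 ∂ν ∂ν := by
  set V := ν Set.univ with hV
  have hVt : V ≠ ⊤ := measure_ne_top ν _
  by_cases hV0 : V = 0
  · simp [hV0]
  have hpt : ∀ q, V ^ 2 * ‖f q‖ₑ ^ 2
      ≤ 2 * ‖∫ p, f p ∂ν‖ₑ ^ 2 + 2 * (V * ∫⁻ p, ‖f q - f p‖ₑ ^ 2 ∂ν) := fun q => by
    have h1 : (ν.real Set.univ : ℂ) * f q = ∫ p, f p ∂ν + ∫ p, (f q - f p) ∂ν := by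
      rw [integral_sub (integrable_const _) hi, integral_const, Complex.real_smul]
      ring
    have h2 : V * ‖f q‖ₑ ≤ ‖∫ p, f p ∂ν‖ₑ + ∫⁻ p, ‖f q - f p‖ₑ ∂ν := by
      have h3 : V * ‖f q‖ₑ = ‖(ν.real Set.univ : ℂ) * f q‖ₑ := by
        rw [enorm_mul]
        congr 1
        rw [← ofReal_norm, Complex.norm_real, Real.norm_of_nonneg measureReal_nonneg,
          ofReal_measureReal]
      rw [h3, h1]
      exact (enorm_add_le _ _).trans (by gcongr; exact enorm_integral_le_lintegral_enorm _)
    rw [← mul_pow]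
    refine (pow_le_pow_left' h2 2).trans ((ennreal_add_sq_le _ _).trans ?_)
    gcongr
    exact lintegral_sq_le ν ((measurable_const.sub hf).enorm.aemeasurable)
  have h4 := lintegral_mono (μ := ν) hpt
  have hm : Measurable fun q => ∫⁻ p, ‖f q - f p‖ₑ ^ 2 ∂ν :=
    Measurable.lintegral_prod_right' (f := fun z : α × α => ‖f z.1 - f z.2‖ₑ ^ 2)
      ((((hf.comp measurable_fst).sub (hf.comp measurable_snd)).enorm).pow_const 2)
  rw [lintegral_const_mul' _ _ (ENNReal.pow_ne_top hVt), lintegral_add_left measurable_const,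
    lintegral_const, lintegral_const_mul' _ _ ENNReal.ofNat_ne_top,
    lintegral_const_mul' _ _ hVt, ← hV] at h4
  have h5 : V * (V * ∫⁻ q, ‖f q‖ₑ ^ 2 ∂ν)
      ≤ V * (2 * ‖∫ p, f p ∂ν‖ₑ ^ 2 + 2 * ∫⁻ q, ∫⁻ p, ‖f q - f p‖ₑ ^ 2 ∂ν ∂ν) := by
    calc V * (V * ∫⁻ q, ‖f q‖ₑ ^ 2 ∂ν) = V ^ 2 * ∫⁻ q, ‖f q‖ₑ ^ 2 ∂ν := by ring
      _ ≤ _ := h4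
      _ = _ := by ring
  exact (ENNReal.mul_le_mul_iff_right hV0 hVt).1 h5

variable {n : ℕ}

theorem lintegral_comp_add_smul {g : EuclideanSpace ℝ (Fin n) → ℝ≥0∞} (hg : Measurable g)
    (a : EuclideanSpace ℝ (Fin n)) {t : ℝ} (ht : t ≠ 0) :
    ∫⁻ x, g (a + t • x) = ENNReal.ofReal |(t ^ n)⁻¹| * ∫⁻ x, g x := by
  have h1 : ∫⁻ x, g (a + t • x) = ∫⁻ z, g (a + z) ∂(Measure.map (t • ·) volume) :=
    (lintegral_map (hg.comp (measurable_const_add a)) (measurable_const_smul t)).symm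
  rw [h1, Measure.map_addHaar_smul volume ht, lintegral_smul_measure,
    lintegral_add_left_eq_self (μ := volume) g a]
  simp

theorem setLIntegral_comp_segment_le {E : Set (EuclideanSpace ℝ (Fin n))} (hE : Convex ℝ E)
    (hEm : MeasurableSet E) {g : EuclideanSpace ℝ (Fin n) → ℝ≥0∞} (hg : Measurable g)
    {y : EuclideanSpace ℝ (Fin n)} (hy : y ∈ E) {t : ℝ} (ht : 1 / 2 ≤ t) (ht1 : t ≤ 1) :
    ∫⁻ x in E, g ((1 - t) • y + t • x) ≤ 2 ^ n * ∫⁻ x in E, g x := by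
  have ht0 : 0 < t := by linarith
  have h1 : ∫⁻ x in E, g ((1 - t) • y + t • x)
      ≤ ∫⁻ x, E.indicator g ((1 - t) • y + t • x) := by
    rw [← lintegral_indicator hEm]
    refine lintegral_mono fun x => ?_
    by_cases hx : x ∈ E
    · rw [Set.indicator_of_mem hx, Set.indicator_of_mem
        (hE hy hx (by linarith) ht0.le (by ring))]
    · rw [Set.indicator_of_notMem hx]
      exact bot_le
  refine h1.trans ?_
  rw [lintegral_comp_add_smul (hg.indicator hEm) _ ht0.ne', lintegral_indicator hEm]
  gcongr
  rw [abs_of_pos (by positivity), ← inv_pow]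
  have : (t⁻¹) ^ n ≤ 2 ^ n := by
    gcongr
    rw [inv_le_comm₀ ht0 two_pos]
    linarith
  refine (ENNReal.ofReal_le_ofReal this).trans (le_of_eq ?_)
  rw [ENNReal.ofReal_pow two_pos.le]
  simp

/-- The fundamental theorem of calculus along a segment, combined with the Cauchy-Schwarz
inequality. -/
theorem enorm_sub_sq_le_segment {f : EuclideanSpace ℝ (Fin n) → ℂ}
    {E : Set (EuclideanSpace ℝ (Fin n))} (hE : Convex ℝ E)
    (hf : ∀ z ∈ E, ContDiffAt ℝ 1 f z) {x y : EuclideanSpace ℝ (Fin n)} (hx : x ∈ E) (hy : y ∈ E) :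
    ‖f x - f y‖ₑ ^ 2 ≤ ‖x - y‖ₑ ^ 2 *
      ∫⁻ t in Set.Ioc (0 : ℝ) 1, ‖fderiv ℝ f ((1 - t) • y + t • x)‖ₑ ^ 2 := by
  have hmem : ∀ t ∈ Set.Icc (0 : ℝ) 1, (1 - t) • y + t • x ∈ E := fun t ht =>
    hE hy hx (by linarith [ht.2]) ht.1 (by ring)
  have hline : ∀ t, HasDerivAt (fun t : ℝ => (1 - t) • y + t • x) (x - y) t := fun t => by
    have h1 : HasDerivAt (fun t : ℝ => (1 - t) • y + t • x) ((-1 : ℝ) • y + (1 : ℝ) • x) t :=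
      (((hasDerivAt_id t).const_sub 1).smul_const y).add ((hasDerivAt_id t).smul_const x)
    convert h1 using 1
    module
  have hcl : Continuous fun t : ℝ => (1 - t) • y + t • x := by fun_prop
  have hder : ∀ t ∈ Set.uIcc (0 : ℝ) 1, HasDerivAt (fun t : ℝ => f ((1 - t) • y + t • x))
      (fderiv ℝ f ((1 - t) • y + t • x) (x - y)) t := fun t ht => by
    rw [Set.uIcc_of_le zero_le_one] at ht
    exact (((hf _ (hmem t ht)).differentiableAt (by simp)).hasFDerivAt).comp_hasDerivAt t (hline t)
  have hcont : ContinuousOn (fun t : ℝ => fderiv ℝ f ((1 - t) • y + t • x) (x - y))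
      (Set.uIcc 0 1) := fun t ht => by
    rw [Set.uIcc_of_le zero_le_one] at ht
    have := ((hf _ (hmem t ht)).fderiv_right (m := 0) (by simp)).continuousAt
    exact ((ContinuousAt.comp (f := fun t : ℝ => (1 - t) • y + t • x) (g := fderiv ℝ f) this
      hcl.continuousAt).clm_apply continuousAt_const).continuousWithinAt
  have h1 := intervalIntegral.integral_eq_sub_of_hasDerivAt hder hcont.intervalIntegrable
  rw [intervalIntegral.integral_of_le zero_le_one] at h1
  norm_num at h1
  have hm : Measurable fun t : ℝ => ‖fderiv ℝ f ((1 - t) • y + t • x)‖ₑ :=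
    ((measurable_fderiv ℝ f).comp hcl.measurable).enorm
  have h2 : ‖f x - f y‖ₑ
      ≤ ‖x - y‖ₑ * ∫⁻ t in Set.Ioc (0 : ℝ) 1, ‖fderiv ℝ f ((1 - t) • y + t • x)‖ₑ := by
    rw [← h1, ← lintegral_const_mul _ hm]
    refine (enorm_integral_le_lintegral_enorm _).trans (lintegral_mono fun t => ?_)
    rw [mul_comm]
    have := (fderiv ℝ f ((1 - t) • y + t • x)).le_opENorm (x - y)
    rwa [map_sub] at this
  refine (pow_le_pow_left' h2 2).trans ?_
  rw [mul_pow]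
  gcongr
  refine (lintegral_sq_le _ hm.aemeasurable).trans (le_of_eq ?_)
  simp

theorem lintegral_rotate {α β γ : Type*} [MeasurableSpace α] [MeasurableSpace β]
    [MeasurableSpace γ] (μ : Measure α) (ν : Measure β) (τ : Measure γ) [SFinite μ] [SFinite ν]
    [SFinite τ] {G : α → β → γ → ℝ≥0∞} (hG : Measurable fun z : (α × γ) × β => G z.1.1 z.2 z.1.2) :
    ∫⁻ x, ∫⁻ y, ∫⁻ t, G x y t ∂τ ∂ν ∂μ = ∫⁻ t, ∫⁻ x, ∫⁻ y, G x y t ∂ν ∂μ ∂τ := by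
  have h2 : ∀ x, ∫⁻ y, ∫⁻ t, G x y t ∂τ ∂ν = ∫⁻ t, ∫⁻ y, G x y t ∂ν ∂τ := fun x =>
    lintegral_lintegral_swap (hG.comp (f := fun z : β × γ => ((x, z.2), z.1))
      (by fun_prop)).aemeasurable
  simp only [h2]
  exact lintegral_lintegral_swap hG.lintegral_prod_right'.aemeasurable

/-- The oscillation of a function on a convex set is controlled by its derivative. In the segment
between two points the parameter is split at `1/2`, so that one of the two end points can be used
as a variable of integration with a bounded Jacobian. -/
theorem oscillation_le {f : EuclideanSpace ℝ (Fin n) → ℂ}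
    {E : Set (EuclideanSpace ℝ (Fin n))} (hE : Convex ℝ E) (hEm : MeasurableSet E)
    (hf : ∀ z ∈ E, ContDiffAt ℝ 1 f z) {d : ℝ≥0∞} (hdt : d ≠ ⊤)
    (hd : ∀ x ∈ E, ∀ y ∈ E, ‖x - y‖ₑ ≤ d) :
    ∫⁻ x in E, ∫⁻ y in E, ‖f x - f y‖ₑ ^ 2
      ≤ d ^ 2 * (2 ^ n * (volume E * ∫⁻ z in E, ‖fderiv ℝ f z‖ₑ ^ 2)) := by
  set g : EuclideanSpace ℝ (Fin n) → ℝ≥0∞ := fun z => ‖fderiv ℝ f z‖ₑ ^ 2 with hg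
  have hgm : Measurable g := (measurable_fderiv ℝ f).enorm.pow_const 2
  have hmap : Measurable fun z : (EuclideanSpace ℝ (Fin n) × ℝ) × EuclideanSpace ℝ (Fin n) =>
      (1 - z.1.2) • z.2 + z.1.2 • z.1.1 := Continuous.measurable (by fun_prop)
  have hslice : ∀ t ∈ Set.Ioc (0 : ℝ) 1, ∫⁻ x in E, ∫⁻ y in E, g ((1 - t) • y + t • x)
      ≤ 2 ^ n * (volume E * ∫⁻ z in E, g z) := by
    intro t ht
    have hb : ∫⁻ _ in E, (2 ^ n * ∫⁻ z in E, g z) = 2 ^ n * (volume E * ∫⁻ z in E, g z) := by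
      rw [setLIntegral_const]
      ring
    rw [← hb]
    rcases le_total (1 / 2) t with h | h
    · rw [lintegral_lintegral_swap]
      · exact setLIntegral_mono' hEm fun y hy => setLIntegral_comp_segment_le hE hEm hgm hy h ht.2
      · have hm : Measurable fun z : EuclideanSpace ℝ (Fin n) × EuclideanSpace ℝ (Fin n) =>
            (1 - t) • z.2 + t • z.1 := Continuous.measurable (by fun_prop)
        exact (hgm.comp hm).aemeasurable
    · refine setLIntegral_mono' hEm fun x hx => ?_
      have := setLIntegral_comp_segment_le hE hEm hgm hx (t := 1 - t) (by linarith)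
        (by linarith [ht.1])
      simpa [add_comm] using this
  calc ∫⁻ x in E, ∫⁻ y in E, ‖f x - f y‖ₑ ^ 2
      ≤ ∫⁻ x in E, ∫⁻ y in E, d ^ 2 * ∫⁻ t in Set.Ioc (0 : ℝ) 1, g ((1 - t) • y + t • x) :=
        setLIntegral_mono' hEm fun x hx => setLIntegral_mono' hEm fun y hy =>
          (enorm_sub_sq_le_segment hE hf hx hy).trans (by gcongr; exact hd x hx y hy)
    _ = d ^ 2 * ∫⁻ x in E, ∫⁻ y in E, ∫⁻ t in Set.Ioc (0 : ℝ) 1, g ((1 - t) • y + t • x) := by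
        simp only [lintegral_const_mul' _ _ (ENNReal.pow_ne_top hdt)]
    _ = d ^ 2 * ∫⁻ t in Set.Ioc (0 : ℝ) 1, ∫⁻ x in E, ∫⁻ y in E, g ((1 - t) • y + t • x) := by
        rw [lintegral_rotate (volume.restrict E) (volume.restrict E) _
          (G := fun x y t => g ((1 - t) • y + t • x)) (hgm.comp hmap)]
    _ ≤ d ^ 2 * ∫⁻ _ in Set.Ioc (0 : ℝ) 1, 2 ^ n * (volume E * ∫⁻ z in E, g z) := by
        exact mul_le_mul_right (setLIntegral_mono' measurableSet_Ioc hslice) _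
    _ = _ := by simp

end Poincare

/-! ### The gradient -/

section Gradient

variable {n : ℕ}

/-- The Cauchy-Schwarz inequality `a_i² ≤ (M⁻¹)^{kl} a_k a_l M_{ii}` for a positive definite
matrix. -/
theorem sq_le_diag_mul_inv {M : Matrix (Fin n) (Fin n) ℝ} (hM : M.PosDef) (a : Fin n → ℝ)
    (i : Fin n) : a i ^ 2 ≤ M i i * ∑ k, ∑ l, M⁻¹ k l * (a k * a l) := by
  have hdet : IsUnit M.det := hM.det_pos.ne'.isUnit
  have hinv : M⁻¹.PosDef := hM.inv
  have hsymm : ∀ k l, M⁻¹ k l = M⁻¹ l k := fun k l => by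
    have := congrFun (congrFun hinv.1 l) k
    simpa using this
  set q := ∑ k, ∑ l, M⁻¹ k l * (a k * a l) with hq
  have hii : 0 < M i i := hM.diag_pos
  have h1 : ∀ k, ∑ l, M⁻¹ k l * M l i = if k = i then 1 else 0 := fun k => by
    have := congrFun (congrFun (Matrix.nonsing_inv_mul M hdet) k) i
    rw [Matrix.mul_apply, Matrix.one_apply] at this
    exact this
  -- the quadratic form of `M⁻¹` at `a - t M e_i`, with `t = a_i / M_{ii}`
  have key : ∀ t : ℝ, 0 ≤ q - 2 * t * a i + t ^ 2 * M i i := fun t => by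
    have h2 := hinv.posSemidef.dotProduct_mulVec_nonneg (fun k => a k - t * M k i)
    have h3 : star (fun k => a k - t * M k i) ⬝ᵥ M⁻¹.mulVec (fun k => a k - t * M k i)
        = q - t * ∑ k, a k * ∑ l, M⁻¹ k l * M l i - t * ∑ k, ∑ l, a l * (M⁻¹ k l * M k i)
          + t ^ 2 * ∑ k, M k i * ∑ l, M⁻¹ k l * M l i := by
      rw [hq]
      simp only [dotProduct, Matrix.mulVec, Pi.star_apply, star_trivial, Finset.mul_sum,
        ← Finset.sum_sub_distrib, ← Finset.sum_add_distrib]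
      exact Finset.sum_congr rfl fun k _ => Finset.sum_congr rfl fun l _ => by ring
    have h4 : ∑ k, ∑ l, a l * (M⁻¹ k l * M k i) = ∑ l, a l * ∑ k, M⁻¹ l k * M k i := by
      rw [Finset.sum_comm]
      refine Finset.sum_congr rfl fun l _ => ?_
      rw [Finset.mul_sum]
      exact Finset.sum_congr rfl fun k _ => by rw [hsymm k l]
    rw [h3, h4] at h2
    simp only [h1, mul_ite, mul_one, mul_zero, Finset.sum_ite_eq', Finset.mem_univ, if_true] at h2
    linarith
  have h5 := key (a i / M i i)
  have h6 : q - 2 * (a i / M i i) * a i + (a i / M i i) ^ 2 * M i i = q - a i ^ 2 / M i i := by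
    field_simp
    ring
  rw [h6, sub_nonneg, div_le_iff₀ hii] at h5
  linarith

theorem re_sum_mul_conj (N : Matrix (Fin n) (Fin n) ℝ) (a : Fin n → ℂ) :
    (∑ k, ∑ l, (N k l : ℂ) * (a k * (starRingEnd ℂ) (a l))).re
      = (∑ k, ∑ l, N k l * ((a k).re * (a l).re)) + ∑ k, ∑ l, N k l * ((a k).im * (a l).im) := by
  simp only [Complex.re_sum, ← Finset.sum_add_distrib]
  refine Finset.sum_congr rfl fun k _ => Finset.sum_congr rfl fun l _ => ?_
  rw [Complex.re_ofReal_mul, Complex.mul_re, Complex.conj_re, Complex.conj_im]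
  ring

theorem norm_sq_le_diag_mul_inv {M : Matrix (Fin n) (Fin n) ℝ} (hM : M.PosDef) (a : Fin n → ℂ)
    (i : Fin n) :
    ‖a i‖ ^ 2 ≤ M i i * (∑ k, ∑ l, (M⁻¹ k l : ℂ) * (a k * (starRingEnd ℂ) (a l))).re := by
  rw [re_sum_mul_conj, mul_add, ← Complex.normSq_eq_norm_sq, Complex.normSq_apply]
  have h1 := sq_le_diag_mul_inv hM (fun k => (a k).re) i
  have h2 := sq_le_diag_mul_inv hM (fun k => (a k).im) i
  nlinarith

theorem norm_fderiv_sq_le (f : EuclideanSpace ℝ (Fin n) → ℂ) (y : EuclideanSpace ℝ (Fin n)) :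
    ‖fderiv ℝ f y‖ ^ 2 ≤ n * ∑ i, ‖pd i f y‖ ^ 2 := by
  have h1 : ‖fderiv ℝ f y‖ ≤ ∑ i, ‖pd i f y‖ := by
    refine ContinuousLinearMap.opNorm_le_bound _ (Finset.sum_nonneg fun i _ => norm_nonneg _)
      fun ξ => ?_
    have h2 := map_eq_sum_bas (fderiv ℝ f y).toLinearMap ξ
    rw [ContinuousLinearMap.coe_coe] at h2
    rw [h2, Finset.sum_mul]
    refine (norm_sum_le _ _).trans (Finset.sum_le_sum fun i _ => ?_)
    rw [norm_smul, mul_comm]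
    exact mul_le_mul_of_nonneg_left (PiLp.norm_apply_le ξ i) (norm_nonneg _)
  refine (pow_le_pow_left₀ (norm_nonneg _) h1 2).trans ?_
  have := sq_sum_le_card_mul_sum_sq (s := (Finset.univ : Finset (Fin n)))
    (f := fun i => ‖pd i f y‖)
  simpa using this

theorem pd_conj (k : Fin n) (f : EuclideanSpace ℝ (Fin n) → ℂ) (y : EuclideanSpace ℝ (Fin n)) :
    pd k (fun z => (starRingEnd ℂ) (f z)) y = (starRingEnd ℂ) (pd k f y) := by
  have := Complex.conjCLE.comp_fderiv (f := f) (x := y)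
  simp only [pd]
  exact congrArg (fun L : EuclideanSpace ℝ (Fin n) →L[ℝ] ℂ => L (EuclideanSpace.single k 1)) this

variable {S : Type*} [TopologicalSpace S] [ChartedSpace (EuclideanSpace ℝ (Fin n)) S]
  [IsManifold (𝓡 n) ∞ S] {σ : Metric n S}

omit [IsManifold (𝓡 n) ∞ S] in
theorem contMDiff_star {u : S → ℂ} (hu : ContMDiff (𝓡 n) 𝓘(ℝ, ℂ) ∞ u) :
    ContMDiff (𝓡 n) 𝓘(ℝ, ℂ) ∞ fun p => (starRingEnd ℂ) (u p) :=
  Complex.conjCLE.contDiff.contMDiff.comp hu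

theorem gradSq_eq (u : S → ℂ) (p : S) :
    gradSq σ u p = (gradDot σ u (fun q => (starRingEnd ℂ) (u q)) p).re := by
  simp only [gradSq, gradDot, pd_conj, Complex.real_smul]

theorem gradSq_pt {u : S → ℂ} (hu : ContMDiff (𝓡 n) 𝓘(ℝ, ℂ) ∞ u) {x : S}
    {y : EuclideanSpace ℝ (Fin n)} (hy : y ∈ chartTgt n x) :
    gradSq σ u (pt x y) = (∑ i, ∑ j, (gramInv σ x y i j : ℂ) *
      (pd i (fun z => u (pt x z)) y * (starRingEnd ℂ) (pd j (fun z => u (pt x z)) y))).re := by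
  rw [gradSq_eq, gradDot_pt hu (contMDiff_star hu) hy]
  simp only [pd_conj, Complex.real_smul]

theorem continuous_gradSq {u : S → ℂ} (hu : ContMDiff (𝓡 n) 𝓘(ℝ, ℂ) ∞ u) :
    Continuous (gradSq σ u) := by
  rw [funext fun p => gradSq_eq (σ := σ) u p]
  exact Complex.continuous_re.comp (continuous_gradDot hu (contMDiff_star hu))

/-- In a chart, a partial derivative is controlled by the Riemannian length of the gradient. -/
theorem norm_pd_sq_le {u : S → ℂ} (hu : ContMDiff (𝓡 n) 𝓘(ℝ, ℂ) ∞ u) {x : S}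
    {y : EuclideanSpace ℝ (Fin n)} (hy : y ∈ chartTgt n x) (i : Fin n) :
    ‖pd i (fun z => u (pt x z)) y‖ ^ 2 ≤ gram σ x y i i * gradSq σ u (pt x y) := by
  rw [gradSq_pt hu hy]
  exact norm_sq_le_diag_mul_inv (gram_posDef σ hy) (fun k => pd k (fun z => u (pt x z)) y) i

theorem gradSq_nonneg (u : S → ℂ) (p : S) : 0 ≤ gradSq σ u p := by
  have hM := (gram_posDef σ (ctr_mem p)).inv
  have h : ∀ a : Fin n → ℝ, 0 ≤ ∑ k, ∑ l, gramInv σ p (ctr p) k l * (a k * a l) := fun a => by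
    have h2 := hM.posSemidef.dotProduct_mulVec_nonneg a
    simp only [dotProduct, Matrix.mulVec, Pi.star_apply, star_trivial, Finset.mul_sum] at h2
    refine h2.trans (le_of_eq ?_)
    exact Finset.sum_congr rfl fun k _ => Finset.sum_congr rfl fun l _ => by
      rw [gramInv]; ring
  rw [gradSq, re_sum_mul_conj]
  exact add_nonneg (h _) (h _)

theorem norm_fderiv_sq_le_gradSq {u : S → ℂ} (hu : ContMDiff (𝓡 n) 𝓘(ℝ, ℂ) ∞ u) {x : S}
    {y : EuclideanSpace ℝ (Fin n)} (hy : y ∈ chartTgt n x) :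
    ‖fderiv ℝ (fun z => u (pt x z)) y‖ ^ 2
      ≤ (n * ∑ i, gram σ x y i i) * gradSq σ u (pt x y) := by
  refine (norm_fderiv_sq_le _ y).trans ?_
  rw [mul_assoc, Finset.sum_mul]
  exact mul_le_mul_of_nonneg_left (Finset.sum_le_sum fun i _ => norm_pd_sq_le hu hy i)
    (Nat.cast_nonneg n)

theorem gradDot_conj (u v : S → ℂ) (p : S) :
    (starRingEnd ℂ) (gradDot σ u v p)
      = gradDot σ (fun q => (starRingEnd ℂ) (u q)) (fun q => (starRingEnd ℂ) (v q)) p := by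
  simp only [gradDot, pd_conj, map_mul, map_sum, Complex.conj_ofReal, Complex.real_smul]

theorem gradDot_comm (u v : S → ℂ) (p : S) : gradDot σ u v p = gradDot σ v u p := by
  have hs : ∀ i j, gramInv σ p (ctr p) i j = gramInv σ p (ctr p) j i := fun i j => by
    have := congrFun (congrFun (gram_posDef σ (ctr_mem p)).inv.1 j) i
    rw [Matrix.conjTranspose_apply, star_trivial] at this
    exact this
  simp only [gradDot]
  rw [Finset.sum_comm]
  exact Finset.sum_congr rfl fun i _ => Finset.sum_congr rfl fun j _ => by
    rw [hs, mul_comm]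

end Gradient

/-! ### Control of the square norm by finitely many means -/

section Compactness

open scoped ENNReal NNReal

variable {n : ℕ} {S : Type*} [TopologicalSpace S] [ChartedSpace (EuclideanSpace ℝ (Fin n)) S]

/-- The subset of the manifold with coordinates in `B` in the preferred chart around `x`. -/
def chartSet (x : S) (B : Set (EuclideanSpace ℝ (Fin n))) : Set S :=
  chartDom n x ∩ chartAt (EuclideanSpace ℝ (Fin n)) x ⁻¹' B

theorem chartTgt_inter_preimage_chartSet {x : S} {B : Set (EuclideanSpace ℝ (Fin n))}
    (hB : B ⊆ chartTgt n x) : chartTgt n x ∩ pt x ⁻¹' chartSet x B = B := by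
  ext y
  constructor
  · rintro ⟨hy, h⟩
    have := h.2
    rwa [Set.mem_preimage, chart_pt hy] at this
  · intro hy
    refine ⟨hB hy, pt_mem (hB hy), ?_⟩
    rwa [Set.mem_preimage, chart_pt (hB hy)]

variable [IsManifold (𝓡 n) ∞ S] (σ : Metric n S) [MeasurableSpace S] [BorelSpace S]

omit [IsManifold (𝓡 n) ∞ S] in
theorem measurableSet_chartSet (x : S) {B : Set (EuclideanSpace ℝ (Fin n))}
    (hB : MeasurableSet B) : MeasurableSet (chartSet x B) := by
  have h1 : Measurable fun p : chartDom n x => chartAt (EuclideanSpace ℝ (Fin n)) x (p : S) :=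
    (continuousOn_iff_continuous_domRestrict.1
      (chartAt (EuclideanSpace ℝ (Fin n)) x).continuousOn).measurable
  have h2 := ((isOpen_chartDom x).measurableSet).subtype_image (h1 hB)
  convert h2 using 1
  ext p
  simp [chartSet, and_comm]

/-- Integration over a part of a chart domain, in coordinates. -/
theorem setLIntegral_chartSet {x : S} {B : Set (EuclideanSpace ℝ (Fin n))} (hB : B ⊆ chartTgt n x)
    (hBm : MeasurableSet B) {F : S → ℝ≥0∞} (hF : Measurable F) :
    ∫⁻ p in chartSet x B, F p ∂(vol σ)
      = ∫⁻ y in B, ENNReal.ofReal (density σ x y) * F (pt x y) := by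
  have hN := measurableSet_chartSet (n := n) x hBm
  have h1 : (vol σ).restrict (chartSet x B) = (chartVol σ x).restrict (chartSet x B) := by
    have hsub : chartSet x B ∩ chartDom n x = chartSet x B :=
      Set.inter_eq_left.2 Set.inter_subset_left
    rw [← vol_restrict_dom, Measure.restrict_restrict hN, hsub]
  rw [h1, ← lintegral_indicator hN, chartVol,
    lintegral_map' (hF.indicator hN).aemeasurable (aemeasurable_pt σ x),
    lintegral_withDensity_eq_lintegral_mul₀ (aemeasurable_density σ x)
      (g := fun y => (chartSet x B).indicator F (pt x y)) ((hF.indicator hN).comp_aemeasurable ((continuousOn_pt x).aemeasurable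
        (isOpen_chartTgt x).measurableSet)),
    ← lintegral_indicator (isOpen_chartTgt x).measurableSet, ← lintegral_indicator hBm]
  refine lintegral_congr fun y => ?_
  by_cases hy : y ∈ B
  · have h2 : pt x y ∈ chartSet x B := by
      rw [← chartTgt_inter_preimage_chartSet hB] at hy
      exact hy.2
    rw [Set.indicator_of_mem hy, Set.indicator_of_mem (hB hy), Pi.mul_apply,
      Set.indicator_of_mem h2]
  · rw [Set.indicator_of_notMem hy]
    by_cases hyt : y ∈ chartTgt n x
    · have h2 : pt x y ∉ chartSet x B := fun h => by
        apply hy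
        rw [← chartTgt_inter_preimage_chartSet hB]
        exact ⟨hyt, h⟩
      rw [Set.indicator_of_mem hyt, Pi.mul_apply, Set.indicator_of_notMem h2, mul_zero]
    · rw [Set.indicator_of_notMem hyt]

variable {σ}

/-- Poincaré's inequality on a convex part of a chart domain. -/
theorem poincare_chartSet {x : S} {B : Set (EuclideanSpace ℝ (Fin n))} (hB : B ⊆ chartTgt n x)
    (hBm : MeasurableSet B) (hBc : Convex ℝ B) {r₀ r₁ K d : ℝ≥0} (hr₀ : 0 < r₀)
    (h₀ : ∀ y ∈ B, (r₀ : ℝ) ≤ density σ x y) (h₁ : ∀ y ∈ B, density σ x y ≤ r₁)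
    (hd : ∀ y ∈ B, ∀ z ∈ B, ‖y - z‖ₑ ≤ d) (hfin : vol σ (chartSet x B) ≠ ⊤)
    {u : S → ℂ} (hu : ContMDiff (𝓡 n) 𝓘(ℝ, ℂ) ∞ u)
    (hint : IntegrableOn u (chartSet x B) (vol σ))
    (hK : ∀ y ∈ B, ‖fderiv ℝ (fun z => u (pt x z)) y‖ ^ 2 ≤ K * gradSq σ u (pt x y)) :
    ∫⁻ p in chartSet x B, ‖u p‖ₑ ^ 2 ∂(vol σ)
      ≤ (2 * (vol σ (chartSet x B)).toNNReal⁻¹ : ℝ≥0) * ‖∫ p in chartSet x B, u p ∂(vol σ)‖ₑ ^ 2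
        + (2 * r₁ ^ 2 * d ^ 2 * 2 ^ n * K / r₀ ^ 2 : ℝ≥0) *
          ∫⁻ p in chartSet x B, ENNReal.ofReal (gradSq σ u p) ∂(vol σ) := by
  set N := chartSet x B with hN
  have hNm : MeasurableSet N := measurableSet_chartSet x hBm
  by_cases hV0 : vol σ N = 0
  · rw [Measure.restrict_eq_zero.2 hV0]
    simp
  set I := ‖∫ p in N, u p ∂(vol σ)‖ₑ with hI
  set D := ∫⁻ p in N, ENNReal.ofReal (gradSq σ u p) ∂(vol σ) with hD
  set V : ℝ≥0 := (vol σ N).toNNReal with hVdef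
  have hV : vol σ N = V := (ENNReal.coe_toNNReal hfin).symm
  have hVpos : V ≠ 0 := fun h => hV0 (by rw [hV, h, ENNReal.coe_zero])
  have hfinN : IsFiniteMeasure ((vol σ).restrict N) :=
    ⟨by rw [Measure.restrict_apply_univ]; exact hfin.lt_top⟩
  have hum : Measurable u := hu.continuous.measurable
  have h1 := lintegral_sq_le_mean_add_oscillation ((vol σ).restrict N) hum hint
  rw [Measure.restrict_apply_univ, ← hI, hV] at h1
  have hρ₀ : ∀ y ∈ B, (r₀ : ℝ≥0∞) ≤ ENNReal.ofReal (density σ x y) := fun y hy => by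
    rw [← ENNReal.ofReal_coe_nnreal]; exact ENNReal.ofReal_le_ofReal (h₀ y hy)
  have hρ₁ : ∀ y ∈ B, ENNReal.ofReal (density σ x y) ≤ r₁ := fun y hy => by
    rw [← ENNReal.ofReal_coe_nnreal]; exact ENNReal.ofReal_le_ofReal (h₁ y hy)
  have hup : ∀ {F : S → ℝ≥0∞}, Measurable F →
      ∫⁻ p in N, F p ∂(vol σ) ≤ r₁ * ∫⁻ y in B, F (pt x y) := fun {F} hF => by
    rw [setLIntegral_chartSet σ hB hBm hF, ← lintegral_const_mul' _ _ ENNReal.coe_ne_top]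
    exact setLIntegral_mono' hBm fun y hy => by gcongr; exact hρ₁ y hy
  have hlow : ∀ {F : S → ℝ≥0∞}, Measurable F →
      r₀ * ∫⁻ y in B, F (pt x y) ≤ ∫⁻ p in N, F p ∂(vol σ) := fun {F} hF => by
    rw [setLIntegral_chartSet σ hB hBm hF, ← lintegral_const_mul' _ _ ENNReal.coe_ne_top]
    exact setLIntegral_mono' hBm fun y hy => by gcongr; exact hρ₀ y hy
  have hm2 : ∀ q, Measurable fun p => ‖u q - u p‖ₑ ^ 2 := fun q =>
    ((measurable_const.sub hum).enorm).pow_const 2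
  have hm3 : Measurable fun q => ∫⁻ p in N, ‖u q - u p‖ₑ ^ 2 ∂(vol σ) :=
    Measurable.lintegral_prod_right' (f := fun z : S × S => ‖u z.1 - u z.2‖ₑ ^ 2)
      ((((hum.comp measurable_fst).sub (hum.comp measurable_snd)).enorm).pow_const 2)
  have h2 : ∫⁻ q in N, ∫⁻ p in N, ‖u q - u p‖ₑ ^ 2 ∂(vol σ) ∂(vol σ)
      ≤ r₁ ^ 2 * ∫⁻ y in B, ∫⁻ z in B, ‖u (pt x y) - u (pt x z)‖ₑ ^ 2 := by
    refine (hup hm3).trans ?_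
    rw [sq, mul_assoc]
    refine mul_le_mul_right ?_ _
    rw [← lintegral_const_mul' (r₁ : ℝ≥0∞) _ ENNReal.coe_ne_top]
    exact lintegral_mono fun y => hup (hm2 _)
  have h3 : ∫⁻ y in B, ∫⁻ z in B, ‖u (pt x y) - u (pt x z)‖ₑ ^ 2
      ≤ d ^ 2 * (2 ^ n * (volume B * ∫⁻ z in B, ‖fderiv ℝ (fun z => u (pt x z)) z‖ₑ ^ 2)) :=
    oscillation_le (f := fun z => u (pt x z)) hBc hBm
      (fun z hz => (contDiffAt_comp_pt hu (hB hz)).of_le ENat.LEInfty.out) ENNReal.coe_ne_top hd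
  have h4 : ∫⁻ z in B, ‖fderiv ℝ (fun z => u (pt x z)) z‖ₑ ^ 2
      ≤ K * ∫⁻ z in B, ENNReal.ofReal (gradSq σ u (pt x z)) := by
    rw [← lintegral_const_mul' _ _ ENNReal.coe_ne_top]
    refine setLIntegral_mono' hBm fun y hy => ?_
    rw [← ofReal_norm, ← ENNReal.ofReal_pow (norm_nonneg _), ← ENNReal.ofReal_coe_nnreal,
      ← ENNReal.ofReal_mul K.coe_nonneg]
    exact ENNReal.ofReal_le_ofReal (hK y hy)
  have h5 : r₀ * ∫⁻ z in B, ENNReal.ofReal (gradSq σ u (pt x z)) ≤ D :=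
    hlow ((continuous_gradSq hu).measurable.ennreal_ofReal)
  have h6 : r₀ * volume B ≤ V := by
    have := hlow (F := fun _ => 1) measurable_const
    simpa [← hV] using this
  have h7 : (r₀ : ℝ≥0∞) ^ 2 * ∫⁻ q in N, ∫⁻ p in N, ‖u q - u p‖ₑ ^ 2 ∂(vol σ) ∂(vol σ)
      ≤ r₁ ^ 2 * d ^ 2 * 2 ^ n * K * (V * D) := by
    calc (r₀ : ℝ≥0∞) ^ 2 * ∫⁻ q in N, ∫⁻ p in N, ‖u q - u p‖ₑ ^ 2 ∂(vol σ) ∂(vol σ)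
        ≤ (r₀ : ℝ≥0∞) ^ 2 * (r₁ ^ 2 * (d ^ 2 * (2 ^ n * (volume B *
            (K * ∫⁻ z in B, ENNReal.ofReal (gradSq σ u (pt x z))))))) := by
          gcongr
          exact h2.trans (by gcongr; exact h3.trans (by gcongr))
      _ = r₁ ^ 2 * d ^ 2 * 2 ^ n * K * ((r₀ * volume B) *
            (r₀ * ∫⁻ z in B, ENNReal.ofReal (gradSq σ u (pt x z)))) := by ring
      _ ≤ _ := by gcongr
  have hr₀' : (r₀ : ℝ≥0∞) ≠ 0 := by exact_mod_cast hr₀.ne'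
  have hc : (r₀ : ℝ≥0∞) ^ 2 * V ≠ 0 := mul_ne_zero (pow_ne_zero _ hr₀') (by exact_mod_cast hVpos)
  have hct : (r₀ : ℝ≥0∞) ^ 2 * V ≠ ⊤ := by finiteness
  rw [← ENNReal.mul_le_mul_iff_right hc hct]
  have e1 : (r₀ : ℝ≥0∞) ^ 2 * V * ((2 * V⁻¹ : ℝ≥0) : ℝ≥0∞) = 2 * (r₀ : ℝ≥0∞) ^ 2 := by
    norm_cast
    field_simp
  have e2 : (r₀ : ℝ≥0∞) ^ 2 * V * ((2 * r₁ ^ 2 * d ^ 2 * 2 ^ n * K / r₀ ^ 2 : ℝ≥0) : ℝ≥0∞)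
      = 2 * (r₁ ^ 2 * d ^ 2 * 2 ^ n * K * V) := by
    norm_cast
    field_simp
  calc (r₀ : ℝ≥0∞) ^ 2 * V * ∫⁻ p in N, ‖u p‖ₑ ^ 2 ∂(vol σ)
      = (r₀ : ℝ≥0∞) ^ 2 * (V * ∫⁻ p in N, ‖u p‖ₑ ^ 2 ∂(vol σ)) := by ring
    _ ≤ (r₀ : ℝ≥0∞) ^ 2 * (2 * I ^ 2
          + 2 * ∫⁻ q in N, ∫⁻ p in N, ‖u q - u p‖ₑ ^ 2 ∂(vol σ) ∂(vol σ)) := by gcongr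
    _ = 2 * (r₀ : ℝ≥0∞) ^ 2 * I ^ 2 + 2 * ((r₀ : ℝ≥0∞) ^ 2 *
          ∫⁻ q in N, ∫⁻ p in N, ‖u q - u p‖ₑ ^ 2 ∂(vol σ) ∂(vol σ)) := by ring
    _ ≤ 2 * (r₀ : ℝ≥0∞) ^ 2 * I ^ 2 + 2 * (r₁ ^ 2 * d ^ 2 * 2 ^ n * K * (V * D)) := by gcongr
    _ = _ := by
      rw [mul_add, ← mul_assoc _ _ (I ^ 2), e1,
        ← mul_assoc ((r₀ : ℝ≥0∞) ^ 2 * V) _ D, e2]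
      ring

/-- The half-open cubes of side `h`. -/
def cell (h : ℝ) (c : Fin n → ℤ) : Set (EuclideanSpace ℝ (Fin n)) := {y | ∀ i, ⌊y i / h⌋ = c i}

theorem measurableSet_cell (h : ℝ) (c : Fin n → ℤ) : MeasurableSet (cell h c) := by
  have : cell h c = ⋂ i, {y : EuclideanSpace ℝ (Fin n) | ⌊y i / h⌋ = c i} := by
    ext y; simp [cell]
  rw [this]
  refine MeasurableSet.iInter fun i => ?_
  have hm : Measurable fun y : EuclideanSpace ℝ (Fin n) => ⌊y i / h⌋ :=
    Int.measurable_floor.comp ((EuclideanSpace.proj i : EuclideanSpace ℝ (Fin n) →L[ℝ] ℝ).measurable.div_const h)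
  exact hm (measurableSet_singleton _)

theorem convex_cell (h : ℝ) (c : Fin n → ℤ) : Convex ℝ (cell h c) := by
  intro y hy z hz a b ha hb hab i
  have h1 := Int.floor_eq_iff.1 (hy i)
  have h2 := Int.floor_eq_iff.1 (hz i)
  rw [Int.floor_eq_iff]
  have h3 : (a • y + b • z) i / h = a * (y i / h) + b * (z i / h) := by
    simp only [PiLp.add_apply, PiLp.smul_apply, smul_eq_mul]
    ring
  have := convex_Ico (𝕜 := ℝ) (c i : ℝ) (c i + 1) h1 h2 ha hb hab
  rw [h3]
  exact this

theorem norm_sub_le_of_mem_cell {h : ℝ} (hh : 0 < h) {c : Fin n → ℤ}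
    {y z : EuclideanSpace ℝ (Fin n)} (hy : y ∈ cell h c) (hz : z ∈ cell h c) :
    ‖y - z‖ ≤ n * h := by
  have h1 : ∀ i, ‖(y - z) i‖ ≤ h := fun i => by
    have h2 := Int.floor_eq_iff.1 (hy i)
    have h3 := Int.floor_eq_iff.1 (hz i)
    rw [le_div_iff₀ hh, div_lt_iff₀ hh] at h2 h3
    rw [PiLp.sub_apply, Real.norm_eq_abs, abs_le]
    constructor <;> nlinarith
  have h4 := map_eq_sum_bas (LinearMap.id (R := ℝ) (M := EuclideanSpace ℝ (Fin n))) (y - z)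
  simp only [LinearMap.id_apply] at h4
  rw [h4]
  refine (norm_sum_le _ _).trans ?_
  calc ∑ i, ‖(y - z) i • bas i‖ ≤ ∑ _i : Fin n, h := Finset.sum_le_sum fun i _ => by
        rw [norm_smul]
        simpa [bas] using h1 i
    _ = n * h := by simp

variable (σ) in
/-- The square integral over `s` of a smooth function is bounded by an arbitrarily small multiple
of its Dirichlet integral and by finitely many of its means. -/
def MeanBound (s : Set S) : Prop :=
  ∀ ε : ℝ≥0, 0 < ε → ∃ (κ : Type) (_ : Fintype κ) (N : κ → Set S) (C : κ → ℝ≥0),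
    (∀ k, MeasurableSet (N k)) ∧ ∀ u : S → ℂ, ContMDiff (𝓡 n) 𝓘(ℝ, ℂ) ∞ u →
      ∫⁻ p in s, ‖u p‖ₑ ^ 2 ∂(vol σ) ≤ ε * ∫⁻ p, ENNReal.ofReal (gradSq σ u p) ∂(vol σ)
        + ∑ k, C k * ‖∫ p in N k, u p ∂(vol σ)‖ₑ ^ 2

omit [BorelSpace S] in
theorem meanBound_union {s t : Set S} (hs : MeanBound σ s) (ht : MeanBound σ t) :
    MeanBound σ (s ∪ t) := fun ε hε => by
  obtain ⟨κ, _, N, C, hN, h⟩ := hs (ε / 2) (half_pos hε)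
  obtain ⟨κ', _, N', C', hN', h'⟩ := ht (ε / 2) (half_pos hε)
  refine ⟨κ ⊕ κ', inferInstance, Sum.elim N N', Sum.elim C C', ?_, fun u hu => ?_⟩
  · rintro (k | k)
    exacts [hN k, hN' k]
  · refine (lintegral_union_le _ _ _).trans ((add_le_add (h u hu) (h' u hu)).trans (le_of_eq ?_))
    simp only [Fintype.sum_sum_type, Sum.elim_inl, Sum.elim_inr]
    rw [add_add_add_comm, ← add_mul, ← ENNReal.coe_add, add_halves]

variable [CompactSpace S]

/-- Near a point, the constant of Poincaré's inequality on a cube is proportional to the square of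
the side, so subdividing a coordinate ball into small cubes makes the gradient term small. -/
theorem exists_meanBound_nhds (x : S) : ∃ t ∈ 𝓝 x, MeanBound σ t := by
  obtain ⟨r', hr', hball⟩ := Metric.isOpen_iff.1 (isOpen_chartTgt (n := n) x) _ (ctr_mem x)
  set r := r' / 2 with hr_def
  have hr : 0 < r := half_pos hr'
  set Q := Metric.closedBall (ctr x : EuclideanSpace ℝ (Fin n)) r with hQ
  have hQt : Q ⊆ chartTgt n x :=
    (Metric.closedBall_subset_ball (half_lt_self hr')).trans hball
  have hQc : IsCompact Q := isCompact_closedBall _ _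
  have hQm : MeasurableSet Q := hQc.measurableSet
  have hQne : Q.Nonempty := ⟨ctr x, Metric.mem_closedBall_self hr.le⟩
  refine ⟨chartSet x Q, ?_, fun ε hε => ?_⟩
  · refine Filter.inter_mem ((isOpen_chartDom x).mem_nhds (mem_chartDom x)) ?_
    exact ((chartAt (EuclideanSpace ℝ (Fin n)) x).continuousAt (mem_chartDom x)).preimage_mem_nhds
      (Metric.closedBall_mem_nhds _ hr)
  -- bounds for the coefficients on the compact ball
  have hρ : ContinuousOn (density σ x) Q := (continuousOn_density σ x).mono hQt
  obtain ⟨y₀, hy₀, hmin⟩ := hQc.exists_isMinOn hQne hρ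
  obtain ⟨y₁, hy₁, hmax⟩ := hQc.exists_isMaxOn hQne hρ
  have htr : ContinuousOn (fun y => (n : ℝ) * ∑ i, gram σ x y i i) Q := fun y hy =>
    ContinuousAt.continuousWithinAt (continuousAt_const.mul (tendsto_finsetSum _ fun i _ =>
      (contDiffAt_gram σ (hQt hy) i i).continuousAt))
  obtain ⟨y₂, hy₂, hmaxK⟩ := hQc.exists_isMaxOn hQne htr
  set r₀ : ℝ≥0 := (density σ x y₀).toNNReal with hr₀
  set r₁ : ℝ≥0 := (density σ x y₁).toNNReal with hr₁
  set K : ℝ≥0 := ((n : ℝ) * ∑ i, gram σ x y₂ i i).toNNReal with hK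
  have hr₀pos : 0 < r₀ := Real.toNNReal_pos.2 (density_pos σ (hQt hy₀))
  have h₀ : ∀ y ∈ Q, (r₀ : ℝ) ≤ density σ x y := fun y hy => by
    rw [hr₀, Real.coe_toNNReal _ (density_pos σ (hQt hy₀)).le]
    exact hmin hy
  have h₁ : ∀ y ∈ Q, density σ x y ≤ r₁ := fun y hy => (hmax hy).trans (Real.le_coe_toNNReal _)
  have hKb : ∀ u : S → ℂ, ContMDiff (𝓡 n) 𝓘(ℝ, ℂ) ∞ u → ∀ y ∈ Q,
      ‖fderiv ℝ (fun z => u (pt x z)) y‖ ^ 2 ≤ K * gradSq σ u (pt x y) := fun u hu y hy =>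
    (norm_fderiv_sq_le_gradSq (σ := σ) hu (hQt hy)).trans (mul_le_mul_of_nonneg_right
      ((hmaxK hy).trans (Real.le_coe_toNNReal _)) (gradSq_nonneg u _))
  -- the constant of the inequality on a cube of side `h` is at most `L * h ^ 2`
  set L : ℝ≥0 := 2 * r₁ ^ 2 * 2 ^ n * K / r₀ ^ 2 * n ^ 2 with hL
  set h : ℝ≥0 := NNReal.sqrt (ε / (L + 1)) with hh
  have hhpos : 0 < h := NNReal.sqrt_pos.2 (div_pos hε (by positivity))
  have hLh : 2 * r₁ ^ 2 * (n * h) ^ 2 * 2 ^ n * K / r₀ ^ 2 ≤ ε := by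
    have h2 : h ^ 2 = ε / (L + 1) := NNReal.sq_sqrt _
    calc 2 * r₁ ^ 2 * (n * h) ^ 2 * 2 ^ n * K / r₀ ^ 2 = L * h ^ 2 := by rw [hL]; ring
      _ ≤ (L + 1) * h ^ 2 := by gcongr; exact le_add_of_nonneg_right zero_le_one
      _ = ε := by rw [h2]; field_simp
  -- finitely many cubes meet the ball
  obtain ⟨R, hR⟩ := hQc.isBounded.exists_norm_le
  set I : Finset (Fin n → ℤ) := Fintype.piFinset fun _ => Finset.Icc ⌊-R / h⌋ ⌊R / h⌋ with hI
  have hhR : (0 : ℝ) < h := hhpos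
  have hcover : Q = ⋃ c ∈ I, (Q ∩ cell (h : ℝ) c) := by
    ext y
    simp only [Set.mem_iUnion, Set.mem_inter_iff, exists_prop]
    refine ⟨fun hy => ⟨fun i => ⌊y i / h⌋, ?_, hy, fun i => rfl⟩, fun ⟨c, _, hy, _⟩ => hy⟩
    rw [hI, Fintype.mem_piFinset]
    intro i
    have h3 : |y i| ≤ R := (PiLp.norm_apply_le y i).trans (hR y hy)
    rw [abs_le] at h3
    exact Finset.mem_Icc.2 ⟨Int.floor_mono (by gcongr; exact h3.1),
      Int.floor_mono (by gcongr; exact h3.2)⟩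
  set N : (Fin n → ℤ) → Set S := fun c => chartSet x (Q ∩ cell (h : ℝ) c) with hN
  have hNm : ∀ c, MeasurableSet (N c) := fun c =>
    measurableSet_chartSet x (hQm.inter (measurableSet_cell _ c))
  have hNcover : chartSet x Q = ⋃ c ∈ I, N c := by
    conv_lhs => rw [hcover]
    simp only [chartSet, hN, Set.preimage_iUnion, Set.inter_iUnion]
  have hdisj : Set.PairwiseDisjoint (I : Set (Fin n → ℤ)) N := fun c _ c' _ hcc' => by
    rw [Function.onFun, Set.disjoint_left]
    rintro p ⟨_, _, hp⟩ ⟨_, _, hp'⟩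
    exact hcc' (funext fun i => (hp i).symm.trans (hp' i))
  have hunion : ∀ F : S → ℝ≥0∞, ∫⁻ p in chartSet x Q, F p ∂(vol σ)
      = ∑ c ∈ I, ∫⁻ p in N c, F p ∂(vol σ) := fun F => by
    rw [hNcover, lintegral_biUnion_finset hdisj fun c _ => hNm c]
  refine ⟨I, inferInstance, fun c => N c, fun c => 2 * (vol σ (N c)).toNNReal⁻¹, fun c => hNm c,
    fun u hu => ?_⟩
  have hcell : ∀ c ∈ I, ∫⁻ p in N c, ‖u p‖ₑ ^ 2 ∂(vol σ)
      ≤ (2 * (vol σ (N c)).toNNReal⁻¹ : ℝ≥0) * ‖∫ p in N c, u p ∂(vol σ)‖ₑ ^ 2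
        + ε * ∫⁻ p in N c, ENNReal.ofReal (gradSq σ u p) ∂(vol σ) := fun c _ => by
    refine (poincare_chartSet (σ := σ) (r₀ := r₀) (r₁ := r₁) (K := K) (d := n * h)
      (Set.inter_subset_left.trans hQt) (hQm.inter (measurableSet_cell _ c))
      ((convex_closedBall _ _).inter (convex_cell _ c)) hr₀pos (fun y hy => h₀ y hy.1)
      (fun y hy => h₁ y hy.1) (fun y hy z hz => ?_) (measure_ne_top _ _) hu
      (hu.continuous.integrable_of_hasCompactSupport
        (HasCompactSupport.of_compactSpace _)).integrableOn
      (fun y hy => hKb u hu y hy.1)).trans ?_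
    · have h5 := norm_sub_le_of_mem_cell hhR hy.2 hz.2
      rw [← ofReal_norm, ← ENNReal.ofReal_coe_nnreal]
      exact ENNReal.ofReal_le_ofReal (by push_cast; exact h5)
    · gcongr
  rw [hunion]
  refine (Finset.sum_le_sum hcell).trans ?_
  rw [Finset.sum_add_distrib, add_comm, ← Finset.mul_sum, ← hunion]
  refine add_le_add ?_ (le_of_eq ?_)
  · exact mul_le_mul_right (setLIntegral_le_lintegral _ _) _
  · exact (Finset.sum_coe_sort I fun c => ((2 * (vol σ (N c)).toNNReal⁻¹ : ℝ≥0) : ℝ≥0∞)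
      * ‖∫ p in N c, u p ∂(vol σ)‖ₑ ^ 2).symm

variable (σ) in
theorem meanBound_univ : MeanBound σ (Set.univ : Set S) := by
  refine isCompact_univ.induction_on (p := MeanBound σ) ?_ ?_ ?_ ?_
  · intro ε _
    exact ⟨Empty, inferInstance, fun _ => ∅, fun _ => 0, fun k => k.elim, fun u _ => by simp⟩
  · intro s t hst ht ε hε
    obtain ⟨κ, hκ, N, C, hN, h⟩ := ht ε hε
    exact ⟨κ, hκ, N, C, hN, fun u hu => (lintegral_mono_set hst).trans (h u hu)⟩
  · exact fun s t hs ht => meanBound_union hs ht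
  · intro x _
    obtain ⟨t, ht, h⟩ := exists_meanBound_nhds (σ := σ) x
    exact ⟨t, mem_nhdsWithin_of_mem_nhds ht, h⟩

end Compactness

/-! ### Semibounded symmetric operators -/

section Spectral

open Filter

variable {H : Type*} [NormedAddCommGroup H] [InnerProductSpace ℂ H] {D : Type*} [AddCommGroup D]
  [Module ℂ D]

/-- The quadratic form `Re ⟨j u, T u⟩` of an operator `T` defined on a space `D` which is mapped
to the Hilbert space `H` by `j`. -/
noncomputable def qform (j T : D →ₗ[ℂ] H) (u : D) : ℝ := (inner ℂ (j u) (T u)).re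

variable {j T T₀ : D →ₗ[ℂ] H}

theorem qform_smul (s : ℂ) (u : D) : qform j T (s • u) = ‖s‖ ^ 2 * qform j T u := by
  simp only [qform, map_smul, inner_smul_left, inner_smul_right]
  rw [← mul_assoc, Complex.mul_conj, Complex.re_ofReal_mul, Complex.normSq_eq_norm_sq]

theorem qform_sub_le (h0 : ∀ u, 0 ≤ qform j T u) (u w : D) :
    qform j T (u - w) ≤ 2 * qform j T u + 2 * qform j T w := by
  have h1 : qform j T (u + w) + qform j T (u - w) = 2 * qform j T u + 2 * qform j T w := by
    simp only [qform, map_add, map_sub, inner_add_left, inner_add_right, inner_sub_left,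
      inner_sub_right, Complex.add_re, Complex.sub_re]
    ring
  linarith [h0 (u + w)]

theorem qform_add_smul (hs : ∀ u w, inner ℂ (T u) (j w) = inner ℂ (j u) (T w)) (u φ : D) (s : ℂ) :
    qform j T (u + s • φ)
      = qform j T u + 2 * (s * inner ℂ (j u) (T φ)).re + ‖s‖ ^ 2 * qform j T φ := by
  have h1 : inner ℂ (j φ) (T u) = (starRingEnd ℂ) (inner ℂ (j u) (T φ)) := by
    rw [← hs, inner_conj_symm]
  rw [← qform_smul]
  simp only [qform, map_add, map_smul, inner_add_left, inner_add_right, inner_smul_left,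
    inner_smul_right, h1, mul_add, Complex.add_re]
  rw [← map_mul, Complex.conj_re]
  ring

theorem qform_sub_real_smul (lam : ℝ) (u : D) :
    qform j (T - (lam : ℂ) • j) u = qform j T u - lam * ‖j u‖ ^ 2 := by
  simp only [qform, LinearMap.sub_apply, LinearMap.smul_apply, inner_sub_right, inner_smul_right,
    Complex.sub_re, Complex.re_ofReal_mul]
  rw [← inner_self_eq_norm_sq (𝕜 := ℂ)]
  rfl

theorem qform_eq_zero {u : D} (h : j u = 0) : qform j T u = 0 := by simp [qform, h]

/-- Sequences which are bounded together with the form of `T₀` have convergent subsequences. -/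
def IsRellich (j T₀ : D →ₗ[ℂ] H) : Prop :=
  ∀ (M : ℝ) (u : ℕ → D), (∀ k, ‖j (u k)‖ ≤ M) → (∀ k, qform j T₀ (u k) ≤ M) →
    ∃ v : H, ∃ ψ : ℕ → ℕ, StrictMono ψ ∧ Tendsto (fun k => j (u (ψ k))) atTop (𝓝 v)

theorem eq_zero_of_forall_re_nonneg {z : ℂ} {e : ℝ} (he : 0 ≤ e)
    (h : ∀ s : ℂ, 0 ≤ 2 * (s * z).re + ‖s‖ ^ 2 * e) : z = 0 := by
  by_contra hz
  have hz' : 0 < ‖z‖ ^ 2 := by positivity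
  have h1 := h (-((1 / (e + 1) : ℝ) : ℂ) * (starRingEnd ℂ) z)
  have h2 : (-((1 / (e + 1) : ℝ) : ℂ) * (starRingEnd ℂ) z * z).re = -(1 / (e + 1)) * ‖z‖ ^ 2 := by
    rw [mul_assoc, ← Complex.normSq_eq_conj_mul_self, Complex.normSq_eq_norm_sq]
    norm_cast
  have h3 : ‖-((1 / (e + 1) : ℝ) : ℂ) * (starRingEnd ℂ) z‖ = (1 / (e + 1)) * ‖z‖ := by
    rw [norm_mul, norm_neg, Complex.norm_real, Real.norm_of_nonneg (by positivity),
      RCLike.norm_conj]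
  rw [h2, h3] at h1
  have h4 : 2 * (-(1 / (e + 1)) * ‖z‖ ^ 2) + (1 / (e + 1) * ‖z‖) ^ 2 * e
      = -(‖z‖ ^ 2 * (e + 2) / (e + 1) ^ 2) := by
    field_simp
    ring
  rw [h4] at h1
  have : 0 < ‖z‖ ^ 2 * (e + 2) / (e + 1) ^ 2 := by positivity
  linarith

theorem exists_norm_one_of_ne_zero {u : D} (hu : j u ≠ 0) :
    ∃ w : D, ‖j w‖ = 1 ∧ ∀ T : D →ₗ[ℂ] H, qform j T u = ‖j u‖ ^ 2 * qform j T w := by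
  have h0 : ‖j u‖ ≠ 0 := norm_ne_zero_iff.2 hu
  refine ⟨((‖j u‖⁻¹ : ℝ) : ℂ) • u, ?_, fun T => ?_⟩
  · rw [map_smul, norm_smul, Complex.norm_real, norm_inv, norm_norm, inv_mul_cancel₀ h0]
  · rw [qform_smul, Complex.norm_real, norm_inv, norm_norm]
    field_simp

/-- The bottom of the spectrum of a semibounded symmetric operator with the Rellich property is an
eigenvalue: a minimizing sequence converges. -/
theorem exists_ground_state (hs : ∀ u w, inner ℂ (T u) (j w) = inner ℂ (j u) (T w)) {κ Λ : ℝ}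
    (hκ : 0 < κ) (hT : ∀ u, |qform j T u - κ * qform j T₀ u| ≤ Λ * ‖j u‖ ^ 2)
    (h₀ : ∀ u, 0 ≤ qform j T₀ u) (hR : IsRellich j T₀) (hne : ∃ u, j u ≠ 0) :
    ∃ (lam : ℝ) (v : H) (u : ℕ → D), (∀ w, lam * ‖j w‖ ^ 2 ≤ qform j T w) ∧
      (∀ c, (∀ w, c * ‖j w‖ ^ 2 ≤ qform j T w) → c ≤ lam) ∧ ‖v‖ = 1 ∧
      Tendsto (fun k => j (u k)) atTop (𝓝 v) ∧
      (∀ ε : ℝ, 0 < ε → ∃ K : ℕ, ∀ k ≥ K, ∀ l ≥ K, qform j T₀ (u k - u l) < ε) ∧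
      ∀ φ, inner ℂ (T φ) v = (lam : ℂ) * inner ℂ (j φ) v := by
  set R : Set ℝ := {r | ∃ w, ‖j w‖ = 1 ∧ qform j T w = r} with hRdef
  have hlow : ∀ r ∈ R, -Λ ≤ r := by
    rintro r ⟨w, hw, rfl⟩
    have h1 := (abs_le.1 (hT w)).1
    rw [hw] at h1
    nlinarith [h₀ w]
  have hbdd : BddBelow R := ⟨-Λ, hlow⟩
  have hRne : R.Nonempty := by
    obtain ⟨u, hu⟩ := hne
    obtain ⟨w, hw, _⟩ := exists_norm_one_of_ne_zero hu
    exact ⟨_, w, hw, rfl⟩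
  set lam := sInf R with hlam
  have hmin : ∀ w, lam * ‖j w‖ ^ 2 ≤ qform j T w := fun w => by
    by_cases hw : j w = 0
    · simp [qform_eq_zero hw, hw]
    · obtain ⟨w', hw', hq⟩ := exists_norm_one_of_ne_zero hw
      rw [hq, mul_comm]
      exact mul_le_mul_of_nonneg_left (csInf_le hbdd ⟨w', hw', rfl⟩) (sq_nonneg _)
  set P : D →ₗ[ℂ] H := T - (lam : ℂ) • j with hP
  have hPq : ∀ w, qform j P w = qform j T w - lam * ‖j w‖ ^ 2 := qform_sub_real_smul lam
  have hP0 : ∀ w, 0 ≤ qform j P w := fun w => by rw [hPq]; linarith [hmin w]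
  have hPs : ∀ u w, inner ℂ (P u) (j w) = inner ℂ (j u) (P w) := fun u w => by
    simp only [hP, LinearMap.sub_apply, LinearMap.smul_apply, inner_sub_left, inner_sub_right,
      inner_smul_left, inner_smul_right, hs, Complex.conj_ofReal]
  have hex : ∀ k : ℕ, ∃ w, ‖j w‖ = 1 ∧ qform j P w < 1 / ((k : ℝ) + 1) := fun k => by
    obtain ⟨r, ⟨w, hw, rfl⟩, hr⟩ := exists_lt_of_csInf_lt hRne
      (lt_add_of_pos_right lam (Nat.one_div_pos_of_nat (α := ℝ) (n := k)))
    refine ⟨w, hw, ?_⟩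
    rw [hPq, hw]
    linarith
  choose u hu1 hu2 using hex
  have hub : ∀ k, qform j T₀ (u k) ≤ (lam + 1 + Λ) / κ := fun k => by
    rw [le_div_iff₀ hκ]
    have h1 := (abs_le.1 (hT (u k))).1
    have h2 := hu2 k
    have h3 : 1 / ((k : ℝ) + 1) ≤ 1 := by
      rw [div_le_one (by positivity)]
      linarith [(Nat.cast_nonneg k : (0 : ℝ) ≤ k)]
    rw [hPq] at h2
    rw [hu1] at h1 h2
    linarith
  obtain ⟨v, ψ, hψ, hv⟩ := hR (max 1 ((lam + 1 + Λ) / κ)) u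
    (fun k => (hu1 k).le.trans (le_max_left _ _)) (fun k => (hub k).trans (le_max_right _ _))
  have hP_lim : Tendsto (fun k => qform j P (u (ψ k))) atTop (𝓝 0) := by
    refine squeeze_zero (fun k => hP0 _) (fun k => ?_) (tendsto_one_div_add_atTop_nhds_zero_nat (𝕜 := ℝ))
    refine (hu2 (ψ k)).le.trans ?_
    have : (k : ℝ) ≤ ψ k := by exact_mod_cast hψ.id_le k
    gcongr
  refine ⟨lam, v, fun k => u (ψ k), hmin, fun c hc => ?_, ?_, hv, fun ε hε => ?_, fun φ => ?_⟩
  · refine le_csInf hRne ?_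
    rintro r ⟨w, hw, rfl⟩
    simpa [hw] using hc w
  · have := hv.norm
    simp only [hu1] at this
    exact tendsto_nhds_unique this tendsto_const_nhds
  · -- the parallelogram inequality for the nonnegative form of `P` makes the sequence Cauchy
    have hbound : ∀ k l, qform j T₀ (u (ψ k) - u (ψ l)) ≤ κ⁻¹ * (2 * qform j P (u (ψ k))
        + 2 * qform j P (u (ψ l)) + (lam + Λ) * ‖j (u (ψ k)) - j (u (ψ l))‖ ^ 2) := fun k l => by
      have h1 := (abs_le.1 (hT (u (ψ k) - u (ψ l)))).1
      have h2 := qform_sub_le hP0 (u (ψ k)) (u (ψ l))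
      rw [hPq] at h2
      rw [le_inv_mul_iff₀ hκ, ← map_sub]
      linarith
    have hlim : Tendsto (fun q : ℕ × ℕ => κ⁻¹ * (2 * qform j P (u (ψ q.1))
        + 2 * qform j P (u (ψ q.2)) + (lam + Λ) * ‖j (u (ψ q.1)) - j (u (ψ q.2))‖ ^ 2))
        (atTop ×ˢ atTop) (𝓝 (κ⁻¹ * (2 * 0 + 2 * 0 + (lam + Λ) * ‖v - v‖ ^ 2))) :=
      ((((hP_lim.comp tendsto_fst).const_mul 2).add ((hP_lim.comp tendsto_snd).const_mul 2)).add
        ((((hv.comp tendsto_fst).sub (hv.comp tendsto_snd)).norm.pow 2).const_mul _)).const_mul _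
    rw [sub_self, norm_zero] at hlim
    norm_num at hlim
    have := hlim.eventually (gt_mem_nhds hε)
    rw [prod_atTop_atTop_eq] at this
    obtain ⟨K, hK⟩ := eventually_atTop_prod_self'.1 this
    exact ⟨K, fun k hk l hl => (hbound k l).trans_lt (hK k hk l hl)⟩
  · -- the first variation at the minimum vanishes
    have hz : inner ℂ v (P φ) = 0 := by
      refine eq_zero_of_forall_re_nonneg (hP0 φ) fun s => ?_
      have h1 : Tendsto (fun k => qform j P (u (ψ k)) + 2 * (s * inner ℂ (j (u (ψ k))) (P φ)).re
          + ‖s‖ ^ 2 * qform j P φ) atTop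
          (𝓝 (0 + 2 * (s * inner ℂ v (P φ)).re + ‖s‖ ^ 2 * qform j P φ)) := by
        have h2 : Tendsto (fun k => inner ℂ (j (u (ψ k))) (P φ)) atTop (𝓝 (inner ℂ v (P φ))) :=
          hv.inner tendsto_const_nhds
        exact (hP_lim.add (((Complex.continuous_re.tendsto _).comp
          (h2.const_mul s)).const_mul 2)).add tendsto_const_nhds
      rw [zero_add] at h1
      refine ge_of_tendsto' h1 fun k => ?_
      rw [← qform_add_smul hPs]
      exact hP0 _
    have hz' : inner ℂ (P φ) v = 0 := by rw [← inner_conj_symm, hz, map_zero]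
    rw [hP, LinearMap.sub_apply, LinearMap.smul_apply, inner_sub_left, inner_smul_left,
      Complex.conj_ofReal, sub_eq_zero] at hz'
    exact hz'

/-- A weak eigenvalue whose eigenvector is approximated in the form norm lies above every lower
bound of the quadratic form. -/
theorem le_of_weak_eigenvalue {κ Λ : ℝ}
    (hs : ∀ u w, inner ℂ (T u) (j w) = inner ℂ (j u) (T w)) (hκ : 0 < κ)
    (hT : ∀ u, |qform j T u - κ * qform j T₀ u| ≤ Λ * ‖j u‖ ^ 2) {lam μ : ℝ}
    (hmin : ∀ w, lam * ‖j w‖ ^ 2 ≤ qform j T w) {v : H} (hv0 : v ≠ 0) {u : ℕ → D}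
    (hv : Tendsto (fun k => j (u k)) atTop (𝓝 v))
    (hC : ∀ ε : ℝ, 0 < ε → ∃ K : ℕ, ∀ k ≥ K, ∀ l ≥ K, qform j T₀ (u k - u l) < ε)
    (hμ : ∀ φ, inner ℂ (T φ) v = (μ : ℂ) * inner ℂ (j φ) v) : lam ≤ μ := by
  set P : D →ₗ[ℂ] H := T - (lam : ℂ) • j with hP
  have hPq : ∀ w, qform j P w = qform j T w - lam * ‖j w‖ ^ 2 := qform_sub_real_smul lam
  have hP0 : ∀ w, 0 ≤ qform j P w := fun w => by rw [hPq]; linarith [hmin w]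
  have hPs : ∀ u w, inner ℂ (P u) (j w) = inner ℂ (j u) (P w) := fun u w => by
    simp only [hP, LinearMap.sub_apply, LinearMap.smul_apply, inner_sub_left, inner_sub_right,
      inner_smul_left, inner_smul_right, hs, Complex.conj_ofReal]
  have hPv : ∀ φ, inner ℂ (P φ) v = ((μ - lam : ℝ) : ℂ) * inner ℂ (j φ) v := fun φ => by
    rw [hP, LinearMap.sub_apply, LinearMap.smul_apply, inner_sub_left, inner_smul_left,
      Complex.conj_ofReal, hμ]
    push_cast
    ring
  -- By polarization and positivity `2 Re ⟨P u_k, u_l⟩` is bounded below by `-P(u_k - u_l)`, which tends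
  -- to zero. In the limit this gives `0 ≤ (μ - lam) * ‖v‖ ^ 2`.
  have hpol : ∀ k l, -(qform j P (u k - u l)) ≤ 2 * (inner ℂ (P (u k)) (j (u l))).re := fun k l => by
    have h1 := qform_add_smul hPs (u k) (u l) (-1)
    rw [neg_one_smul, ← sub_eq_add_neg, ← hPs] at h1
    simp only [neg_mul, one_mul, Complex.neg_re, norm_neg, norm_one, one_pow] at h1
    linarith [hP0 (u k), hP0 (u l)]
  have hlim : Tendsto (fun k => 2 * (inner ℂ (P (u k)) v).re) atTop
      (𝓝 (2 * ((μ - lam) * ‖v‖ ^ 2))) := by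
    have h1 : Tendsto (fun k => ((μ - lam : ℝ) : ℂ) * inner ℂ (j (u k)) v) atTop
        (𝓝 (((μ - lam : ℝ) : ℂ) * inner ℂ v v)) := (hv.inner tendsto_const_nhds).const_mul _
    have h2 := ((Complex.continuous_re.tendsto _).comp h1).const_mul 2
    rw [Complex.re_ofReal_mul] at h2
    simp only [hPv]
    have h3 : (inner ℂ v v).re = ‖v‖ ^ 2 := inner_self_eq_norm_sq (𝕜 := ℂ) v
    rwa [h3] at h2
  have hge : 0 ≤ 2 * ((μ - lam) * ‖v‖ ^ 2) := by
    refine le_of_forall_pos_le_add fun ε hε => ?_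
    obtain ⟨K, hK⟩ := hC (ε / (2 * κ)) (by positivity)
    have hsub : Tendsto (fun q : ℕ × ℕ => (|Λ| + |lam|) * ‖j (u q.1) - j (u q.2)‖ ^ 2)
        (atTop ×ˢ atTop) (𝓝 ((|Λ| + |lam|) * ‖v - v‖ ^ 2)) :=
      (((hv.comp tendsto_fst).sub (hv.comp tendsto_snd)).norm.pow 2).const_mul _
    rw [sub_self, norm_zero] at hsub
    norm_num at hsub
    have h4 := hsub.eventually (gt_mem_nhds (half_pos hε))
    rw [prod_atTop_atTop_eq] at h4
    obtain ⟨K', hK'⟩ := eventually_atTop_prod_self'.1 h4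
    have h5 : ∀ k ≥ max K K', ∀ l ≥ max K K', -ε ≤ 2 * (inner ℂ (P (u k)) (j (u l))).re := by
      intro k hk l hl
      have h6 := hK k ((le_max_left _ _).trans hk) l ((le_max_left _ _).trans hl)
      have h7 := hK' k ((le_max_right _ _).trans hk) l ((le_max_right _ _).trans hl)
      have h8 := (abs_le.1 (hT (u k - u l))).2
      have h9 := hpol k l
      rw [hPq] at h9
      rw [lt_div_iff₀ (by positivity)] at h6
      simp only [← map_sub] at h7
      have h10 := mul_le_mul_of_nonneg_right (le_abs_self Λ) (sq_nonneg ‖j (u k - u l)‖)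
      have h11 := mul_le_mul_of_nonneg_right (neg_abs_le lam) (sq_nonneg ‖j (u k - u l)‖)
      linarith
    have h6 : ∀ k ≥ max K K', -ε ≤ 2 * (inner ℂ (P (u k)) v).re := fun k hk => by
      have h7 : Tendsto (fun l => 2 * (inner ℂ (P (u k)) (j (u l))).re) atTop
          (𝓝 (2 * (inner ℂ (P (u k)) v).re)) :=
        ((Complex.continuous_re.tendsto _).comp (tendsto_const_nhds.inner hv)).const_mul 2
      refine ge_of_tendsto h7 ?_
      filter_upwards [eventually_ge_atTop (max K K')] with l hl using h5 k hk l hl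
    have h7 := ge_of_tendsto hlim
      ((eventually_ge_atTop (max K K')).mono fun k hk => h6 k hk)
    linarith
  have hvpos : 0 < ‖v‖ ^ 2 := by positivity
  nlinarith

/-- Adding a large multiple of a nonnegative form without kernel makes a semibounded form with the
Rellich property uniformly positive. -/
theorem exists_uniform_lower_bound {κ Λ : ℝ} (hκ : 0 < κ)
    (hT : ∀ u, |qform j T u - κ * qform j T₀ u| ≤ Λ * ‖j u‖ ^ 2)
    (h₀ : ∀ u, 0 ≤ qform j T₀ u) (hR : IsRellich j T₀) {W : H → ℝ} (hW : Continuous W)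
    (hW0 : ∀ x, 0 ≤ W x) (hW1 : ∀ x, W x = 0 → x = 0)
    (hWs : ∀ (r : ℝ) x, W ((r : ℂ) • x) = r ^ 2 * W x) :
    ∃ m₀ c : ℝ, 0 ≤ m₀ ∧ 0 < c ∧ ∀ m, m₀ ≤ m → ∀ u,
      c * ‖j u‖ ^ 2 ≤ qform j T u + m * W (j u) := by
  by_contra hcon
  push Not at hcon
  have hex : ∀ k : ℕ, ∃ w : D, ‖j w‖ = 1 ∧ qform j T w + k * W (j w) ≤ 1 := fun k => by
    obtain ⟨m, hm, u, hu⟩ := hcon k 1 (Nat.cast_nonneg k) one_pos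
    have hju : j u ≠ 0 := fun h => by
      have hW00 : W 0 = 0 := by simpa using hWs 0 0
      rw [qform_eq_zero h, h, hW00] at hu
      simp at hu
    have h0 : ‖j u‖ ≠ 0 := norm_ne_zero_iff.2 hju
    have hpos : 0 < ‖j u‖ ^ 2 := by positivity
    refine ⟨((‖j u‖⁻¹ : ℝ) : ℂ) • u, ?_, ?_⟩
    · rw [map_smul, norm_smul, Complex.norm_real, norm_inv, norm_norm, inv_mul_cancel₀ h0]
    · rw [qform_smul, map_smul, hWs, Complex.norm_real, norm_inv, norm_norm, inv_pow]
      have h1 : qform j T u + k * W (j u) ≤ ‖j u‖ ^ 2 := by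
        have := mul_le_mul_of_nonneg_right hm (hW0 (j u))
        linarith
      calc (‖j u‖ ^ 2)⁻¹ * qform j T u + k * ((‖j u‖ ^ 2)⁻¹ * W (j u))
          = (‖j u‖ ^ 2)⁻¹ * (qform j T u + k * W (j u)) := by ring
        _ ≤ (‖j u‖ ^ 2)⁻¹ * ‖j u‖ ^ 2 := by gcongr
        _ = 1 := inv_mul_cancel₀ hpos.ne'
  -- a sequence of unit vectors contradicting the claim has a limit, on which `W` vanishes
  choose u hu1 hu2 using hex
  have hb : ∀ k, -Λ ≤ qform j T (u k) - κ * qform j T₀ (u k) := fun k => by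
    have := (abs_le.1 (hT (u k))).1
    rwa [hu1, one_pow, mul_one] at this
  have hub : ∀ k, qform j T₀ (u k) ≤ (1 + Λ) / κ := fun k => by
    rw [le_div_iff₀ hκ]
    linarith [hu2 k, hb k, mul_nonneg (Nat.cast_nonneg (α := ℝ) k) (hW0 (j (u k)))]
  obtain ⟨v, ψ, hψ, hv⟩ := hR (max 1 ((1 + Λ) / κ)) u
    (fun k => (hu1 k).le.trans (le_max_left _ _)) (fun k => (hub k).trans (le_max_right _ _))
  have hvn : ‖v‖ = 1 := by
    have := hv.norm
    simp only [hu1] at this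
    exact tendsto_nhds_unique this tendsto_const_nhds
  have hWlim : Tendsto (fun k => W (j (u (ψ k)))) atTop (𝓝 0) := by
    refine squeeze_zero' (Eventually.of_forall fun k => hW0 _) ?_
      (tendsto_const_div_atTop_nhds_zero_nat (1 + Λ))
    filter_upwards [eventually_gt_atTop 0] with k hk
    have hk' : (0 : ℝ) < k := by exact_mod_cast hk
    rw [le_div_iff₀ hk']
    have h1 : (k : ℝ) ≤ ψ k := by exact_mod_cast hψ.id_le k
    have h2 := mul_le_mul_of_nonneg_right h1 (hW0 (j (u (ψ k))))
    have h3 := mul_nonneg hκ.le (h₀ (u (ψ k)))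
    linarith [hu2 (ψ k), hb (ψ k)]
  have hWv : W v = 0 := tendsto_nhds_unique ((hW.tendsto v).comp hv) hWlim
  rw [hW1 v hWv, norm_zero] at hvn
  exact zero_ne_one hvn

end Spectral

/-! ### Rellich's theorem -/

section RellichCriterion

open Filter

variable {H : Type*} [NormedAddCommGroup H] [InnerProductSpace ℂ H] [CompleteSpace H]
  {D : Type*} [AddCommGroup D] [Module ℂ D] {j T₀ : D →ₗ[ℂ] H}

omit [CompleteSpace H] in
/-- A bounded set has finite discretizations for a continuous map to a finite-dimensional space. -/
theorem exists_finite_discretization {κ : Type} [Fintype κ] (L : H →L[ℂ] (κ → ℂ)) {A : Set H}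
    {M : ℝ} (hA : ∀ x ∈ A, ‖x‖ ≤ M) {η : ℝ} (hη : 0 < η) :
    ∃ (β : Type) (_ : Fintype β) (F : A → β), ∀ x y, F x = F y → ‖L (x : H) - L (y : H)‖ ≤ 2 * η := by
  have hbd : Bornology.IsBounded (L '' A : Set (κ → ℂ)) := by
    refine isBounded_iff_forall_norm_le.2 ⟨‖L‖ * M, ?_⟩
    rintro _ ⟨x, hx, rfl⟩
    exact (L.le_opNorm _).trans (mul_le_mul_of_nonneg_left (hA x hx) (norm_nonneg L))
  have htb : TotallyBounded (L '' A : Set (κ → ℂ)) :=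
    hbd.isCompact_closure.totallyBounded.subset subset_closure
  obtain ⟨t, ht, hcov⟩ := Metric.totallyBounded_iff.1 htb η hη
  have hc : ∀ x : A, ∃ y : t, L (x : H) ∈ Metric.ball (y : κ → ℂ) η := fun x => by
    obtain ⟨y, hy, hxy⟩ := Set.mem_iUnion₂.1 (hcov (Set.mem_image_of_mem L x.2))
    exact ⟨⟨y, hy⟩, hxy⟩
  choose F hF using hc
  refine ⟨t, ht.fintype, F, fun x y hxy => ?_⟩
  have h2 := hF x
  have h3 := hF y
  rw [← hxy] at h3
  rw [Metric.mem_ball] at h2 h3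
  rw [← dist_eq_norm]
  linarith [dist_triangle_right (L (x : H)) (L (y : H)) (F x : κ → ℂ)]

/-- The Rellich property holds if, up to an arbitrarily small multiple of the form of `T₀`, the norm
is controlled by finitely many functionals. -/
theorem isRellich_of_finite_functionals (h₀ : ∀ u, 0 ≤ qform j T₀ u)
    (h : ∀ ε : ℝ, 0 < ε → ∃ (κ : Type) (_ : Fintype κ) (θ : κ → H) (C : κ → ℝ), (∀ k, 0 ≤ C k) ∧
      ∀ u, ‖j u‖ ^ 2 ≤ ε * qform j T₀ u + ∑ k, C k * ‖inner ℂ (θ k) (j u)‖ ^ 2) :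
    IsRellich j T₀ := by
  intro M u hu hq
  set A : Set H := Set.range fun k => j (u k) with hA
  have hM : 0 ≤ M := (norm_nonneg _).trans (hu 0)
  have htb : TotallyBounded A := by
    refine Metric.totallyBounded_of_finite_discretization fun δ hδ => ?_
    -- differences have form at most `4 * M`, which leads to the constant `8 * (M + 1)`
    obtain ⟨κ, _, θ, C, hC, hb⟩ := h (δ ^ 2 / (8 * (M + 1))) (by positivity)
    obtain ⟨L, hL⟩ : ∃ L : H →L[ℂ] (κ → ℂ), ∀ x i, L x i = inner ℂ (θ i) x :=
      ⟨ContinuousLinearMap.pi fun k => innerSL ℂ (θ k), fun _ _ => rfl⟩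
    set C' := ∑ k, C k with hC'
    have hC'0 : 0 ≤ C' := Finset.sum_nonneg fun k _ => hC k
    set η := δ / (4 * (C' + 1)) with hη
    have hη0 : 0 < η := by positivity
    obtain ⟨β, _, F, hF⟩ := exists_finite_discretization L (A := A) (M := M)
      (by rintro _ ⟨k, rfl⟩; exact hu k) hη0
    refine ⟨ULift β, inferInstance, fun x => ⟨F x⟩, fun x y hxy => ?_⟩
    have h1 := hF x y (congrArg ULift.down hxy)
    obtain ⟨k, hk⟩ := x.2
    obtain ⟨l, hl⟩ := y.2
    rw [← hk, ← hl] at h1 ⊢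
    have h4 : ∀ i, ‖inner ℂ (θ i) (j (u k - u l))‖ ≤ 2 * η := fun i => by
      have := (norm_le_pi_norm (L (j (u k)) - L (j (u l))) i).trans h1
      rwa [Pi.sub_apply, hL, hL, ← inner_sub_right, ← map_sub] at this
    have h5 := hb (u k - u l)
    have h6 : qform j T₀ (u k - u l) ≤ 4 * M := by
      linarith [qform_sub_le h₀ (u k) (u l), hq k, hq l]
    have h7 : ∑ i, C i * ‖inner ℂ (θ i) (j (u k - u l))‖ ^ 2 ≤ C' * (2 * η) ^ 2 := by
      rw [hC', Finset.sum_mul]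
      exact Finset.sum_le_sum fun i _ => mul_le_mul_of_nonneg_left
        (pow_le_pow_left₀ (norm_nonneg _) (h4 i) 2) (hC i)
    have h8 : C' * (2 * η) ^ 2 ≤ δ ^ 2 / 4 := by
      have : C' * (2 * η) ^ 2 = δ ^ 2 / 4 * (C' / (C' + 1) ^ 2) := by
        rw [hη]
        field_simp
        ring
      rw [this]
      refine mul_le_of_le_one_right (by positivity) ((div_le_one (by positivity)).2 ?_)
      nlinarith
    have h9 : δ ^ 2 / (8 * (M + 1)) * qform j T₀ (u k - u l) ≤ δ ^ 2 / 2 := by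
      refine (mul_le_mul_of_nonneg_left h6 (by positivity)).trans ?_
      have : δ ^ 2 / (8 * (M + 1)) * (4 * M) = δ ^ 2 / 2 * (M / (M + 1)) := by
        field_simp
        ring
      rw [this]
      refine mul_le_of_le_one_right (by positivity) ((div_le_one (by positivity)).2 ?_)
      linarith
    have h10 : ‖j (u k) - j (u l)‖ ^ 2 < δ ^ 2 := by
      rw [← map_sub]
      nlinarith
    rw [dist_eq_norm]
    exact lt_of_pow_lt_pow_left₀ 2 hδ.le h10
  have hcpt : IsCompact (closure A) :=
    TotallyBounded.isCompact_of_isClosed htb.closure isClosed_closure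
  obtain ⟨v, _, ψ, hψ, hv⟩ := hcpt.tendsto_subseq (x := fun k => j (u k))
    fun k => subset_closure ⟨k, rfl⟩
  exact ⟨v, ψ, hψ, hv⟩

end RellichCriterion

section Operators

variable {n : ℕ} {S : Type*} [TopologicalSpace S] [ChartedSpace (EuclideanSpace ℝ (Fin n)) S]

variable (n S) in
/-- The space of smooth complex functions. -/
def smoothFun : Submodule ℂ (S → ℂ) where
  carrier := {u | ContMDiff (𝓡 n) 𝓘(ℝ, ℂ) ∞ u}
  add_mem' hu hv := hu.add hv
  zero_mem' := contMDiff_const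
  smul_mem' c _ hu :=
    (contDiff_const_smul (𝕜 := ℝ) (n := ∞) (F := ℂ) c).contMDiff.comp hu

variable [IsManifold (𝓡 n) ∞ S] {σ : Metric n S}

theorem pd_add_smul {f g : EuclideanSpace ℝ (Fin n) → ℂ} {y : EuclideanSpace ℝ (Fin n)}
    (hf : DifferentiableAt ℝ f y) (hg : DifferentiableAt ℝ g y) (c : ℂ) (k : Fin n) :
    pd k (fun z => f z + c * g z) y = pd k f y + c * pd k g y := by
  simp only [pd]
  rw [fderiv_fun_add hf (hg.const_mul c), fderiv_const_mul hg]
  rfl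

theorem laplacian_add_smul {u v : S → ℂ} (hu : ContMDiff (𝓡 n) 𝓘(ℝ, ℂ) ∞ u)
    (hv : ContMDiff (𝓡 n) 𝓘(ℝ, ℂ) ∞ v) (c : ℂ) (p : S) :
    laplacian σ (fun q => u q + c * v q) p = laplacian σ u p + c * laplacian σ v p := by
  have h1 : ∀ i, ∀ y ∈ chartTgt n p, flux σ p (fun q => u q + c * v q) i y
      = flux σ p u i y + c * flux σ p v i y := fun i y hy => by
    have h0 : ∀ k, pd k (fun z => u (pt p z) + c * v (pt p z)) y
        = pd k (fun z => u (pt p z)) y + c * pd k (fun z => v (pt p z)) y := fun k =>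
      pd_add_smul ((contDiffAt_comp_pt hu hy).differentiableAt (by simp))
        ((contDiffAt_comp_pt hv hy).differentiableAt (by simp)) c k
    simp only [flux, h0, Finset.mul_sum, ← Finset.sum_add_distrib]
    exact Finset.sum_congr rfl fun k _ => by ring
  have h2 : ∀ i, pd i (flux σ p (fun q => u q + c * v q) i) (ctr p)
      = pd i (flux σ p u i) (ctr p) + c * pd i (flux σ p v i) (ctr p) := fun i => by
    have he : flux σ p (fun q => u q + c * v q) i
        =ᶠ[𝓝 (ctr p)] fun y => flux σ p u i y + c * flux σ p v i y := by
      filter_upwards [eventually_mem_tgt (ctr_mem p)] with y hy using h1 i y hy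
    rw [← pd_add_smul ((contDiffAt_flux hu (ctr_mem p) i).differentiableAt (by simp))
      ((contDiffAt_flux hv (ctr_mem p) i).differentiableAt (by simp))]
    simp only [pd, he.fderiv_eq]
  simp only [laplacian_eq, chartLap, h2, Finset.sum_add_distrib, ← Finset.mul_sum]
  ring

variable [T2Space S] [CompactSpace S] [MeasurableSpace S] [BorelSpace S]

variable (σ) in
omit [T2Space S] in
theorem integrable_of_continuous {F : Type*} [NormedAddCommGroup F] [SecondCountableTopology F]
    {v : S → F} (hv : Continuous v) : Integrable v (vol σ) :=
  hv.integrable_of_hasCompactSupport (HasCompactSupport.of_compactSpace _)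

variable (σ) in
omit [T2Space S] in
theorem memLp_of_continuous {v : S → ℂ} (hv : Continuous v) (r : ENNReal) : MemLp v r (vol σ) := by
  obtain ⟨C, hC⟩ := isCompact_univ.exists_bound_of_continuousOn hv.continuousOn
  exact MemLp.of_bound hv.aestronglyMeasurable C
    (Filter.Eventually.of_forall fun p => hC p (Set.mem_univ p))

variable (σ) in
/-- The inclusion of the smooth functions into `L²`. -/
noncomputable def incl : smoothFun n S →ₗ[ℂ] Lp ℂ 2 (vol σ) where
  toFun u := (memLp_of_continuous σ u.2.continuous 2).toLp
  map_add' _ _ := rfl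
  map_smul' _ _ := rfl

variable (σ) in
/-- The operator `-Δ` on smooth functions. -/
noncomputable def negLap : smoothFun n S →ₗ[ℂ] Lp ℂ 2 (vol σ) where
  toFun u := -(memLp_of_continuous σ (continuous_laplacian u.2) 2).toLp
  map_add' u v := by
    rw [← neg_add, ← MemLp.toLp_add]
    congr 2
    funext p
    have := laplacian_add_smul (σ := σ) u.2 v.2 1 p
    simp only [one_mul] at this
    exact this
  map_smul' c u := by
    rw [smul_neg, ← MemLp.toLp_const_smul]
    congr 2
    funext p
    have h0 : ∀ p, laplacian σ (fun _ : S => (0 : ℂ)) p = 0 := fun p => by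
      have := laplacian_add_smul (σ := σ) (u := fun _ : S => (0 : ℂ)) (v := fun _ : S => (0 : ℂ))
        contMDiff_const contMDiff_const (-1) p
      simpa using this
    have := laplacian_add_smul (σ := σ) (u := fun _ : S => (0 : ℂ)) contMDiff_const u.2 c p
    simp only [zero_add, h0] at this
    exact this

variable (σ) in
/-- Multiplication by a continuous real function, as an operator on `L²`. -/
noncomputable def mulOp {q : S → ℝ} (hq : Continuous q) : Lp ℂ 2 (vol σ) →L[ℂ] Lp ℂ 2 (vol σ) :=
  (ContinuousLinearMap.mul ℂ ℂ).holderL (vol σ) ⊤ 2 2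
    (memLp_of_continuous σ (Complex.continuous_ofReal.comp hq) ⊤).toLp

omit [T2Space S] in
theorem coeFn_mulOp {q : S → ℝ} (hq : Continuous q) (f : Lp ℂ 2 (vol σ)) :
    mulOp σ hq f =ᵐ[vol σ] fun p => (q p : ℂ) * f p := by
  have h1 := (ContinuousLinearMap.mul ℂ ℂ).coeFn_holder (r := 2)
    (memLp_of_continuous σ (Complex.continuous_ofReal.comp hq) ⊤).toLp f
  filter_upwards [h1, MemLp.coeFn_toLp
    (memLp_of_continuous σ (Complex.continuous_ofReal.comp hq) ⊤)] with p h2 h3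
  rw [h3] at h2
  exact h2

omit [T2Space S] in
theorem coeFn_incl (u : smoothFun n S) : incl σ u =ᵐ[vol σ] (u : S → ℂ) :=
  MemLp.coeFn_toLp (memLp_of_continuous σ u.2.continuous 2)

theorem coeFn_negLap (u : smoothFun n S) :
    negLap σ u =ᵐ[vol σ] fun p => -laplacian σ (u : S → ℂ) p := by
  filter_upwards [Lp.coeFn_neg (memLp_of_continuous σ (continuous_laplacian u.2) 2).toLp,
    MemLp.coeFn_toLp (memLp_of_continuous σ (continuous_laplacian (σ := σ) u.2) 2)] with p h1 h2
  rw [Pi.neg_apply, h2] at h1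
  exact h1

theorem inner_incl_negLap (u w : smoothFun n S) :
    inner ℂ (incl σ u) (negLap σ w)
      = ∫ p, gradDot σ (fun q => (starRingEnd ℂ) ((u : S → ℂ) q)) w p ∂(vol σ) := by
  rw [L2.inner_def, ← neg_neg (∫ p, gradDot σ _ _ p ∂(vol σ)), ← green (contMDiff_star u.2) w.2,
    ← integral_neg]
  refine integral_congr_ae ?_
  filter_upwards [coeFn_incl (σ := σ) u, coeFn_negLap (σ := σ) w] with p h1 h2
  rw [h1, h2, RCLike.inner_apply]
  ring

theorem negLap_symm (u w : smoothFun n S) :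
    inner ℂ (negLap σ u) (incl σ w) = inner ℂ (incl σ u) (negLap σ w) := by
  rw [← inner_conj_symm, inner_incl_negLap, inner_incl_negLap, ← integral_conj]
  refine integral_congr_ae (Filter.Eventually.of_forall fun p => ?_)
  simp only [gradDot_conj, Complex.conj_conj]
  exact gradDot_comm _ _ _

theorem qform_negLap (u : smoothFun n S) :
    qform (incl σ) (negLap σ) u = ∫ p, gradSq σ u p ∂(vol σ) := by
  have h := integrable_of_continuous σ (continuous_gradDot (σ := σ) (contMDiff_star u.2) u.2)
  rw [qform, inner_incl_negLap]
  have h2 := integral_re h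
  simp only [RCLike.re_to_complex] at h2
  rw [← h2]
  refine integral_congr_ae (Filter.Eventually.of_forall fun p => ?_)
  simp only [gradSq_eq, gradDot_comm _ (u : S → ℂ)]

theorem qform_negLap_nonneg (u : smoothFun n S) : 0 ≤ qform (incl σ) (negLap σ) u := by
  rw [qform_negLap]
  exact integral_nonneg fun p => gradSq_nonneg _ p

omit [T2Space S] in
theorem norm_incl_sq (u : smoothFun n S) :
    ENNReal.ofReal (‖incl σ u‖ ^ 2) = ∫⁻ p, ‖(u : S → ℂ) p‖ₑ ^ 2 ∂(vol σ) := by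
  have h1 : ‖incl σ u‖ ^ 2 = ∫ p, ‖(u : S → ℂ) p‖ ^ 2 ∂(vol σ) := by
    rw [← inner_self_eq_norm_sq (𝕜 := ℂ), L2.inner_def, ← integral_re (L2.integrable_inner _ _)]
    refine integral_congr_ae ?_
    filter_upwards [coeFn_incl (σ := σ) u] with p hp
    rw [hp, inner_self_eq_norm_sq (𝕜 := ℂ)]
  rw [h1, ofReal_integral_eq_lintegral_ofReal
    (integrable_of_continuous σ (v := fun p => ‖(u : S → ℂ) p‖ ^ 2) (u.2.continuous.norm.pow 2))
    (Filter.Eventually.of_forall fun p => sq_nonneg _)]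
  refine lintegral_congr fun p => ?_
  rw [ENNReal.ofReal_pow (norm_nonneg _), ofReal_norm]

/-- Rellich's theorem: smooth functions bounded in `L²` together with their Dirichlet integrals are
relatively compact in `L²`. -/
theorem isRellich_negLap : IsRellich (incl σ) (negLap σ) := by
  refine isRellich_of_finite_functionals qform_negLap_nonneg fun ε hε => ?_
  obtain ⟨κ, _, N, C, hN, hb⟩ := meanBound_univ σ ε.toNNReal (Real.toNNReal_pos.2 hε)
  refine ⟨κ, inferInstance, fun k => indicatorConstLp 2 (hN k) (measure_ne_top _ _) (1 : ℂ),
    fun k => C k, fun k => (C k).coe_nonneg, fun u => ?_⟩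
  have h1 := hb u u.2
  rw [Measure.restrict_univ, ← norm_incl_sq, ← ofReal_integral_eq_lintegral_ofReal
    (integrable_of_continuous σ (continuous_gradSq u.2))
    (Filter.Eventually.of_forall fun p => gradSq_nonneg _ p), ← qform_negLap] at h1
  have h2 : ∀ k, (C k : ENNReal) * ‖∫ p in N k, (u : S → ℂ) p ∂(vol σ)‖ₑ ^ 2
      = ENNReal.ofReal (C k * ‖inner ℂ (indicatorConstLp 2 (hN k)
        (measure_ne_top (vol σ) _) (1 : ℂ)) (incl σ u)‖ ^ 2) := fun k => by
    rw [L2.inner_indicatorConstLp_one, ENNReal.ofReal_mul (C k).coe_nonneg,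
      ENNReal.ofReal_coe_nnreal, ENNReal.ofReal_pow (norm_nonneg _), ofReal_norm,
      setIntegral_congr_ae (hN k) ((coeFn_incl (σ := σ) u).mono fun p hp _ => hp)]
  have h3 : 0 ≤ qform (incl σ) (negLap σ) u := qform_negLap_nonneg u
  simp only [h2] at h1
  rw [← ENNReal.ofReal_sum_of_nonneg fun k _ => by positivity, ← ENNReal.ofReal_coe_nnreal,
    Real.coe_toNNReal _ hε.le, ← ENNReal.ofReal_mul hε.le, ← ENNReal.ofReal_add (by positivity)
    (Finset.sum_nonneg fun k _ => by positivity)] at h1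
  refine (ENNReal.ofReal_le_ofReal_iff ?_).1 h1
  exact add_nonneg (mul_nonneg hε.le h3) (Finset.sum_nonneg fun k _ => by positivity)

omit [T2Space S] in
theorem mulOp_symm {q : S → ℝ} (hq : Continuous q) (f g : Lp ℂ 2 (vol σ)) :
    inner ℂ (mulOp σ hq f) g = inner ℂ f (mulOp σ hq g) := by
  rw [L2.inner_def, L2.inner_def]
  refine integral_congr_ae ?_
  filter_upwards [coeFn_mulOp hq f, coeFn_mulOp hq g] with p h1 h2
  rw [h1, h2, RCLike.inner_apply, RCLike.inner_apply, map_mul, Complex.conj_ofReal]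
  ring

omit [T2Space S] in
theorem inner_mulOp_re {q : S → ℝ} (hq : Continuous q) (f : Lp ℂ 2 (vol σ)) :
    (inner ℂ f (mulOp σ hq f)).re = ∫ p, q p * ‖f p‖ ^ 2 ∂(vol σ) := by
  rw [L2.inner_def]
  have h := integral_re (L2.integrable_inner (𝕜 := ℂ) f (mulOp σ hq f))
  simp only [RCLike.re_to_complex] at h
  rw [← h]
  refine integral_congr_ae ?_
  filter_upwards [coeFn_mulOp hq f] with p h1
  rw [h1, RCLike.inner_apply, mul_assoc, Complex.re_ofReal_mul, Complex.mul_conj,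
    Complex.ofReal_re, Complex.normSq_eq_norm_sq]

omit [T2Space S] in
theorem integrable_mul_norm_sq {q : S → ℝ} (hq : Continuous q) (f : Lp ℂ 2 (vol σ)) :
    Integrable (fun p => q p * ‖f p‖ ^ 2) (vol σ) := by
  have h := (L2.integrable_inner (𝕜 := ℂ) f (mulOp σ hq f)).re
  refine h.congr ?_
  filter_upwards [coeFn_mulOp hq f] with p h1
  rw [h1, RCLike.inner_apply, mul_assoc, RCLike.re_to_complex, Complex.re_ofReal_mul,
    Complex.mul_conj, Complex.ofReal_re, Complex.normSq_eq_norm_sq]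

omit [T2Space S] in
/-- The form of a potential which is positive almost everywhere has no kernel. -/
theorem eq_zero_of_integral_mul_norm_sq {q : S → ℝ} (hq : Continuous q)
    (hpos : ∀ᵐ p ∂(vol σ), 0 < q p) {f : Lp ℂ 2 (vol σ)}
    (h : ∫ p, q p * ‖f p‖ ^ 2 ∂(vol σ) = 0) : f = 0 := by
  have h0 : 0 ≤ᵐ[vol σ] fun p => q p * ‖f p‖ ^ 2 :=
    hpos.mono fun p hp => mul_nonneg hp.le (sq_nonneg _)
  rw [integral_eq_zero_iff_of_nonneg_ae h0 (integrable_mul_norm_sq hq f)] at h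
  refine Lp.ext ?_
  filter_upwards [h, hpos, Lp.coeFn_zero ℂ 2 (vol σ)] with p h1 h2 h3
  rw [h3]
  simpa [h2.ne'] using h1

end Operators

/-! ### Schrödinger operators -/

section Schrodinger

open Filter

variable {n : ℕ} {S : Type*} [TopologicalSpace S] [ChartedSpace (EuclideanSpace ℝ (Fin n)) S]
  [IsManifold (𝓡 n) ∞ S] {σ : Metric n S} [T2Space S] [CompactSpace S]
  [MeasurableSpace S] [BorelSpace S] {q : S → ℝ}

variable (σ) in
/-- The operator `-(n-1) Δ + q` on smooth functions, with values in `L²`. -/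
noncomputable def schrOp (hq : Continuous q) : smoothFun n S →ₗ[ℂ] Lp ℂ 2 (vol σ) :=
  ((n : ℂ) - 1) • negLap σ + (mulOp σ hq).toLinearMap ∘ₗ incl σ

theorem coeFn_schrOp (hq : Continuous q) (φ : smoothFun n S) :
    schrOp σ hq φ =ᵐ[vol σ] fun p => -((n : ℂ) - 1) * laplacian σ (φ : S → ℂ) p
      + (q p : ℂ) * (φ : S → ℂ) p := by
  have h0 : schrOp σ hq φ = ((n : ℂ) - 1) • negLap σ φ + mulOp σ hq (incl σ φ) := rfl
  rw [h0]
  filter_upwards [Lp.coeFn_add (((n : ℂ) - 1) • negLap σ φ) (mulOp σ hq (incl σ φ)),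
    Lp.coeFn_smul ((n : ℂ) - 1) (negLap σ φ), coeFn_negLap (σ := σ) φ,
    coeFn_mulOp hq (incl σ φ), coeFn_incl (σ := σ) φ] with p h1 h2 h3 h4 h5
  rw [h1, Pi.add_apply, h2, Pi.smul_apply, h3, h4, h5, smul_eq_mul]
  ring

theorem schrOp_symm (hq : Continuous q) (u w : smoothFun n S) :
    inner ℂ (schrOp σ hq u) (incl σ w) = inner ℂ (incl σ u) (schrOp σ hq w) := by
  have h0 : ∀ φ, schrOp σ hq φ = ((n : ℂ) - 1) • negLap σ φ + mulOp σ hq (incl σ φ) := fun _ => rfl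
  rw [h0, h0, inner_add_left, inner_add_right, inner_smul_left, inner_smul_right, negLap_symm,
    mulOp_symm]
  simp

theorem qform_schrOp (hq : Continuous q) (u : smoothFun n S) :
    qform (incl σ) (schrOp σ hq) u = ((n : ℝ) - 1) * qform (incl σ) (negLap σ) u
      + (inner ℂ (incl σ u) (mulOp σ hq (incl σ u))).re := by
  have h0 : schrOp σ hq u = ((n : ℂ) - 1) • negLap σ u + mulOp σ hq (incl σ u) := rfl
  have h1 : ((n : ℂ) - 1) = (((n : ℝ) - 1 : ℝ) : ℂ) := by push_cast; rfl
  rw [qform, h0, inner_add_right, inner_smul_right, Complex.add_re, h1, Complex.re_ofReal_mul]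
  rfl

theorem abs_qform_schrOp_sub_le (hq : Continuous q) (u : smoothFun n S) :
    |qform (incl σ) (schrOp σ hq) u - ((n : ℝ) - 1) * qform (incl σ) (negLap σ) u|
      ≤ ‖mulOp σ hq‖ * ‖incl σ u‖ ^ 2 := by
  rw [qform_schrOp, add_sub_cancel_left]
  refine (Complex.abs_re_le_norm _).trans ((norm_inner_le_norm _ _).trans ?_)
  calc ‖incl σ u‖ * ‖mulOp σ hq (incl σ u)‖
      ≤ ‖incl σ u‖ * (‖mulOp σ hq‖ * ‖incl σ u‖) := by
        gcongr
        exact (mulOp σ hq).le_opNorm _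
    _ = _ := by ring

theorem inner_schrOp (hq : Continuous q) (φ : smoothFun n S) (v : Lp ℂ 2 (vol σ)) {v' : S → ℂ}
    (hv : v =ᵐ[vol σ] v') :
    inner ℂ (schrOp σ hq φ) v = ∫ p, v' p * (starRingEnd ℂ) (-((n : ℂ) - 1) *
      laplacian σ (φ : S → ℂ) p + (q p : ℂ) * (φ : S → ℂ) p) ∂(vol σ) := by
  rw [L2.inner_def]
  refine integral_congr_ae ?_
  filter_upwards [coeFn_schrOp hq φ, hv] with p h1 h2
  rw [h1, h2, RCLike.inner_apply]

omit [T2Space S] in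
theorem inner_incl (φ : smoothFun n S) (v : Lp ℂ 2 (vol σ)) {v' : S → ℂ} (hv : v =ᵐ[vol σ] v') :
    inner ℂ (incl σ φ) v = ∫ p, v' p * (starRingEnd ℂ) ((φ : S → ℂ) p) ∂(vol σ) := by
  rw [L2.inner_def]
  refine integral_congr_ae ?_
  filter_upwards [coeFn_incl (σ := σ) φ, hv] with p h1 h2
  rw [h1, h2, RCLike.inner_apply]

omit [T2Space S] in
theorem tendsto_incl_iff {u : ℕ → smoothFun n S} {v : S → ℂ} (hv : MemLp v 2 (vol σ)) :
    Tendsto (fun k => incl σ (u k)) atTop (𝓝 hv.toLp) ↔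
      Tendsto (fun k => eLpNorm ((u k : S → ℂ) - v) 2 (vol σ)) atTop (𝓝 0) :=
  Lp.tendsto_Lp_iff_tendsto_eLpNorm'' (fun k => (u k : S → ℂ))
    (fun k => memLp_of_continuous σ (u k).2.continuous 2) v hv

omit [T2Space S] in
theorem incl_ne_zero {u : smoothFun n S} (hu : (u : S → ℂ) ≠ 0) : incl σ u ≠ 0 := fun h => by
  apply hu
  refine Continuous.ae_eq_iff_eq (vol σ) u.2.continuous continuous_const |>.1 ?_
  filter_upwards [coeFn_incl (σ := σ) u, Lp.coeFn_zero ℂ 2 (vol σ)] with p h1 h2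
  rw [← h1, h, h2]
  rfl

/-- `μ` is an eigenvalue of `-(n-1) Δ + q` in the sense of distributions. -/
def IsWeakEigenvalue (σ : Metric n S) (q : S → ℝ) (μ : ℝ) : Prop :=
  ∃ v : S → ℂ, MemSobolev σ v ∧ (¬ v =ᵐ[vol σ] 0) ∧
    ∀ φ : S → ℂ, ContMDiff (𝓡 n) 𝓘(ℝ, ℂ) ∞ φ →
      ∫ p, v p * (starRingEnd ℂ) (-((n : ℂ) - 1) * laplacian σ φ p + (q p : ℂ) * φ p) ∂(vol σ)
        = (μ : ℂ) * ∫ p, v p * (starRingEnd ℂ) (φ p) ∂(vol σ)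

/-- A Schrödinger operator on a compact manifold has a smallest eigenvalue, which is the largest
lower bound of its quadratic form. -/
theorem exists_isLeast_weakEigenvalue [Nonempty S] (hn : 2 ≤ n) (hq : Continuous q) :
    ∃ lam : ℝ, IsLeast {μ | IsWeakEigenvalue σ q μ} lam ∧
      (∀ w, lam * ‖incl σ w‖ ^ 2 ≤ qform (incl σ) (schrOp σ hq) w) ∧
      ∀ c, (∀ w, c * ‖incl σ w‖ ^ 2 ≤ qform (incl σ) (schrOp σ hq) w) → c ≤ lam := by
  have hκ : (0 : ℝ) < (n : ℝ) - 1 := by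
    have : (2 : ℝ) ≤ n := by exact_mod_cast hn
    linarith
  have hne : ∃ u : smoothFun n S, incl σ u ≠ 0 := by
    refine ⟨⟨fun _ => 1, contMDiff_const⟩, incl_ne_zero fun h => ?_⟩
    obtain ⟨p⟩ := ‹Nonempty S›
    exact one_ne_zero (congrFun h p)
  obtain ⟨lam, v, u, hmin, hmax, hv1, hv, hC, heq⟩ := exists_ground_state (schrOp_symm hq) hκ
    (abs_qform_schrOp_sub_le hq) qform_negLap_nonneg (isRellich_negLap (σ := σ)) hne
  refine ⟨lam, ⟨⟨v, ⟨Lp.memLp v, fun k => u k, fun k => (u k).2, ?_, ?_⟩, ?_, ?_⟩, ?_⟩, hmin, hmax⟩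
  · rw [← tendsto_incl_iff (Lp.memLp v), Lp.toLp_coeFn]
    exact hv
  · intro ε hε
    obtain ⟨K, hK⟩ := hC ε hε
    refine ⟨K, fun k hk l hl => ?_⟩
    have := hK k hk l hl
    rwa [qform_negLap] at this
  · intro h
    have h0 : v = 0 := (Lp.eq_zero_iff_ae_eq_zero).2 h
    rw [h0, norm_zero] at hv1
    exact zero_ne_one hv1
  · intro φ hφ
    have := heq ⟨φ, hφ⟩
    rwa [inner_schrOp hq ⟨φ, hφ⟩ v (ae_eq_refl _), inner_incl ⟨φ, hφ⟩ v (ae_eq_refl _)] at this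
  · rintro μ ⟨w, ⟨hw, u', hu', hlim, hC'⟩, hw0, hweq⟩
    set U : ℕ → smoothFun n S := fun k => ⟨u' k, hu' k⟩ with hU
    refine le_of_weak_eigenvalue (schrOp_symm hq) hκ (abs_qform_schrOp_sub_le hq) hmin
      (v := hw.toLp) (u := U) ?_ ((tendsto_incl_iff hw).2 hlim) ?_ ?_
    · intro h0
      apply hw0
      have h1 := hw.coeFn_toLp
      rw [h0] at h1
      exact h1.symm.trans (Lp.coeFn_zero ℂ 2 (vol σ))
    · intro ε hε
      obtain ⟨K, hK⟩ := hC' ε hε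
      refine ⟨K, fun k hk l hl => ?_⟩
      rw [qform_negLap]
      exact hK k hk l hl
    · intro φ
      rw [inner_schrOp hq φ _ hw.coeFn_toLp, inner_incl φ _ hw.coeFn_toLp]
      exact hweq φ φ.2

/-- A lower bound of the quadratic form is a lower bound of the classical eigenvalues. -/
theorem le_of_classical_eigenvalue (hq : Continuous q) {lam μ : ℝ}
    (hmin : ∀ w, lam * ‖incl σ w‖ ^ 2 ≤ qform (incl σ) (schrOp σ hq) w) {v : S → ℂ}
    (hv : ContMDiff (𝓡 n) 𝓘(ℝ, ℂ) ∞ v) (hv0 : v ≠ 0)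
    (heq : ∀ p, -((n : ℂ) - 1) * laplacian σ v p + (q p : ℂ) * v p = (μ : ℂ) * v p) : lam ≤ μ := by
  set u : smoothFun n S := ⟨v, hv⟩ with hu
  have h1 : schrOp σ hq u = (μ : ℂ) • incl σ u := by
    refine Lp.ext ?_
    filter_upwards [coeFn_schrOp hq u, Lp.coeFn_smul (μ : ℂ) (incl σ u), coeFn_incl (σ := σ) u]
      with p h1 h2 h3
    rw [h1, h2, Pi.smul_apply, h3, smul_eq_mul]
    exact heq p
  have h2 := hmin u
  have h3 : qform (incl σ) (schrOp σ hq) u = μ * ‖incl σ u‖ ^ 2 := by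
    rw [qform, h1, inner_smul_right, Complex.re_ofReal_mul, ← inner_self_eq_norm_sq (𝕜 := ℂ)]
    rfl
  rw [h3] at h2
  have h4 : 0 < ‖incl σ u‖ ^ 2 := by
    have : ‖incl σ u‖ ≠ 0 := norm_ne_zero_iff.2 (incl_ne_zero hv0)
    positivity
  exact le_of_mul_le_mul_right h2 h4

/-- Adding a large multiple of a potential which is positive almost everywhere makes a Schrödinger
operator uniformly positive. -/
theorem exists_schrOp_lower_bound (hn : 2 ≤ n) (hq : Continuous q) {V : S → ℝ}
    (hVc : Continuous V) (hV : ∀ᵐ p ∂(vol σ), 0 < V p) :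
    ∃ m₀ c : ℝ, 0 ≤ m₀ ∧ 0 < c ∧ ∀ m, m₀ ≤ m → ∀ (q' : S → ℝ) (hq' : Continuous q'),
      (∀ p, q' p = q p + m * V p) → ∀ u,
        c * ‖incl σ u‖ ^ 2 ≤ qform (incl σ) (schrOp σ hq') u := by
  have hκ : (0 : ℝ) < (n : ℝ) - 1 := by
    have : (2 : ℝ) ≤ n := by exact_mod_cast hn
    linarith
  obtain ⟨m₀, c, hm₀, hc, h⟩ := exists_uniform_lower_bound hκ (abs_qform_schrOp_sub_le (σ := σ) hq)
    qform_negLap_nonneg isRellich_negLap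
    (W := fun x : Lp ℂ 2 (vol σ) => (inner ℂ x (mulOp σ hVc x)).re)
    (Complex.continuous_re.comp (continuous_id.inner (mulOp σ hVc).continuous))
    (fun x => by
      rw [inner_mulOp_re]
      exact integral_nonneg_of_ae (hV.mono fun p hp => mul_nonneg hp.le (sq_nonneg _)))
    (fun x hx => eq_zero_of_integral_mul_norm_sq hVc hV (by rwa [inner_mulOp_re] at hx))
    (fun r x => by
      rw [map_smul, inner_smul_left, inner_smul_right, Complex.conj_ofReal, ← mul_assoc,
        ← Complex.ofReal_mul, Complex.re_ofReal_mul, sq])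
  refine ⟨m₀, c, hm₀, hc, fun m hm q' hq' hqq' u => (h m hm u).trans (le_of_eq ?_)⟩
  rw [qform_schrOp, qform_schrOp, add_assoc]
  congr 1
  rw [inner_mulOp_re, inner_mulOp_re, inner_mulOp_re, ← integral_const_mul, ← integral_add
    (integrable_mul_norm_sq hq _) ((integrable_mul_norm_sq hVc _).const_mul m)]
  refine integral_congr_ae (Eventually.of_forall fun p => ?_)
  simp only [hqq']
  ring

end Schrodinger

end YMHiggs

/-! ### The Yang-Mills-Higgs eigenvalue problem -/

theorem theorem7p4 {n : ℕ} (hn : 2 ≤ n)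
    {S : Type*} [TopologicalSpace S] [T2Space S] [CompactSpace S] [Nonempty S]
    [ChartedSpace (EuclideanSpace ℝ (Fin n)) S] [IsManifold (𝓡 n) ∞ S]
    [MeasurableSpace S] [BorelSpace S] (σ : YMHiggs.Metric n S)
    {d : ℕ} {G : Type*} [TopologicalSpace G] [T2Space G] [CompactSpace G] [ConnectedSpace G]
    [ChartedSpace (EuclideanSpace ℝ (Fin d)) G] [Group G] [LieGroup (𝓡 d) ∞ G]
    [LieAlgebra.IsSemisimple ℝ (GroupLieAlgebra (𝓡 d) G)]
    {ι : Type*} (Z : VectorBundleCore ℝ S (EuclideanSpace ℝ (Fin d)) ι) [Z.IsContMDiff (𝓡 n) ∞]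
    (hZ : YMHiggs.IsAdjointBundle G Z)
    (A : YMHiggs.GaugeConnection G (n := n) Z) (Φ : YMHiggs.HiggsField n Z)
    (α₁ α₂ : ℝ) (hα₁ : 0 < α₁) (hα₂ : 0 < α₂)
    (hV : ∀ᵐ p ∂(YMHiggs.vol σ), 0 < Φ.potential p) :
    ∃ m₀ c : ℝ, 0 ≤ m₀ ∧ 0 < c ∧ ∀ m : ℝ, m₀ ≤ m → ∃ μ₀ : ℝ,
      c ≤ μ₀ ∧
      IsLeast {μ : ℝ | YMHiggs.IsEigenvalue σ A Φ α₁ α₂ m μ} μ₀ ∧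
      ∀ μ : ℝ, YMHiggs.IsClassicalEigenvalue σ A Φ α₁ α₂ m μ → μ₀ ≤ μ := by
  -- the zeroth order coefficient without the potential term, and the potential term
  set q₀ : S → ℝ := fun p => -((n : ℝ) / 2) * YMHiggs.scalarCurvature σ p
    + α₁ * ((n : ℝ) / 8) * A.normSq σ p + α₂ * ((n : ℝ) / 4) * Φ.kinetic A σ p with hq₀
  set V : S → ℝ := fun p => α₂ * ((n : ℝ) / 2) * Φ.potential p with hVdef
  have hq₀c : Continuous q₀ :=
    ((continuous_const.mul (YMHiggs.continuous_scalarCurvature σ)).add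
      (continuous_const.mul (YMHiggs.continuous_normSq A σ))).add
      (continuous_const.mul (YMHiggs.continuous_kinetic A σ Φ hZ))
  have hVc : Continuous V := continuous_const.mul (YMHiggs.continuous_potential Φ)
  have hVpos : ∀ᵐ p ∂(YMHiggs.vol σ), 0 < V p := hV.mono fun p hp => by
    have hn' : (0 : ℝ) < n := by exact_mod_cast (by omega : 0 < n)
    exact mul_pos (by positivity) hp
  obtain ⟨m₀, c, hm₀, hc, hlow⟩ := YMHiggs.exists_schrOp_lower_bound hn hq₀c hVc hVpos
  refine ⟨m₀, c, hm₀, hc, fun m hm => ?_⟩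
  have hqc : Continuous fun p => q₀ p + m * V p := hq₀c.add (continuous_const.mul hVc)
  have hop : ∀ (φ : S → ℂ) p, YMHiggs.ellipticOp σ A Φ α₁ α₂ m φ p
      = -((n : ℂ) - 1) * YMHiggs.laplacian σ φ p + ((q₀ p + m * V p : ℝ) : ℂ) * φ p := fun φ p => by
    rw [YMHiggs.ellipticOp]
    congr 3
    simp only [hq₀, hVdef]
    ring
  have hiff : ∀ μ, YMHiggs.IsEigenvalue σ A Φ α₁ α₂ m μ
      ↔ YMHiggs.IsWeakEigenvalue σ (fun p => q₀ p + m * V p) μ := fun μ => by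
    simp only [YMHiggs.IsEigenvalue, YMHiggs.IsWeakEigenvalue, hop]
  obtain ⟨lam, hleast, hmin, hmax⟩ := YMHiggs.exists_isLeast_weakEigenvalue hn hqc
  refine ⟨lam, hmax c (hlow m hm _ hqc fun _ => rfl), ?_, ?_⟩
  · simp only [hiff]
    exact hleast
  · rintro μ ⟨v, hv, hv0, heq⟩
    refine YMHiggs.le_of_classical_eigenvalue hqc hmin hv hv0 fun p => ?_
    rw [← hop]
    exact heq p
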